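/- **Setting.** Let $k$ be a global function field of characteristic $p$ with full field of constants ${\mathbb F}_r$, let $\infty$ be a place of $k$ of degree $d_\infty$ over ${\mathbb F}_r$, and let $A$ be the ring of elements of $k$ that are integral at all places other than $\infty$. For a place $w$ let $k_w$ be the completion of $k$ with the normalized absolute value, $\bar k_w$ an algebraic closure and ${\mathbb C}_w$ its completion. Fix a uniformizer $\pi$ of $K=k_\infty$ and $\pi_*\in{\mathbb C}_\infty$ with $\pi_*^{d_\infty}=\pi$. Call $\alpha\in K^*$ positive if $\alpha=\pi^n\langle\alpha\rangle$ with $n\in{\mathbb Z}$ and $\langle\alpha\rangle$ a $1$-unit. For nonzero ideals $I$ of $A$ let $\deg I=\dim_{{\mathbb F}_r}A/I$, and let $I\mapsto\langle I\rangle$ be the unique multiplicative map to the $1$-units of ${\mathbb C}_\infty$ with $\langle (a)\rangle=\langle a\rangle$ for positive $a\in A$. For a $1$-unit $u$ and $y\in{\mathbb Z}_p$, $u^y$ is the usual $p$-adic power. For $s=(x,y)\in S_\infty={\mathbb C}_\infty^*\times{\mathbb Z}_p$ put $I^{s}=x^{\deg I}\langle I\rangle^{y}$, and put $-s=(x^{-1},-y)$.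 Let $I^{s_1}=\pi_*^{-\deg I}\langle I\rangle$, let ${\mathbb V}=k(\{I^{s_1}\})\subset{\mathbb C}_\infty$, and let ${\mathcal O}_{\mathbb V}$ be the integral closure of $A$ in ${\mathbb V}$. Let $v\neq\infty$ be a place of $k$ of degree $d_v$ and $\sigma:{\mathbb V}\to\bar k_v$ an embedding over $k$. Let $f_\sigma$ be the residue degree of $k_\sigma=k_v(\sigma({\mathbb V}))$ over $k_v$, and let $S_\sigma={\mathbb Z}_p\times{\mathbb Z}/(r^{d_vf_\sigma}-1)$. For a unit $\beta$ of the integers of $k_\sigma$ and $y=(y_0,y_1)\in S_\sigma$ let $\beta^y=\omega(\beta)^{y_1}\langle\beta\rangle^{y_0}$, where $\beta=\omega(\beta)\langle\beta\rangle$, $\omega(\beta)^{r^{d_vf_\sigma}-1}=1$ and $\langle\beta\rangle$ is a $1$-unit. For $I$ prime to $v$ and $s_\sigma=(x,y)\in{\mathbb C}_v^*\times S_\sigma$ put $I^{s_\sigma}=x^{\deg I}\sigma(I^{s_1})^{y}$, and put $-s_\sigma=(x^{-1},-y)$. A Dirichlet series converges absolutely at a point if its terms tend to $0$ as $\deg I\to\infty$.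 An entire function on ${\mathbb C}_w^*\times Y$ (where $(w,Y)=(\infty,{\mathbb Z}_p)$ or $(v,S_\sigma)$) is a family $(g_y)_{y\in Y}$ of power series over ${\mathbb C}_w$, each converging on all of ${\mathbb C}_w$, such that $y\mapsto g_y$ is uniformly continuous with respect to uniform convergence on each bounded subset of ${\mathbb C}_w$; its value at $(x,y)$ is $g_y(1/x)$. It continues a Dirichlet series if the series converges absolutely in some half-plane $|x|\ge t$ (with $t>0$) and the series has sum $g_y(1/x)$ at every point $(x,y)$ where it converges absolutely. **The motivic class.** $L(s)=\sum_I b_I I^{-s}$ ($I$ running over the nonzero ideals of $A$, $s\in S_\infty$) is in the motivic class $\mathfrak M$ if (1) all $b_I\in A$; (2) $L(s)$ converges absolutely in some half-plane $\{(x,y)\in S_\infty : |x|_\infty\ge t\}$, $t>0$; (3) for each integer $j\ge0$ the formal power series $L(\pi_*^jx,-j)$ in $x^{-1}$ is a polynomial in $x^{-1}$ with coefficients in ${\mathcal O}_{\mathbb V}$, and its degree is $O(\log j)$ as $j\to\infty$. **Theorem.** Let $L(s)=\sum_I b_II^{-s}$ be in the motivic class $\mathfrak M$. 1. $L(s)$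 is continued by an entire function $(g_y)$ on $S_\infty$ which is essentially algebraic: for each integer $j\ge 0$, $g_{-j}(\pi_*^{-j}x^{-1})\in{\mathbb V}[x^{-1}]$. 2. For every place $v\ne\infty$ and every embedding $\sigma:{\mathbb V}\to\bar k_v$ over $k$, the $v$-adic interpolation $L(s_\sigma)=\sum_{I\text{ prime to }v}b_II^{-s_\sigma}$ is continued by an entire function $(g_y)$ on ${\mathbb C}_v^*\times S_\sigma$ which is essentially algebraic: for each integer $j\ge0$, $g_{(-j,-j)}(x^{-1})\in\sigma({\mathbb V})[x^{-1}]$. -/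

import Mathlib

open Filter Topology
open scoped PowerSeries Polynomial

noncomputable section

/-! ### Global function fields and their places -/

/-- `k` is a global function field with full field of constants the finite field `Fq`: it is finite
over a rational function field `Fq(x)`, and `Fq` is algebraically closed in `k`. These are exactly
the function fields of smooth, projective, geometrically connected curves `C` over `Fq`. -/
def IsGlobalFunctionField (Fq k : Type*) [Field Fq] [Field k] [Algebra Fq k] : Prop :=
  (∃ x : k, Transcendental Fq x ∧ FiniteDimensional (IntermediateField.adjoin Fq {x}) k) ∧
    ∀ a : k, IsAlgebraic Fq a → a ∈ Set.range (algebraMap Fq k)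

/-- The valuation ring `{x | |x| ≤ 1}` of a non-Archimedean absolute value. -/
def absRing {k : Type*} [Field k] (v : AbsoluteValue k ℝ) (hv : IsNonarchimedean v) :
    ValuationSubring k where
  carrier := {x | v x ≤ 1}
  mul_mem' {a b} ha hb := by
    change v (a * b) ≤ 1
    rw [map_mul]
    exact mul_le_one₀ ha (v.nonneg b) hb
  one_mem' := by simp
  add_mem' {a b} ha hb := (hv a b).trans (max_le ha hb)
  zero_mem' := by simp
  neg_mem' {a} ha := by simpa using ha
  mem_or_inv_mem' a := by
    change v a ≤ 1 ∨ v a⁻¹ ≤ 1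
    rw [map_inv₀]
    rcases le_total (v a) 1 with h | h
    · exact Or.inl h
    · exact Or.inr (inv_le_one_of_one_le₀ h)

/-- A place of the field `k`, given by its normalized absolute value: a discrete absolute value
for which a uniformizer has absolute value `q⁻¹`, where `q` is the order of the residue field.
For a global function field the places correspond to the closed points of the curve. -/
@[ext]
structure Place (k : Type*) [Field k] where
  /-- the normalized absolute value -/
  abs : AbsoluteValue k ℝ
  nonarch : IsNonarchimedean abs
  normalized : ∃ ϖ : k, 0 < abs ϖ ∧ abs ϖ < 1 ∧ (∀ x : k, abs x < 1 → abs x ≤ abs ϖ) ∧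
    abs ϖ = (Nat.card (IsLocalRing.ResidueField (absRing abs nonarch)) : ℝ)⁻¹

namespace Place

variable {k : Type*} [Field k] (w : Place k)

/-- The residue field of a place. -/
abbrev Residue : Type _ := IsLocalRing.ResidueField (absRing w.abs w.nonarch)

theorem abs_algebraMap_le (Fq : Type*) [Field Fq] [Finite Fq] [Algebra Fq k] (c : Fq) :
    w.abs (algebraMap Fq k c) ≤ 1 := by
  by_cases hc : c = 0
  · simp [hc]
  · obtain ⟨n, hn, h⟩ := isOfFinOrder_iff_pow_eq_one.1 (isOfFinOrder_of_finite (Units.mk0 c hc))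
    have h1 : c ^ n = 1 := by simpa using congrArg Units.val h
    have h2 : w.abs (algebraMap Fq k c) ^ n = 1 := by
      rw [← map_pow, ← map_pow, h1, map_one, map_one]
    exact ((pow_eq_one_iff_of_nonneg (w.abs.nonneg _) hn.ne').1 h2).le

/-- The constants are integral at every place, so that the residue field is an `Fq`-algebra. -/
instance (Fq : Type*) [Field Fq] [Finite Fq] [Algebra Fq k] :
    Algebra Fq (absRing w.abs w.nonarch) :=
  ((algebraMap Fq k).codRestrict (absRing w.abs w.nonarch).toSubring
    (fun c => w.abs_algebraMap_le Fq c)).toAlgebra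

/-- The degree over `Fq` of a place. -/
def deg (Fq : Type*) [Field Fq] [Finite Fq] [Algebra Fq k] : ℕ := Module.finrank Fq w.Residue

/-- The completion of `k` at `w`. -/
abbrev Local : Type _ := w.abs.Completion

instance : IsUltrametricDist (WithAbs w.abs) :=
  IsUltrametricDist.isUltrametricDist_of_forall_norm_add_le_max_norm
    (fun x y => w.nonarch x.ofAbs y.ofAbs)

instance : IsUltrametricDist w.Local := by
  refine IsUltrametricDist.isUltrametricDist_of_forall_norm_add_le_max_norm fun x y => ?_
  induction x, y using UniformSpace.Completion.induction_on₂ with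
  | hp => exact isClosed_le (by fun_prop) (by fun_prop)
  | ih a b =>
    rw [← UniformSpace.Completion.coe_add]
    simpa only [UniformSpace.Completion.norm_coe] using IsUltrametricDist.norm_add_le_max a b

instance : NontriviallyNormedField w.Local where
  non_trivial := by
    obtain ⟨ϖ, h0, h1, -⟩ := w.normalized
    refine ⟨((WithAbs.toAbs w.abs ϖ⁻¹ : WithAbs w.abs) : w.Local), ?_⟩
    rw [UniformSpace.Completion.norm_coe, WithAbs.norm_toAbs_eq, map_inv₀]
    exact (one_lt_inv₀ h0).2 h1

/-- The algebraic closure of the completion at `w`, with the canonical (spectral) extension of the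
absolute value. -/
abbrev AlgCl : Type _ := AlgebraicClosure w.Local

instance : NormedField w.AlgCl := spectralNorm.normedField w.Local w.AlgCl

/-- The completion of the algebraic closure of the completion of `k` at `w`. -/
abbrev Cp : Type _ := UniformSpace.Completion w.AlgCl

instance : IsUltrametricDist w.AlgCl :=
  IsUltrametricDist.isUltrametricDist_of_forall_norm_add_le_max_norm
    (isNonarchimedean_spectralNorm (K := w.Local) (L := w.AlgCl))

instance : UniformContinuousConstSMul w.Local w.AlgCl where
  uniformContinuous_const_smul c := by
    simp_rw [Algebra.smul_def]
    exact (Ring.uniformContinuousConstSMul w.AlgCl).uniformContinuous_const_smul _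

instance : UniformContinuousConstSMul k w.AlgCl where
  uniformContinuous_const_smul c := by
    simp_rw [Algebra.smul_def]
    exact (Ring.uniformContinuousConstSMul w.AlgCl).uniformContinuous_const_smul _

end Place

/-! ### Dirichlet series in general

Below `ι` is the set of ideals over which a Dirichlet series runs, `C` the field of values, and `Y`
the group of second coordinates, so that `Cˣ × Y` is the domain of the series. -/

section Dirichlet

variable {ι Y C : Type*} [NormedField C]

/-- Absolute convergence of a Dirichlet series with terms `f` at a point:
`f I → 0` as `deg I → ∞`. -/
def AbsConverges (deg : ι → ℕ) (f : ι → C) : Prop :=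
  Tendsto f (comap deg atTop) (𝓝 0)

/-- Absolute convergence in some half-plane `|x| ≥ t`. -/
def HasHalfPlane (deg : ι → ℕ) (L : Cˣ × Y → ι → C) : Prop :=
  ∃ t : ℝ, 0 < t ∧ ∀ s : Cˣ × Y, t ≤ ‖(s.1 : C)‖ → AbsConverges deg (L s)

/-- The value of a power series at `u`. -/
def seriesEval (f : C⟦X⟧) (u : C) : C := ∑' n, PowerSeries.coeff n f * u ^ n

/-- A uniformly convergent family, parametrized by `Y`, of entire power series. -/
def IsEntireFamily [AddGroup Y] [TopologicalSpace Y] (g : Y → C⟦X⟧) : Prop :=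
  (∀ (y : Y) (u : C), Summable fun n => PowerSeries.coeff n (g y) * u ^ n) ∧
    ∀ B : Set C, Bornology.IsBounded B → ∀ ε : ℝ, 0 < ε → ∃ U ∈ 𝓝 (0 : Y),
      ∀ y₀ y₁ : Y, y₀ - y₁ ∈ U → ∀ u ∈ B, ‖seriesEval (g y₀) u - seriesEval (g y₁) u‖ < ε

/-- The function `(x, y) ↦ g_y(1/x)` continues the Dirichlet series with terms `L`: the series
converges absolutely in some half-plane, and wherever it converges absolutely its sum is
`g_y(1/x)`. -/
def Continues (deg : ι → ℕ) (L : Cˣ × Y → ι → C) (g : Y → C⟦X⟧) : Prop :=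
  HasHalfPlane deg L ∧
    ∀ s : Cˣ × Y, AbsConverges deg (L s) → HasSum (L s) (seriesEval (g s.2) (s.1 : C)⁻¹)

/-- `u ^ y` for a `1`-unit `u` in characteristic `p` and `y = ∑ c_j p ^ j` in `ℤ_p`: the limit of
`u ^ (∑_{j < n} c_j p ^ j) = ∏_{j < n} (1 + (u - 1) ^ (p ^ j)) ^ c_j`. -/
def oneUnitPow {p : ℕ} [Fact p.Prime] (u : C) (y : ℤ_[p]) : C :=
  limUnder atTop fun n => u ^ y.appr n

end Dirichlet

/-! ### The theory at the place `∞` -/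

/-- The basic data: the place `∞`, a uniformizer `π` of the completion `K` of `k` at `∞`, and a
`d_∞`-th root `π_*` of `π` in `ℂ_∞`. -/
structure Datum (Fq k : Type*) [Field Fq] [Finite Fq] [Field k] [Algebra Fq k] where
  /-- the place `∞` -/
  inf : Place k
  /-- the uniformizer `π` -/
  unif : inf.Local
  norm_unif : ‖unif‖ = (Nat.card inf.Residue : ℝ)⁻¹
  /-- the root `π_*` -/
  root : inf.Cp
  root_pow : root ^ inf.deg Fq = algebraMap inf.Local inf.Cp unif

namespace Datum

variable {Fq k : Type*} [Field Fq] [Finite Fq] [Field k] [Algebra Fq k] (D : Datum Fq k)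

/-- The ring `A` of elements of `k` which are integral at all places different from `∞`. -/
def A : Subalgebra Fq k where
  carrier := {x | ∀ w : Place k, w ≠ D.inf → w.abs x ≤ 1}
  mul_mem' ha hb w hw := (absRing w.abs w.nonarch).mul_mem _ _ (ha w hw) (hb w hw)
  add_mem' ha hb w hw := (absRing w.abs w.nonarch).add_mem _ _ (ha w hw) (hb w hw)
  algebraMap_mem' c w _ := w.abs_algebraMap_le Fq c

/-- The nonzero ideals of `A`. -/
abbrev Ideals : Type _ := {I : Ideal D.A // I ≠ ⊥}

/-- The degree `dim_{Fq} (A / I)` of a nonzero ideal. -/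
def degI (I : D.Ideals) : ℕ := Module.finrank Fq (D.A ⧸ I.1)

/-- `α ∈ K` is positive (monic) with `1`-unit part `⟨α⟩ = u`, i.e. in the decomposition
`α = ζ_α π ^ (n_α) ⟨α⟩` one has `ζ_α = 1` and `⟨α⟩ = u`. -/
def PositiveWith (α u : D.inf.Local) : Prop :=
  ‖u - 1‖ < 1 ∧ ∃ n : ℤ, α = D.unif ^ n * u

/-- The `1`-unit `⟨I⟩` of `ℂ_∞`. The group of fractional ideals modulo principal ideals with a
positive generator is finite and roots of `1`-units are unique among `1`-units in characteristic
`p`, so the unique homomorphism `I ↦ ⟨I⟩` into the `1`-units of `ℂ_∞` with `⟨(a)⟩ = ⟨a⟩` for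
positive `a` is given as follows: `⟨I⟩` is the only `1`-unit `z` with `z ^ t = ⟨a⟩` when
`I ^ t = (a)`, where `t > 0` and `a` is positive. -/
def bracket (I : D.Ideals) : D.inf.Cp :=
  Classical.epsilon fun z : D.inf.Cp => ‖z - 1‖ < 1 ∧
    ∃ (t : ℕ) (a : D.A) (u : D.inf.Local), 0 < t ∧ I.1 ^ t = Ideal.span {a} ∧
      D.PositiveWith (algebraMap k D.inf.Local (a : k)) u ∧
      z ^ t = algebraMap D.inf.Local D.inf.Cp u

/-- `I ^ s = x ^ (deg I) ⟨I⟩ ^ y` for `s = (x, y)` in `S_∞ = ℂ_∞^* × ℤ_p`. -/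
def idealPow {p : ℕ} [Fact p.Prime] (I : D.Ideals) (s : D.inf.Cpˣ × ℤ_[p]) : D.inf.Cp :=
  (s.1 : D.inf.Cp) ^ D.degI I * oneUnitPow (D.bracket I) s.2

/-- `I ^ (s_1) = π_* ^ (- deg I) ⟨I⟩`, where `s_1 = (π_*⁻¹, 1)`. -/
def idealOne (I : D.Ideals) : D.inf.Cp := D.root⁻¹ ^ D.degI I * D.bracket I

/-- The value field `𝕍 = k({I ^ (s_1)})`, a subfield of `ℂ_∞`. -/
def valueField : IntermediateField k D.inf.Cp :=
  IntermediateField.adjoin k (Set.range D.idealOne)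

/-- `I ^ (s_1)` as an element of `𝕍`. -/
def idealOneV (I : D.Ideals) : D.valueField :=
  ⟨D.idealOne I, IntermediateField.subset_adjoin k _ ⟨I, rfl⟩⟩

/-- The terms `b_I I ^ (-s)` of the Dirichlet series `L(s) = ∑ b_I I ^ (-s)`, `s ∈ S_∞`. -/
def term {p : ℕ} [Fact p.Prime] (b : D.Ideals → D.A) (s : D.inf.Cpˣ × ℤ_[p]) (I : D.Ideals) :
    D.inf.Cp :=
  algebraMap k D.inf.Cp (b I) * D.idealPow I (s.1⁻¹, -s.2)

/-- The formal power series in `x⁻¹` given by `L(x, y)`; its `n`-th coefficient is the (finite) sum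
of `b_I ⟨I⟩ ^ (-y)` over the ideals `I` of degree `n`. -/
def formalSeries {p : ℕ} [Fact p.Prime] (b : D.Ideals → D.A) (y : ℤ_[p]) : D.inf.Cp⟦X⟧ :=
  PowerSeries.mk fun n => ∑ᶠ I : {I : D.Ideals // D.degI I = n},
    algebraMap k D.inf.Cp (b I.1) * oneUnitPow (D.bracket I.1) (-y)

/-- Substitution of `π_* ^ j x` for `x` in a power series in `x⁻¹`. -/
def twist (j : ℕ) (f : D.inf.Cp⟦X⟧) : D.inf.Cp⟦X⟧ :=
  PowerSeries.rescale ((D.root ^ j)⁻¹) f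

/-- The motivic class of Dirichlet series with coefficients in `A`: absolute convergence in a
half-plane, and the power series `L(π_* ^ j x, -j)` are polynomials in `x⁻¹`, with coefficients in
the `A`-integers of `𝕍`, of degree `O(log j)`. -/
def IsMotivic (p : ℕ) [Fact p.Prime] (b : D.Ideals → D.A) : Prop :=
  HasHalfPlane D.degI (D.term (p := p) b) ∧
    ∃ P : ℕ → D.valueField[X],
      (∀ j : ℕ, (((P j).map (algebraMap D.valueField D.inf.Cp) : D.inf.Cp[X]) : D.inf.Cp⟦X⟧) =
        D.twist j (D.formalSeries b (-(j : ℤ_[p])))) ∧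
      (∀ j n : ℕ, IsIntegral D.A (((P j).coeff n : D.valueField) : D.inf.Cp)) ∧
      (fun j : ℕ => ((P j).natDegree : ℝ)) =O[atTop] (fun j : ℕ => Real.log j)

/-- The entire family `g` on `S_∞` is essentially algebraic, for a Dirichlet series with
coefficients in `k`: each `z_L(x, -j) = L(π_* ^ j x, -j)` is in `𝕍[x⁻¹]`. -/
def IsEssAlgebraic {p : ℕ} [Fact p.Prime] (g : ℤ_[p] → D.inf.Cp⟦X⟧) : Prop :=
  ∀ j : ℕ, ∃ P : D.valueField[X],
    D.twist j (g (-(j : ℤ_[p]))) =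
      ((P.map (algebraMap D.valueField D.inf.Cp) : D.inf.Cp[X]) : D.inf.Cp⟦X⟧)

/-! ### The theory at a finite prime `v`, with an embedding `σ : 𝕍 → k̄_v` over `k` -/

section Finite

variable (v : Place k) (σ : D.valueField →ₐ[k] v.AlgCl)

/-- The ideals prime to `v`: those not contained in the prime `{a ∈ A | |a|_v < 1}` of `v`. -/
abbrev IdealsPrimeTo : Type _ := {I : D.Ideals // ∃ a ∈ I.1, v.abs (a : k) = 1}

/-- The field `k_σ = k_v(σ(𝕍))`. -/
def sigmaField : IntermediateField v.Local v.AlgCl :=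
  IntermediateField.adjoin v.Local (Set.range σ)

/-- The order `r ^ (d_v f_σ)` of the residue field of `k_σ`. -/
def sigmaCard : ℕ :=
  Nat.card (IsLocalRing.ResidueField
    (absRing (NormedField.toAbsoluteValue (D.sigmaField v σ))
      (fun a b => IsUltrametricDist.norm_add_le_max (a : v.AlgCl) (b : v.AlgCl))))

/-- The group `S_σ = ℤ_p × ℤ / (r ^ (d_v f_σ) - 1)`. -/
abbrev SSigma (p : ℕ) [Fact p.Prime] : Type := ℤ_[p] × ZMod (D.sigmaCard v σ - 1)

/-- The root of unity `ω(β)`, of order dividing `r ^ (d_v f_σ) - 1`, congruent to the unit `β`. -/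
def omega (β : v.Cp) : v.Cp :=
  Classical.epsilon fun ζ : v.Cp => ζ ^ (D.sigmaCard v σ - 1) = 1 ∧ ‖β - ζ‖ < 1

/-- `β ^ y = ω(β) ^ (y_1) ⟨β⟩ ^ (y_0)`, where `⟨β⟩ = β / ω(β)`, for a unit `β` of the integers of
`k_σ` and `y = (y_0, y_1)` in `S_σ`. -/
def unitPow {p : ℕ} [Fact p.Prime] (β : v.Cp) (y : D.SSigma v σ p) : v.Cp :=
  D.omega v σ β ^ y.2.val * oneUnitPow (β / D.omega v σ β) y.1

/-- `I ^ (s_σ) = x ^ (deg I) σ(I ^ (s_1)) ^ y` for `s_σ = (x, y)` in `ℂ_v^* × S_σ`. -/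
def idealPowV {p : ℕ} [Fact p.Prime] (I : D.Ideals) (s : v.Cpˣ × D.SSigma v σ p) : v.Cp :=
  (s.1 : v.Cp) ^ D.degI I *
    D.unitPow v σ (algebraMap v.AlgCl v.Cp (σ (D.idealOneV I))) s.2

/-- The terms `b_I I ^ (-s_σ)`, for `I` prime to `v`, of the `v`-adic interpolation of `L(s)`. -/
def termV {p : ℕ} [Fact p.Prime] (b : D.Ideals → D.A) (s : v.Cpˣ × D.SSigma v σ p)
    (I : D.IdealsPrimeTo v) : v.Cp :=
  algebraMap k v.Cp (b I.1) * D.idealPowV v σ I.1 (s.1⁻¹, -s.2)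

/-- The entire family `g` on `ℂ_v^* × S_σ` is essentially algebraic, for a Dirichlet series with
coefficients in `k`: each `L(x, -j)` is a polynomial in `x⁻¹` with coefficients in `σ(𝕍)`. -/
def IsEssAlgebraicV {p : ℕ} [Fact p.Prime] (g : D.SSigma v σ p → v.Cp⟦X⟧) : Prop :=
  ∀ j : ℕ, ∃ P : D.valueField[X],
    g (-(j : D.SSigma v σ p)) =
      ((P.map ((algebraMap v.AlgCl v.Cp).comp σ.toRingHom) : v.Cp[X]) : v.Cp⟦X⟧)

end Finite

end Datum

end

/-! The coefficient of `x⁻ⁿ` in the interpolated series is a sum of `b_I ⟨I⟩ ^ (-y)` over the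
finitely many ideals of degree `n`. At `y = -j` it is a power sum, and the logarithmic degree bound
of the motivic class makes it vanish for all `j < K * n` once `n` is large, for every fixed `K`
(`eventually_coeff_eq_zero`). The `⟨I⟩` lie in one disc of radius `ρ < 1` about `1`. By the binomial
theorem, smallness of the power sums for exponents below `M` forces smallness for all exponents, up
to `ρ ^ M` (`norm_sum_mul_pow_le`); by continuity this reaches every `p`-adic exponent. The
coefficients are therefore `O(X ^ n * ρ ^ (K * n))` for every `K`, uniformly in `y`, which beats any
`R ^ n`. Algebraicity at `∞` is part of the hypothesis.

At `v ≠ ∞` the vanishing relations are rewritten for the algebraic values `I ^ (s₁)` and transported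
by `σ`. Ideals not prime to `v` contribute at most `ρ ^ j`, so the power sums over ideals prime to
`v` are small in a long range of exponents. On residue classes modulo `r ^ (d_v f_σ) - 1` the
Teichmüller parts are constant, and the same binomial argument gives smallness for all large
exponents (`exists_norm_sum_idealOneSigma_le`). These are dense in `S_σ`. At `y = -j` the
coefficients are images of `A`-integral elements of `𝕍` whose conjugates at `∞` grow at most
exponentially in `n`. A product formula bounds nonzero such elements from below at `v`
(`pow_le_norm_algHom`), so super-exponential decay makes them vanish for large `n`: the series is a
polynomial.

The arithmetic input is derived from the definition of a place: enough places exist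
(`IsGlobalFunctionField.exists_place`), Riemann's inequality holds for multiples of `∞`
(`exists_card_lattice_ge`), `#A/(a) = |a|`, the class group is finite, and hence `⟨I⟩` exists and
`𝕍` is finite over `k`. -/

noncomputable section

/-! ### Finiteness over rational subfields -/

open scoped IntermediateField.algebraAdjoinAdjoin

section Transcendental

variable {Fq k : Type*} [Field Fq] [Field k] [Algebra Fq k]

/-- In a global function field, every transcendental element generates a subfield of finite
index. -/
theorem IsGlobalFunctionField.finiteDimensional (hk : IsGlobalFunctionField Fq k) {z : k}
    (hz : Transcendental Fq z) : FiniteDimensional (IntermediateField.adjoin Fq {z}) k := by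
  obtain ⟨⟨x, hx, hfin⟩, -⟩ := hk
  have hr (t : k) : Set.range (fun _ : Unit => t) = {t} := by simp
  have hax : Algebra.IsAlgebraic (Algebra.adjoin Fq (Set.range fun _ : Unit => x)) k := by
    rw [hr]
    have h1 : Algebra.IsAlgebraic (IntermediateField.adjoin Fq {x}) k := inferInstance
    exact (IsFractionRing.comap_isAlgebraic_iff (A := Algebra.adjoin Fq {x})
      (K := IntermediateField.adjoin Fq {x}) (C := k)).2 h1
  -- The transcendence degree is at most one, so `z` alone is a transcendence basis; finite
  -- generation of `k` then turns algebraic into finite.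
  have hle := Algebra.IsAlgebraic.trdeg_le_cardinalMk Fq (Set.range fun _ : Unit => x)
  have hind : AlgebraicIndependent Fq (fun _ : Unit => z) :=
    (algebraicIndependent_unique_type_iff).2 hz
  have hb : IsTranscendenceBasis Fq (fun _ : Unit => z) := by
    refine hind.isTranscendenceBasis_of_lift_trdeg_le_of_finite ?_
    refine (Cardinal.lift_le.2 hle).trans ?_
    simp
  have hale := hb.isAlgebraic_field
  rw [hr] at hale
  have hess : Algebra.EssFiniteType Fq k := by
    have h1 : Algebra.EssFiniteType Fq (IntermediateField.adjoin Fq {x}) :=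
      (IntermediateField.essFiniteType_iff).2 ⟨{x}, by simp⟩
    exact Algebra.EssFiniteType.comp Fq (IntermediateField.adjoin Fq {x}) k
  have : Algebra.EssFiniteType (IntermediateField.adjoin Fq {z}) k :=
    Algebra.EssFiniteType.of_comp Fq _ k
  exact Algebra.finite_of_essFiniteType_of_isAlgebraic

/-- Elements of a ring `R` containing the transcendental non-unit `z` which are linearly independent
over the constants modulo `z` are linearly independent over the rational function field in `z`. -/
theorem linearIndependent_of_quotient {z : k} (hz : Transcendental Fq z) {R : Subalgebra Fq k}
    (hzR : z ∈ R) {ι : Type*} (u : ι → R)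
    (hu : LinearIndependent Fq
      (fun i => Ideal.Quotient.mk (Ideal.span {(⟨z, hzR⟩ : R)}) (u i))) :
    LinearIndependent (IntermediateField.adjoin Fq {z}) (fun i => (u i : k)) := by
  have hz0 : z ≠ 0 := by
    rintro rfl
    exact hz isAlgebraic_zero
  rw [← LinearIndependent.iff_fractionRing (Algebra.adjoin Fq {z}), linearIndependent_iff']
  intro s g hg
  have hP (i : ι) : ∃ P : Fq[X], Polynomial.aeval z P = (g i : k) := by
    have h : ((g i : Algebra.adjoin Fq {z}) : k) ∈ (Polynomial.aeval (R := Fq) z).range :=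
      Algebra.adjoin_singleton_eq_range_aeval Fq z ▸ (g i).2
    exact h
  choose P hP using hP
  -- Modulo `z` a relation involves only the constant terms, which therefore vanish. Dividing by `z`
  -- shifts the coefficients, and induction kills all of them.
  have key : ∀ (n : ℕ) (P : ι → Fq[X]),
      (∑ i ∈ s, Polynomial.aeval z (P i) * (u i : k) = 0) → ∀ i ∈ s, (P i).coeff n = 0 := by
    have h0 : ∀ (P : ι → Fq[X]),
        (∑ i ∈ s, Polynomial.aeval z (P i) * (u i : k) = 0) → ∀ i ∈ s, (P i).coeff 0 = 0 := by
      intro P hrel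
      refine linearIndependent_iff'.1 hu s (fun i => (P i).coeff 0) ?_
      have h1 : ∑ i ∈ s, Polynomial.aeval (⟨z, hzR⟩ : R) (P i) * u i = 0 := by
        apply Subtype.val_injective
        rw [← R.coe_val, map_sum]
        simp only [map_mul, ← Polynomial.aeval_algHom_apply]
        exact hrel
      have h2 := congrArg (Ideal.Quotient.mkₐ Fq (Ideal.span {(⟨z, hzR⟩ : R)})) h1
      rw [map_sum, map_zero] at h2
      rw [← h2]
      refine Finset.sum_congr rfl fun i _ => ?_
      have h3 : (Ideal.Quotient.mkₐ Fq (Ideal.span {(⟨z, hzR⟩ : R)})) ⟨z, hzR⟩ = 0 :=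
        Ideal.Quotient.eq_zero_iff_mem.2 (Ideal.mem_span_singleton_self _)
      rw [map_mul, ← Polynomial.aeval_algHom_apply, h3, ← Polynomial.coeff_zero_eq_aeval_zero',
        ← AlgHom.commutes (Ideal.Quotient.mkₐ Fq (Ideal.span {(⟨z, hzR⟩ : R)})), ← map_mul,
        ← Algebra.smul_def]
      rfl
    intro n
    induction n with
    | zero => exact h0
    | succ n ih =>
      intro P hrel i hi
      rw [← Polynomial.coeff_divX]
      refine ih (fun i => (P i).divX) ?_ i hi
      refine (mul_eq_zero.1 (?_ : z * _ = 0)).resolve_left hz0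
      rw [Finset.mul_sum, ← hrel]
      refine Finset.sum_congr rfl fun j hj => ?_
      conv_rhs => rw [← Polynomial.divX_mul_X_add (P j)]
      simp [h0 P hrel j hj]
      ring
  intro i hi
  have : P i = 0 := by
    ext n
    simpa using key n P (by simpa [hP, Algebra.smul_def] using! hg) i hi
  apply Subtype.val_injective
  rw [← hP i, this]
  simp

/-- The `Fq`-dimension of the quotient is bounded by the degree of `k` over `Fq(z)`. The freedom in
`R` matters: it is used both for a valuation ring and for the functions regular at finitely many
places. -/
theorem finite_quotient_of_transcendental [Finite Fq] {z : k} (hz : Transcendental Fq z)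
    [FiniteDimensional (IntermediateField.adjoin Fq {z}) k] {R : Subalgebra Fq k} (hzR : z ∈ R) :
    Finite (R ⧸ Ideal.span {(⟨z, hzR⟩ : R)}) ∧
      Nat.card (R ⧸ Ideal.span {(⟨z, hzR⟩ : R)}) ≤
        Nat.card Fq ^ Module.finrank (IntermediateField.adjoin Fq {z}) k := by
  set I := Ideal.span {(⟨z, hzR⟩ : R)} with hI
  have hrank : Module.rank Fq (R ⧸ I) ≤
      (Module.finrank (IntermediateField.adjoin Fq {z}) k : ℕ) := by
    refine rank_le fun s hs => ?_
    choose u hu using fun i : s => Ideal.Quotient.mk_surjective (I := I) (i : R ⧸ I)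
    have hli := (linearIndependent_of_quotient hz hzR u (by
      rw [← hI, show (fun i => Ideal.Quotient.mk I (u i)) = fun i : s => (i : R ⧸ I) from
        funext hu]
      exact hs)).fintype_card_le_finrank
    rwa [Fintype.card_coe] at hli
  have hfree : Module.Free Fq (R ⧸ I) := Module.Free.of_divisionRing Fq (R ⧸ I)
  have hfin : Module.Finite Fq (R ⧸ I) :=
    Module.rank_lt_aleph0_iff.1 (hrank.trans_lt (Cardinal.natCast_lt_aleph0))
  refine ⟨Module.finite_of_finite Fq, ?_⟩
  rw [Module.natCard_eq_pow_finrank (K := Fq) (V := R ⧸ I)]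
  exact Nat.pow_le_pow_right Nat.card_pos (by
    rw [← Module.finrank_eq_rank] at hrank; exact_mod_cast hrank)

end Transcendental

end

noncomputable section

/-! ### Existence of places -/

open scoped IntermediateField.algebraAdjoinAdjoin

/-- A nonzero ideal is an extension of its finite image modulo one of its nonzero elements by a
principal ideal. -/
theorem isNoetherianRing_of_finite_quotient {R : Type*} [CommRing R]
    (h : ∀ y : R, y ≠ 0 → Finite (R ⧸ Ideal.span {y})) : IsNoetherianRing R := by
  rw [isNoetherianRing_iff_ideal_fg]
  intro I
  by_cases hI : I = ⊥
  · exact hI ▸ Submodule.fg_bot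
  obtain ⟨y, hyI, hy⟩ := Submodule.exists_mem_ne_zero_of_ne_bot hI
  have := h y hy
  refine Submodule.fg_of_fg_map_of_fg_inf_ker (Submodule.mkQ (Ideal.span {y})) ?_ ?_
  · have : IsNoetherian R (R ⧸ Ideal.span {y}) := inferInstance
    exact IsNoetherian.noetherian _
  · rw [Submodule.ker_mkQ, inf_eq_right.2]
    · exact ⟨{y}, by simp [Ideal.span]⟩
    · rwa [Ideal.span_singleton_le_iff_mem]

/-- A discrete valuation ring of `k` with finite residue field gives a place. -/
theorem ValuationSubring.exists_place {k : Type*} [Field k] (B : ValuationSubring k)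
    [IsDiscreteValuationRing B] [Finite (IsLocalRing.ResidueField B)] :
    ∃ w : Place k, ∀ x : k, w.abs x < 1 ↔ x ∈ B.nonunits := by
  -- Taking the residue cardinality as base of the adic absolute value makes it the normalized one.
  set q : NNReal := (Nat.card (IsLocalRing.ResidueField B) : NNReal) with hq
  have hb : 1 < q := by
    rw [hq]
    exact_mod_cast Finite.one_lt_card
  set P := IsDiscreteValuationRing.maximalIdeal B
  have hlt (x : k) : P.adicAbv hb x < 1 ↔ x ∈ B.nonunits := by
    by_cases hx : x ∈ B
    · rw [show x = algebraMap B k ⟨x, hx⟩ from rfl, P.adicAbv_coe_lt_one_iff]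
      exact (ValuationSubring.coe_mem_nonunits_iff (A := B) (a := ⟨x, hx⟩)).symm
    · have hx' : x⁻¹ ∈ B := (B.mem_or_inv_mem x).resolve_left hx
      have h1 : 1 < P.adicAbv hb x := by
        have h2 : P.adicAbv hb x⁻¹ < 1 := by
          rw [show x⁻¹ = algebraMap B k ⟨x⁻¹, hx'⟩ from rfl, P.adicAbv_coe_lt_one_iff]
          refine (ValuationSubring.coe_mem_nonunits_iff (A := B) (a := ⟨x⁻¹, hx'⟩)).1 ?_
          exact B.inv_mem_nonunits_iff.2 (Or.inr hx)
        rw [map_inv₀] at h2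
        have hpos : 0 < P.adicAbv hb x := (P.adicAbv hb).pos (by rintro rfl; exact hx B.zero_mem)
        exact (inv_lt_one₀ hpos).1 h2
      refine iff_of_false h1.not_gt fun h => hx (B.nonunits_subset h)
  have hle (x : k) : P.adicAbv hb x ≤ 1 ↔ x ∈ B := by
    constructor
    · intro h
      by_contra hx
      have hx' : x⁻¹ ∈ B := (B.mem_or_inv_mem x).resolve_left hx
      have h1 : x⁻¹ ∈ B.nonunits := by
        rw [B.inv_mem_nonunits_iff]
        exact Or.inr hx
      rw [← hlt, map_inv₀] at h1
      have hpos : 0 < P.adicAbv hb x := (P.adicAbv hb).pos (by rintro rfl; exact hx B.zero_mem)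
      exact absurd ((inv_lt_one₀ hpos).1 h1) h.not_gt
    · intro hx
      exact P.adicAbv_coe_le_one (K := k) hb (⟨x, hx⟩ : B)
  have hR : absRing (P.adicAbv (K := k) hb) (P.isNonarchimedean_adicAbv hb) = B := by
    ext x
    exact hle x
  have hcard : Nat.card (IsLocalRing.ResidueField
      (absRing (P.adicAbv (K := k) hb) (P.isNonarchimedean_adicAbv hb))) =
      Nat.card (IsLocalRing.ResidueField B) := by
    rw [hR]
  obtain ⟨ϖ, hϖ⟩ := P.valuation_exists_uniformizer k
  have hval : P.adicAbv hb ϖ = (q : ℝ)⁻¹ := by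
    change ((P.adicAbvDef hb ϖ : NNReal) : ℝ) = _
    rw [IsDedekindDomain.HeightOneSpectrum.adicAbvDef, hϖ]
    rw [WithZeroMulInt.toNNReal_neg_apply _ (by simp)]
    change ((q ^ (-1 : ℤ) : NNReal) : ℝ) = _
    simp
  refine ⟨⟨P.adicAbv hb, P.isNonarchimedean_adicAbv hb, ϖ, ?_, ?_, ?_, ?_⟩, hlt⟩
  · rw [hval]
    positivity
  · rw [hval]
    exact inv_lt_one_of_one_lt₀ (by exact_mod_cast hb)
  · intro x hx
    change ((P.adicAbvDef hb x : NNReal) : ℝ) ≤ (P.adicAbvDef hb ϖ : NNReal)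
    have hx : ((P.adicAbvDef hb x : NNReal) : ℝ) < 1 := hx
    rw [IsDedekindDomain.HeightOneSpectrum.adicAbvDef] at hx ⊢
    rw [IsDedekindDomain.HeightOneSpectrum.adicAbvDef, hϖ]
    have h1 : P.valuation k x < 1 := by
      rw [← WithZeroMulInt.toNNReal_lt_one_iff hb]
      exact_mod_cast hx
    have : P.valuation k x ≤ WithZero.exp (-1 : ℤ) := by
      rcases eq_or_ne (P.valuation k x) 0 with h0 | h0
      · rw [h0]
        exact zero_le
      · rw [← WithZero.exp_log h0, ← WithZero.exp_zero, WithZero.exp_lt_exp] at h1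
        rw [← WithZero.exp_log h0, WithZero.exp_le_exp]
        omega
    exact_mod_cast (WithZeroMulInt.toNNReal_strictMono hb).monotone this
  · rw [hval, hcard, hq]
    simp

variable {Fq k : Type*} [Field Fq] [Finite Fq] [Field k] [Algebra Fq k]

/-- Every transcendental element of a global function field vanishes at some place. -/
theorem IsGlobalFunctionField.exists_place (hk : IsGlobalFunctionField Fq k) {z : k}
    (hz : Transcendental Fq z) : ∃ w : Place k, w.abs z < 1 := by
  have hz0 : z ≠ 0 := by
    rintro rfl
    exact hz isAlgebraic_zero
  have hzS : z ∈ (Algebra.adjoin Fq {z}).toSubring := Algebra.self_mem_adjoin_singleton Fq z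
  have hI : Ideal.span {(⟨z, hzS⟩ : (Algebra.adjoin Fq {z}).toSubring)} ≠ ⊤ := by
    rw [Ne, Ideal.span_singleton_eq_top]
    intro hu
    obtain ⟨⟨y, hy⟩, hzy⟩ := isUnit_iff_exists_inv.1 hu
    have hzy : z * y = 1 := congrArg Subtype.val hzy
    have hy' : y ∈ (Polynomial.aeval (R := Fq) z).range :=
      Algebra.adjoin_singleton_eq_range_aeval Fq z ▸ hy
    obtain ⟨P, rfl⟩ := hy'
    refine hz ⟨Polynomial.X * P - 1, fun h => ?_, by simpa [sub_eq_zero] using hzy⟩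
    have := congrArg (Polynomial.eval 0) h
    simp at this
  -- Chevalley's extension theorem: `z` is not a unit of `Fq[z]`, so some valuation ring of `k` has
  -- `z` in its maximal ideal.
  obtain ⟨B, hSB, hIB⟩ := Ideal.image_subset_nonunits_valuationSubring _ hI
  have hzn : z ∈ B.nonunits := hIB ⟨_, Ideal.mem_span_singleton_self _, rfl⟩
  have hzB : z ∈ B := B.nonunits_subset hzn
  let R : Subalgebra Fq k :=
    { B.toSubring with
      algebraMap_mem' := fun c => hSB (Subalgebra.algebraMap_mem _ c) }
  have hzn' : (⟨z, hzB⟩ : B) ∈ IsLocalRing.maximalIdeal B :=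
    (ValuationSubring.coe_mem_nonunits_iff (A := B) (a := ⟨z, hzB⟩)).1 hzn
  -- every nonzero element of `B` divides a power of `z`
  have hdvd : ∀ y : B, y ≠ 0 → ∃ i : ℕ, 0 < i ∧ y ∣ (⟨z, hzB⟩ : B) ^ i := by
    intro y hy
    have halg : IsAlgebraic (Algebra.adjoin Fq {z}) (y : k) := by
      have := hk.finiteDimensional hz
      have h1 : Algebra.IsAlgebraic (IntermediateField.adjoin Fq {z}) k := inferInstance
      have h2 := (IsFractionRing.comap_isAlgebraic_iff (A := Algebra.adjoin Fq {z})
        (K := IntermediateField.adjoin Fq {z}) (C := k)).2 h1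
      exact h2.1 _
    let alg : Algebra (Algebra.adjoin Fq {z}) B := (Subring.inclusion hSB).toAlgebra
    have hst : IsScalarTower (Algebra.adjoin Fq {z}) B k := IsScalarTower.of_algebraMap_eq' rfl
    have halg' : IsAlgebraic (Algebra.adjoin Fq {z}) y :=
      (isAlgebraic_algebraMap_iff (A := k) (Subtype.val_injective)).1 halg
    -- Being algebraic, `y` divides a nonzero polynomial in `z`. After removal of the power of `z`,
    -- that polynomial has nonzero constant term, hence is a unit of `B`.
    obtain ⟨⟨r, hr⟩, hr0, hyr⟩ := halg'.exists_nonzero_dvd (mem_nonZeroDivisors_of_ne_zero hy)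
    obtain ⟨P, rfl⟩ : r ∈ (Polynomial.aeval (R := Fq) z).range :=
      Algebra.adjoin_singleton_eq_range_aeval Fq z ▸ hr
    have hP0 : P ≠ 0 := by
      rintro rfl
      exact hr0 (Subtype.ext (map_zero _))
    obtain ⟨P', hPP', hP'⟩ := Polynomial.exists_eq_pow_rootMultiplicity_mul_and_not_dvd P hP0 0
    have hQ : ∀ Q : Fq[X], Polynomial.aeval z Q ∈ B := fun Q =>
      hSB (Algebra.adjoin_singleton_eq_range_aeval Fq z ▸ (⟨Q, rfl⟩ : _ ∈ (Polynomial.aeval z).range))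
    have hunit : IsUnit (⟨Polynomial.aeval z P', hQ P'⟩ : B) := by
      by_contra hnu
      have h1 := (IsLocalRing.mem_maximalIdeal _).2 hnu
      have h2 : (⟨Polynomial.aeval z P', hQ P'⟩ : B) = ⟨Polynomial.aeval z P'.divX, hQ _⟩ *
          ⟨z, hzB⟩ + ⟨algebraMap Fq k (P'.coeff 0), R.algebraMap_mem _⟩ := by
        apply Subtype.val_injective
        conv_lhs => rw [← Polynomial.divX_mul_X_add P']
        simp
      rw [h2, Ideal.add_mem_iff_right _ (Ideal.mul_mem_left _ _ hzn')] at h1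
      refine (IsLocalRing.mem_maximalIdeal _).1 h1 (IsUnit.of_mul_eq_one
        ⟨algebraMap Fq k (P'.coeff 0)⁻¹, R.algebraMap_mem _⟩ (Subtype.val_injective ?_))
      have hc : P'.coeff 0 ≠ 0 := by
        intro hc
        rw [Polynomial.C_0, sub_zero, Polynomial.X_dvd_iff] at hP'
        exact hP' hc
      change algebraMap Fq k _ * algebraMap Fq k _ = 1
      rw [← map_mul, mul_inv_cancel₀ hc, map_one]
    refine ⟨P.rootMultiplicity 0 + 1, Nat.succ_pos _, Dvd.dvd.trans ?_ (pow_dvd_pow _ (Nat.le_succ _))⟩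
    rw [← hunit.dvd_mul_right]
    convert! hyr using 1
    apply Subtype.val_injective
    change z ^ _ * Polynomial.aeval z P' = Polynomial.aeval z P
    conv_rhs => rw [hPP']
    simp
  -- Powers of `z` are still transcendental, so their quotients are finite; by `hdvd` all quotients
  -- by nonzero elements are. Thus `B` is Noetherian, and a Noetherian valuation ring that is not a
  -- field is discrete.
  have hfinz : ∀ i : ℕ, 0 < i → Finite (B ⧸ Ideal.span {(⟨z, hzB⟩ : B) ^ i}) := by
    intro i hi
    have hzi : Transcendental Fq (z ^ i) := hz.pow hi
    have := hk.finiteDimensional hzi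
    exact (finite_quotient_of_transcendental hzi (R := R) (R.pow_mem hzB i)).1
  have hfin : ∀ y : B, y ≠ 0 → Finite (B ⧸ Ideal.span {y}) := by
    intro y hy
    obtain ⟨i, hi, hyi⟩ := hdvd y hy
    have := hfinz i hi
    exact Finite.of_surjective _ (Ideal.Quotient.factor_surjective
      ((Ideal.span_singleton_le_span_singleton).2 hyi))
  have := isNoetherianRing_of_finite_quotient hfin
  have hnf : ¬ IsField B := by
    intro hf
    obtain ⟨y, hy⟩ := hf.mul_inv_cancel (a := ⟨z, hzB⟩) (fun h => hz0 (congrArg Subtype.val h))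
    exact (IsLocalRing.mem_maximalIdeal _).1 hzn' (IsUnit.of_mul_eq_one _ hy)
  have : IsDiscreteValuationRing B := by
    have hv : ValuationRing B := inferInstance
    exact ((IsDiscreteValuationRing.TFAE B hnf).out 1 0).1 hv
  have : Finite (IsLocalRing.ResidueField B) := by
    have := hfinz 1 one_pos
    refine Finite.of_surjective _ (Ideal.Quotient.factor_surjective
      (S := Ideal.span {(⟨z, hzB⟩ : B) ^ 1}) (T := IsLocalRing.maximalIdeal B) ?_)
    rwa [pow_one, Ideal.span_singleton_le_iff_mem]
  obtain ⟨w, hw⟩ := B.exists_place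
  exact ⟨w, (hw z).2 hzn⟩

end

noncomputable section

/-! ### Balls of a place -/

theorem AbsoluteValue.le_one_of_isIntegral {K S : Type*} [Field K] [CommRing S] [Algebra S K]
    {v : AbsoluteValue K ℝ} (hv : IsNonarchimedean v) (h : ∀ s : S, v (algebraMap S K s) ≤ 1)
    {x : K} (hx : IsIntegral S x) : v x ≤ 1 := by
  let alg : Algebra S (absRing v hv) :=
    ((algebraMap S K).codRestrict (absRing v hv).toSubring h).toAlgebra
  have : IsScalarTower S (absRing v hv) K := IsScalarTower.of_algebraMap_eq' rfl
  obtain ⟨y, rfl⟩ := IsIntegrallyClosed.isIntegral_iff.1 (hx.tower_top (A := absRing v hv))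
  exact y.2

namespace Place

variable {k : Type*} [Field k] (w : Place k)

/-- The order of the residue field. -/
def card : ℕ := Nat.card w.Residue

theorem exists_uniformizer : ∃ ϖ : k, ϖ ≠ 0 ∧ w.abs ϖ = (w.card : ℝ)⁻¹ ∧
    (∀ x : k, w.abs x < 1 → w.abs x ≤ (w.card : ℝ)⁻¹) := by
  obtain ⟨ϖ, h0, h1, h2, h3⟩ := w.normalized
  exact ⟨ϖ, w.abs.pos_iff.1 h0, h3, fun x hx => (h2 x hx).trans h3.le⟩

theorem one_lt_card : 1 < w.card := by
  obtain ⟨ϖ, h0, h1, h2, h3⟩ := w.normalized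
  rw [h3] at h0 h1
  have hpos : (0 : ℝ) < w.card := inv_pos.1 h0
  exact_mod_cast (inv_lt_one₀ hpos).1 h1

theorem one_lt_card' : (1 : ℝ) < w.card := by exact_mod_cast w.one_lt_card

theorem card_pos : (0 : ℝ) < w.card := zero_lt_one.trans w.one_lt_card'

instance : Finite w.Residue := Nat.finite_of_card_ne_zero (by
  have := w.one_lt_card
  unfold card at this
  omega)

theorem abs_le_inv_card {x : k} (hx : w.abs x < 1) : w.abs x ≤ (w.card : ℝ)⁻¹ :=
  w.exists_uniformizer.choose_spec.2.2 x hx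

theorem exists_abs_eq_zpow {x : k} (hx : x ≠ 0) : ∃ n : ℤ, w.abs x = (w.card : ℝ) ^ n := by
  obtain ⟨ϖ, h0, h1, -⟩ := w.exists_uniformizer
  obtain ⟨n, hn1, hn2⟩ := exists_mem_Ioc_zpow (w.abs.pos hx) w.one_lt_card'
  refine ⟨n + 1, le_antisymm hn2 ?_⟩
  -- A value strictly between two consecutive powers could be scaled by the uniformizer strictly
  -- between `card⁻¹` and `1`.
  by_contra! hlt
  have h2 : w.abs (x * ϖ ^ (n + 1)) < 1 := by
    rw [map_mul, map_zpow₀, h1, inv_zpow, ← div_eq_mul_inv,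
      div_lt_one (zpow_pos w.card_pos _)]
    exact hlt
  have h3 := w.abs_le_inv_card h2
  rw [map_mul, map_zpow₀, h1, inv_zpow, ← div_eq_mul_inv,
      div_le_iff₀ (zpow_pos w.card_pos _), zpow_add_one₀ w.card_pos.ne', mul_comm,
      mul_assoc, mul_inv_cancel₀ w.card_pos.ne', mul_one] at h3
  exact absurd h3 hn1.not_ge

/-- The elements of absolute value at most `ρ`. -/
def ball (ρ : ℝ) (hρ : 0 ≤ ρ := by positivity) : AddSubgroup k where
  carrier := {x | w.abs x ≤ ρ}
  add_mem' {a b} ha hb := (w.nonarch a b).trans (max_le ha hb)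
  zero_mem' := by simpa using hρ
  neg_mem' {a} ha := by simpa using ha

@[simp]
theorem mem_ball {ρ : ℝ} {hρ : 0 ≤ ρ} {x : k} : x ∈ w.ball ρ hρ ↔ w.abs x ≤ ρ := Iff.rfl

theorem ball_mono {ρ ρ' : ℝ} {hρ : 0 ≤ ρ} {hρ' : 0 ≤ ρ'} (h : ρ ≤ ρ') :
    w.ball ρ hρ ≤ w.ball ρ' hρ' := fun _ hx => le_trans hx h

theorem map_mulLeft_ball {c : k} (hc : c ≠ 0) {ρ : ℝ} (hρ : 0 ≤ ρ) :
    (w.ball ρ hρ).map (AddMonoidHom.mulLeft c) =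
      w.ball (w.abs c * ρ) (mul_nonneg (w.abs.nonneg c) hρ) := by
  ext x
  simp only [AddSubgroup.mem_map, mem_ball, AddMonoidHom.coe_mulLeft]
  constructor
  · rintro ⟨y, hy, rfl⟩
    rw [map_mul]
    exact mul_le_mul_of_nonneg_left hy (w.abs.nonneg c)
  · intro hx
    refine ⟨c⁻¹ * x, ?_, by field_simp⟩
    rwa [map_mul, map_inv₀, inv_mul_le_iff₀ (w.abs.pos hc)]

theorem relIndex_ball_mul {c : k} (hc : c ≠ 0) {ρ ρ' : ℝ} (hρ : 0 ≤ ρ) (hρ' : 0 ≤ ρ') :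
    (w.ball (w.abs c * ρ) (mul_nonneg (w.abs.nonneg c) hρ)).relIndex
      (w.ball (w.abs c * ρ') (mul_nonneg (w.abs.nonneg c) hρ')) =
      (w.ball ρ hρ).relIndex (w.ball ρ' hρ') := by
  rw [← map_mulLeft_ball w hc, ← map_mulLeft_ball w hc]
  exact AddSubgroup.relIndex_map_map_of_injective _ _ (mul_right_injective₀ hc)

theorem relIndex_ball_inv_card :
    (w.ball (w.card : ℝ)⁻¹).relIndex (w.ball 1) = w.card := by
  let f : w.ball 1 →+ w.Residue :=
    { toFun := fun x => IsLocalRing.residue (absRing w.abs w.nonarch) ⟨x.1, x.2⟩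
      map_zero' := map_zero (IsLocalRing.residue (absRing w.abs w.nonarch))
      map_add' := fun x y => map_add (IsLocalRing.residue (absRing w.abs w.nonarch))
        ⟨x.1, x.2⟩ ⟨y.1, y.2⟩ }
  have h : (w.ball (w.card : ℝ)⁻¹).addSubgroupOf (w.ball 1) = f.ker := by
    ext ⟨x, hx⟩
    rw [AddSubgroup.mem_addSubgroupOf, AddMonoidHom.mem_ker]
    change w.abs x ≤ _ ↔ IsLocalRing.residue (absRing w.abs w.nonarch) ⟨x, hx⟩ = 0
    rw [IsLocalRing.residue_eq_zero_iff, IsLocalRing.mem_maximalIdeal, mem_nonunits_iff,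
      isUnit_iff_exists_inv]
    constructor
    · rintro h1 ⟨⟨y, hy⟩, hxy⟩
      have h2 : w.abs x * w.abs y = 1 := by
        rw [← map_mul, show x * y = 1 from congrArg Subtype.val hxy, map_one]
      have h3 : w.abs x * w.abs y ≤ (w.card : ℝ)⁻¹ * 1 :=
        mul_le_mul h1 hy (w.abs.nonneg y) (by positivity)
      rw [h2, mul_one] at h3
      exact absurd h3 (inv_lt_one_of_one_lt₀ w.one_lt_card').not_ge
    · intro h1
      refine w.abs_le_inv_card (lt_of_le_of_ne hx fun h2 => h1 ?_)
      have hx0 : x ≠ 0 := by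
        rintro rfl
        simp at h2
      refine ⟨⟨x⁻¹, ?_⟩, Subtype.ext (mul_inv_cancel₀ hx0)⟩
      change w.abs x⁻¹ ≤ 1
      rw [map_inv₀, h2, inv_one]
  rw [AddSubgroup.relIndex, h, AddSubgroup.index_ker]
  have : f.range = ⊤ := AddMonoidHom.range_eq_top.2 fun y => by
    obtain ⟨x, rfl⟩ := IsLocalRing.residue_surjective y
    exact ⟨⟨x.1, x.2⟩, rfl⟩
  rw [this, AddSubgroup.card_top]
  rfl

theorem zpow_card_nonneg (n : ℤ) : 0 ≤ (w.card : ℝ) ^ n := (zpow_pos w.card_pos n).le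

/-- Scaling by powers of a uniformizer reduces each step of the chain to the residue field count. -/
theorem relIndex_ball_zpow (a : ℤ) (n : ℕ) :
    (w.ball ((w.card : ℝ) ^ a) (w.zpow_card_nonneg a)).relIndex
      (w.ball ((w.card : ℝ) ^ (a + n)) (w.zpow_card_nonneg _)) = w.card ^ n := by
  induction n with
  | zero => simp
  | succ n ih =>
    rw [← AddSubgroup.relIndex_mul_relIndex _
      (w.ball ((w.card : ℝ) ^ (a + n)) (w.zpow_card_nonneg _)) _
      (w.ball_mono (zpow_le_zpow_right₀ w.one_lt_card'.le (by omega)))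
      (w.ball_mono (zpow_le_zpow_right₀ w.one_lt_card'.le (by push_cast; omega))), ih, pow_succ]
    congr 1
    obtain ⟨ϖ, h0, h1, -⟩ := w.exists_uniformizer
    have h2 := w.relIndex_ball_mul (zpow_ne_zero (-(a + n + 1)) h0)
      (ρ := (w.card : ℝ)⁻¹) (ρ' := 1) (by positivity) (by positivity)
    rw [relIndex_ball_inv_card] at h2
    refine Eq.trans ?_ h2
    congr 2
    · rw [map_zpow₀, h1, inv_zpow, zpow_neg, inv_inv, zpow_add_one₀ w.card_pos.ne', mul_assoc,
        mul_inv_cancel₀ w.card_pos.ne', mul_one]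
    · rw [map_zpow₀, h1, inv_zpow, zpow_neg, inv_inv, mul_one]
      push_cast
      rw [add_assoc]

/-- Equivalent places are equal. -/
theorem eq_of_isEquiv {w w' : Place k} (h : w.abs.IsEquiv w'.abs) : w = w' := by
  have hR : absRing w.abs w.nonarch = absRing w'.abs w'.nonarch := by
    ext x
    exact h.le_one_iff
  have hc : w.card = w'.card := by
    have (B B' : ValuationSubring k) (h : B = B') : Nat.card (IsLocalRing.ResidueField B) =
        Nat.card (IsLocalRing.ResidueField B') := by rw [h]
    exact this _ _ hR
  obtain ⟨ϖ, h0, h1, -⟩ := w.exists_uniformizer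
  obtain ⟨ϖ', h0', h1', -⟩ := w'.exists_uniformizer
  have h2 : w'.abs ϖ = (w.card : ℝ)⁻¹ := by
    apply le_antisymm
    · rw [hc]
      refine w'.abs_le_inv_card (h.lt_one_iff.1 ?_)
      rw [h1]
      exact inv_lt_one_of_one_lt₀ w.one_lt_card'
    · rw [hc, ← h1']
      rw [← h.le_iff_le, h1]
      refine w.abs_le_inv_card (h.lt_one_iff.2 ?_)
      rw [h1']
      exact inv_lt_one_of_one_lt₀ w'.one_lt_card'
  apply Place.ext
  ext x
  by_cases hx : x = 0
  · simp [hx]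
  obtain ⟨n, hn⟩ := w.exists_abs_eq_zpow hx
  have h3 : w.abs (x * ϖ ^ n) = 1 := by
    rw [map_mul, map_zpow₀, h1, hn, inv_zpow, mul_inv_cancel₀ (zpow_pos w.card_pos n).ne']
  have h4 := h.eq_one_iff.1 h3
  rw [map_mul, map_zpow₀, h2, inv_zpow, mul_inv_eq_one₀ (zpow_pos w.card_pos n).ne'] at h4
  rw [hn, h4]

theorem isNontrivial : w.abs.IsNontrivial := by
  obtain ⟨ϖ, h0, h1, -⟩ := w.exists_uniformizer
  exact ⟨ϖ, h0, by rw [h1]; exact (inv_lt_one_of_one_lt₀ w.one_lt_card').ne⟩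

variable {Fq : Type*} [Field Fq] [Finite Fq] [Algebra Fq k]

theorem abs_le_one_of_isAlgebraic {x : k} (hx : IsAlgebraic Fq x) : w.abs x ≤ 1 :=
  AbsoluteValue.le_one_of_isIntegral w.nonarch (w.abs_algebraMap_le Fq) hx.isIntegral

theorem abs_eq_one_of_isAlgebraic {x : k} (hx : IsAlgebraic Fq x) (h0 : x ≠ 0) : w.abs x = 1 := by
  refine le_antisymm (w.abs_le_one_of_isAlgebraic hx) ?_
  have := w.abs_le_one_of_isAlgebraic hx.inv
  rw [map_inv₀] at this
  exact (inv_le_one₀ (w.abs.pos h0)).1 this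

theorem card_eq : w.card = Nat.card Fq ^ w.deg Fq := by
  have : Module.Finite Fq w.Residue := inferInstance
  exact Module.natCard_eq_pow_finrank

end Place

end

noncomputable section

/-! ### Riemann's inequality -/

open scoped IntermediateField.algebraAdjoinAdjoin

theorem Finset.exists_pos_le_one_le {α : Type*} (S : Finset α) (f : α → ℝ)
    (hf : ∀ i ∈ S, 0 < f i) : ∃ ε : ℝ, 0 < ε ∧ ε ≤ 1 ∧ ∀ i ∈ S, ε ≤ f i := by
  classical
  induction S using Finset.induction with
  | empty => exact ⟨1, one_pos, le_rfl, by simp⟩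
  | insert w S hw ih =>
    obtain ⟨ε, h0, h1, h2⟩ := ih fun i hi => hf i (Finset.mem_insert_of_mem hi)
    refine ⟨min ε (f w), lt_min h0 (hf w (Finset.mem_insert_self _ _)),
      (min_le_left _ _).trans h1, ?_⟩
    intro w' hw'
    rcases Finset.mem_insert.1 hw' with rfl | hw'
    · exact min_le_right _ _
    · exact (min_le_left _ _).trans (h2 w' hw')

namespace Place

variable {k : Type*} [Field k]

/-- Simultaneous approximation at finitely many places. -/
theorem exists_approx {S : Finset (Place k)} (y : S → k) {ε : ℝ} (hε : 0 < ε) :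
    ∃ x : k, ∀ w : S, w.1.abs (x - y w) < ε := by
  have hd := AbsoluteValue.denseRange_algebraMap_pi (v := fun w : S => w.1.abs)
    (fun w => w.1.isNontrivial) (fun w w' hww' h => hww' (Subtype.ext (eq_of_isEquiv h)))
  obtain ⟨x, hx⟩ := Metric.denseRange_iff.1 hd (fun w => WithAbs.toAbs w.1.abs (y w)) ε hε
  refine ⟨x, fun w => ?_⟩
  have := (dist_pi_lt_iff hε).1 hx w
  rw [dist_comm, dist_eq_norm] at this
  exact this

variable {Fq : Type*} [Field Fq] [Finite Fq] [Algebra Fq k]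

/-- The degree of the divisor of zeros of `z` is at most `[k : Fq(z)]`. -/
theorem prod_relIndex_le {z : k} (hz : Transcendental Fq z)
    [FiniteDimensional (IntermediateField.adjoin Fq {z}) k] (S : Finset (Place k))
    (hS : ∀ w ∈ S, w.abs z < 1) :
    ∏ w ∈ S, (w.ball (w.abs z) (w.abs.nonneg z)).relIndex (w.ball 1) ≤
      Nat.card Fq ^ Module.finrank (IntermediateField.adjoin Fq {z}) k := by
  have hz0 : z ≠ 0 := by
    rintro rfl
    exact hz isAlgebraic_zero
  -- Functions regular on `S`. Simultaneous approximation realizes every family of local residues in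
  -- `R`, and families agreeing modulo `z` in `R` agree at each place, so the product of the local
  -- quotients injects into `R / (z)`.
  let R : Subalgebra Fq k :=
    { carrier := {x | ∀ w ∈ S, w.abs x ≤ 1}
      mul_mem' := fun ha hb w hw => (absRing w.abs w.nonarch).mul_mem _ _ (ha w hw) (hb w hw)
      add_mem' := fun ha hb w hw => (absRing w.abs w.nonarch).add_mem _ _ (ha w hw) (hb w hw)
      algebraMap_mem' := fun c w _ => w.abs_algebraMap_le Fq c }
  have hzR : z ∈ R := fun w hw => (hS w hw).le
  obtain ⟨hfin, hcard⟩ := finite_quotient_of_transcendental hz hzR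
  refine le_trans ?_ hcard
  let Q (w : S) : Type _ := w.1.ball 1 zero_le_one ⧸
    (w.1.ball (w.1.abs z) (w.1.abs.nonneg z)).addSubgroupOf (w.1.ball 1 zero_le_one)
  rw [← Finset.prod_coe_sort, show ∏ w : S, (w.1.ball (w.1.abs z) (w.1.abs.nonneg z)).relIndex
    (w.1.ball 1 zero_le_one) = ∏ w : S, Nat.card (Q w) from rfl, ← Nat.card_pi]
  have hε := Finset.exists_pos_le_one_le S (fun w => w.abs z) (fun w _ => w.abs.pos hz0)
  obtain ⟨ε, hε0, hε1, hε⟩ := hε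
  have hex : ∀ q : (∀ w, Q w), ∃ x : R, ∀ w : S, (QuotientAddGroup.mk (⟨x.1, x.2 w.1 w.2⟩ :
      w.1.ball 1 zero_le_one) : Q w) = q w := by
    intro q
    choose y hy using fun w => QuotientAddGroup.mk_surjective (q w)
    obtain ⟨x, hx⟩ := exists_approx (fun w => (y w : k)) hε0
    have hxR : x ∈ R := fun w hw => by
      have h1 := (w.nonarch (x - y ⟨w, hw⟩) (y ⟨w, hw⟩))
      rw [sub_add_cancel] at h1
      exact h1.trans (max_le ((hx ⟨w, hw⟩).le.trans hε1) (y ⟨w, hw⟩).2)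
    refine ⟨⟨x, hxR⟩, fun w => ?_⟩
    rw [← hy w, eq_comm, QuotientAddGroup.eq]
    change w.1.abs (-(y w : k) + x) ≤ w.1.abs z
    rw [neg_add_eq_sub]
    exact (hx w).le.trans (hε w.1 w.2)
  choose x hx using hex
  refine Nat.card_le_card_of_injective
    (fun q => Ideal.Quotient.mk (Ideal.span {(⟨z, hzR⟩ : R)}) (x q)) ?_
  intro q q' hqq'
  funext w
  rw [← hx q w, ← hx q' w, eq_comm, QuotientAddGroup.eq]
  obtain ⟨t, ht⟩ := Ideal.mem_span_singleton'.1 (Ideal.Quotient.eq.1 hqq')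
  change w.1.abs (-(x q' : k) + x q) ≤ w.1.abs z
  have ht' : (t : k) * z = x q - x q' := congrArg Subtype.val ht
  rw [neg_add_eq_sub, ← ht', map_mul]
  exact mul_le_of_le_one_left (w.1.abs.nonneg z) (t.2 w.1 w.2)

/-- If `|z| < 1` then `|z| = q⁻ᵉ` with `e > 0`. -/
theorem exists_abs_eq_inv_pow (w : Place k) {z : k} (hz0 : z ≠ 0) (hz : w.abs z < 1) :
    ∃ e : ℕ, 0 < e ∧ w.abs z = ((w.card : ℝ) ^ e)⁻¹ := by
  obtain ⟨n, hn⟩ := w.exists_abs_eq_zpow hz0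
  have h1 : n < 0 := by
    by_contra! h
    rw [hn] at hz
    exact absurd hz (one_le_zpow₀ w.one_lt_card'.le h).not_gt
  refine ⟨n.natAbs, by omega, ?_⟩
  rw [hn, ← zpow_natCast, ← zpow_neg]
  congr 1
  omega

theorem relIndex_ball_pow (w : Place k) {z : k} {e : ℕ} (h : w.abs z = ((w.card : ℝ) ^ e)⁻¹) :
    (w.ball (w.abs z) (w.abs.nonneg z)).relIndex (w.ball 1) = w.card ^ e := by
  have := w.relIndex_ball_zpow (-e) e
  rw [← this]
  congr 2
  · rw [h, zpow_neg, zpow_natCast]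
  · simp

/-- Each zero contributes a factor at least `2` to the product in `prod_relIndex_le`. -/
theorem finite_abs_lt_one {z : k} (hz : Transcendental Fq z)
    [FiniteDimensional (IntermediateField.adjoin Fq {z}) k] :
    {w : Place k | w.abs z < 1}.Finite := by
  have hz0 : z ≠ 0 := by
    rintro rfl
    exact hz isAlgebraic_zero
  by_contra hinf
  obtain ⟨S, hS, hcard⟩ := Set.Infinite.exists_subset_card_eq hinf
    (Nat.card Fq ^ Module.finrank (IntermediateField.adjoin Fq {z}) k)
  have h1 := prod_relIndex_le hz S hS
  have h2 : 2 ^ S.card ≤ ∏ w ∈ S, (w.ball (w.abs z) (w.abs.nonneg z)).relIndex (w.ball 1) := by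
    rw [← Finset.prod_const]
    refine Finset.prod_le_prod (fun _ _ => Nat.zero_le _) fun w hw => ?_
    obtain ⟨e, he, h⟩ := w.exists_abs_eq_inv_pow hz0 (hS hw)
    rw [w.relIndex_ball_pow h]
    exact le_trans (Nat.succ_le_of_lt w.one_lt_card) (Nat.le_self_pow he.ne' _)
  rw [hcard] at h2
  exact absurd (h2.trans h1) Nat.lt_two_pow_self.not_ge

end Place

namespace Datum

variable {Fq k : Type*} [Field Fq] [Finite Fq] [Field k] [Algebra Fq k] (D : Datum Fq k)

/-- The elements of `A` of absolute value at most `ρ` at `∞`. -/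
def lattice (ρ : ℝ) (hρ : 0 ≤ ρ := by positivity) : AddSubgroup k :=
  D.A.toSubmodule.toAddSubgroup ⊓ D.inf.ball ρ hρ

/-- A nonzero function has a pole unless it is a constant. -/
theorem eq_zero_of_abs_lt_one (hk : IsGlobalFunctionField Fq k) {a : k} (ha : a ∈ D.A)
    (h : D.inf.abs a < 1) : a = 0 := by
  by_contra h0
  -- Since `|a⁻¹| > 1` somewhere, `a⁻¹` is not a constant and so vanishes at some place. There `a`
  -- has a pole, which is excluded at `∞` by `h` and elsewhere by `a ∈ A`.
  have htr : Transcendental Fq a⁻¹ := fun halg => by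
    have := D.inf.abs_le_one_of_isAlgebraic halg
    rw [map_inv₀] at this
    exact absurd ((inv_le_one₀ (D.inf.abs.pos h0)).1 this) h.not_ge
  obtain ⟨w, hw⟩ := hk.exists_place htr
  rw [map_inv₀] at hw
  have hw : 1 < w.abs a := (inv_lt_one₀ (w.abs.pos h0)).1 hw
  by_cases hwi : w = D.inf
  · rw [hwi] at hw
    exact absurd hw h.not_gt
  · exact absurd hw (ha w hwi).not_gt

theorem lattice_inv_card (hk : IsGlobalFunctionField Fq k) :
    D.lattice (D.inf.card : ℝ)⁻¹ = ⊥ := by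
  rw [eq_bot_iff]
  rintro x ⟨hx, hx'⟩
  exact D.eq_zero_of_abs_lt_one hk hx
    (lt_of_le_of_lt hx' (inv_lt_one_of_one_lt₀ D.inf.one_lt_card'))

/-- Intersecting with `A` cannot increase the index of balls. The second clause says that the index
is finite, an infinite index being recorded as `0`. -/
theorem relIndex_lattice_le (a : ℤ) (n : ℕ) :
    (D.lattice ((D.inf.card : ℝ) ^ a) (D.inf.zpow_card_nonneg a)).relIndex
      (D.lattice ((D.inf.card : ℝ) ^ (a + n)) (D.inf.zpow_card_nonneg _)) ≤ D.inf.card ^ n ∧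
    (D.lattice ((D.inf.card : ℝ) ^ a) (D.inf.zpow_card_nonneg a)).relIndex
      (D.lattice ((D.inf.card : ℝ) ^ (a + n)) (D.inf.zpow_card_nonneg _)) ≠ 0 := by
  have h1 := D.inf.relIndex_ball_zpow a n
  have h0 : D.inf.card ^ n ≠ 0 := pow_ne_zero _ (zero_lt_one.trans D.inf.one_lt_card).ne'
  rw [← h1] at h0
  have h2 : (D.lattice ((D.inf.card : ℝ) ^ a) (D.inf.zpow_card_nonneg a)).relIndex
      (D.lattice ((D.inf.card : ℝ) ^ (a + n)) (D.inf.zpow_card_nonneg _)) =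
      (D.inf.ball ((D.inf.card : ℝ) ^ a) (D.inf.zpow_card_nonneg a)).relIndex
      (D.lattice ((D.inf.card : ℝ) ^ (a + n)) (D.inf.zpow_card_nonneg _)) := by
    rw [← AddSubgroup.inf_relIndex_right, ← AddSubgroup.inf_relIndex_right (D.inf.ball _ _)]
    congr 1
    ext x
    simp only [lattice, AddSubgroup.mem_inf]
    tauto
  rw [h2, ← h1]
  exact ⟨AddSubgroup.relIndex_le_of_le_right inf_le_right h0,
    fun h => h0 (AddSubgroup.relIndex_eq_zero_of_le_right inf_le_right h)⟩

theorem lattice_mono {ρ ρ' : ℝ} {hρ : 0 ≤ ρ} {hρ' : 0 ≤ ρ'} (h : ρ ≤ ρ') :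
    D.lattice ρ hρ ≤ D.lattice ρ' hρ' := fun _ hx => ⟨hx.1, hx.2.trans h⟩

/-- The lattice of radius `card⁻¹` is zero, and every larger one is reached from it by steps of
finite index. -/
theorem finite_lattice (hk : IsGlobalFunctionField Fq k) (ρ : ℝ) (hρ : 0 ≤ ρ) :
    Finite (D.lattice ρ hρ) := by
  obtain ⟨n, hn⟩ := pow_unbounded_of_one_lt ρ D.inf.one_lt_card'
  have h1 := (D.relIndex_lattice_le (-1) (n + 1)).2
  have h2 : D.lattice ((D.inf.card : ℝ) ^ (-1 : ℤ)) (D.inf.zpow_card_nonneg _) = ⊥ := by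
    simpa using D.lattice_inv_card hk
  rw [h2, AddSubgroup.relIndex_bot_left] at h1
  have := Nat.finite_of_card_ne_zero h1
  refine Finite.of_injective _ (AddSubgroup.inclusion_injective
    (D.lattice_mono (hρ' := D.inf.zpow_card_nonneg (-1 + (n + 1 : ℕ))) ?_))
  rw [show (-1 + ((n + 1 : ℕ) : ℤ)) = (n : ℤ) by push_cast; ring, zpow_natCast]
  exact hn.le

end Datum

end

/-! ### Counting functions with poles bounded by a multiple of a polar divisor. -/

noncomputable section

open scoped IntermediateField.algebraAdjoinAdjoin

variable {Fq k : Type*} [Field Fq] [Finite Fq] [Field k] [Algebra Fq k]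

/-- The functions whose poles are bounded by `m` times the polar divisor of `x`. -/
def polarSpace (x : k) (m : ℕ) : AddSubgroup k where
  carrier := {a | ∀ w : Place k, w.abs a ≤ max 1 (w.abs x) ^ m}
  add_mem' {a b} ha hb w := (w.nonarch a b).trans (max_le (ha w) (hb w))
  zero_mem' w := by simp only [map_zero]; positivity
  neg_mem' {a} ha w := by simpa using ha w

theorem polarSpace_mul {x a b : k} {m n : ℕ} (ha : a ∈ polarSpace x m) (hb : b ∈ polarSpace x n) :
    a * b ∈ polarSpace x (m + n) := fun w => by
  rw [map_mul, pow_add]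
  exact mul_le_mul (ha w) (hb w) (w.abs.nonneg b) (by positivity)

theorem pow_mem_polarSpace (x : k) (n : ℕ) : x ^ n ∈ polarSpace x n := fun w => by
  rw [map_pow]
  exact pow_le_pow_left₀ (w.abs.nonneg x) (le_max_right _ _) n

theorem polarSpace_mono (x : k) {m n : ℕ} (h : m ≤ n) : polarSpace x m ≤ polarSpace x n :=
  fun _ ha w => (ha w).trans (pow_le_pow_right₀ (le_max_left _ _) h)

theorem constant_mul_mem_polarSpace {x a : k} {m : ℕ} (c : Fq) (ha : a ∈ polarSpace x m) :
    algebraMap Fq k c * a ∈ polarSpace x m := fun w => by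
  rw [map_mul]
  exact (mul_le_of_le_one_left (w.abs.nonneg a) (w.abs_algebraMap_le Fq c)).trans (ha w)

/-- A basis of `k` over `Fq(x)` that is integral over `Fq[x]` has poles only at those of `x`, so it
lies in some `polarSpace x c`. Its combinations with polynomial coefficients in `x` of degree below
`n` are distinct and lie in `polarSpace x (n + c)`. The hypothesis `hfin'` keeps `Nat.card`
meaningful. -/
theorem card_polarSpace_ge (hk : IsGlobalFunctionField Fq k) {x : k} (hx : Transcendental Fq x)
    (hfin : {w : Place k | 1 < w.abs x}.Finite) (hfin' : ∀ m, Finite (polarSpace x m)) :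
    ∃ c : ℕ, ∀ n : ℕ,
      Nat.card Fq ^ (n * Module.finrank (IntermediateField.adjoin Fq {x}) k) ≤
        Nat.card (polarSpace x (n + c)) := by
  have := hk.finiteDimensional hx
  obtain ⟨s, u, hu⟩ := FiniteDimensional.exists_is_basis_integral (Algebra.adjoin Fq {x})
    (IntermediateField.adjoin Fq {x}) k
  have hc : ∃ c, ∀ i, u i ∈ polarSpace x c := by
    have h1 : ∃ c, ∀ w ∈ {w : Place k | 1 < w.abs x}, ∀ i, w.abs (u i) ≤ w.abs x ^ c := by
      have h2 : ∀ w : Place k, 1 < w.abs x → ∃ c : ℕ, ∀ i, w.abs (u i) ≤ w.abs x ^ c := by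
        intro w hw
        obtain ⟨c, hc⟩ := pow_unbounded_of_one_lt (∑ i, w.abs (u i)) hw
        exact ⟨c, fun i => (Finset.single_le_sum (f := fun i => w.abs (u i))
          (fun i _ => w.abs.nonneg _) (Finset.mem_univ i)).trans hc.le⟩
      choose! c hc using h2
      refine ⟨hfin.toFinset.sup c, fun w hw i => (hc w hw i).trans ?_⟩
      exact pow_le_pow_right₀ (le_of_lt hw) (Finset.le_sup (by simpa using hw))
    obtain ⟨c, hc⟩ := h1
    refine ⟨c, fun i w => ?_⟩
    rcases le_or_gt (w.abs x) 1 with hw | hw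
    · rw [max_eq_left hw, one_pow]
      refine AbsoluteValue.le_one_of_isIntegral w.nonarch (S := Algebra.adjoin Fq {x}) ?_ (hu i)
      rintro ⟨y, hy⟩
      change w.abs y ≤ 1
      let R : Subalgebra Fq k :=
        { (absRing w.abs w.nonarch).toSubring with
          algebraMap_mem' := fun c => w.abs_algebraMap_le Fq c }
      have h3 : Algebra.adjoin Fq {x} ≤ R := Algebra.adjoin_le (Set.singleton_subset_iff.2 hw)
      exact h3 hy
    · exact (hc w hw i).trans (pow_le_pow_left₀ (w.abs.nonneg x) (le_max_right _ _) c)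
  obtain ⟨c, hc⟩ := hc
  refine ⟨c, fun n => ?_⟩
  have hs : Module.finrank (IntermediateField.adjoin Fq {x}) k = Fintype.card s :=
    Module.finrank_eq_card_basis u
  have := hfin' (n + c)
  let P (f : s → Fin n → Fq) (i : s) : Fq[X] := ∑ j : Fin n, Polynomial.monomial (j : ℕ) (f i j)
  let F (f : s → Fin n → Fq) : k := ∑ i, Polynomial.aeval x (P f i) * u i
  have hmem (f) : F f ∈ polarSpace x (n + c) := by
    refine AddSubgroup.sum_mem _ fun i _ => ?_
    simp only [P, map_sum, Finset.sum_mul, Polynomial.aeval_monomial]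
    refine AddSubgroup.sum_mem _ fun j _ => ?_
    rw [mul_assoc]
    refine constant_mul_mem_polarSpace _ (polarSpace_mono x (m := j + c) (by omega) ?_)
    exact polarSpace_mul (pow_mem_polarSpace x j) (hc i)
  have hinj : Function.Injective F := by
    intro f g hfg
    have hli := u.linearIndependent
    rw [← LinearIndependent.iff_fractionRing (Algebra.adjoin Fq {x}),
      Fintype.linearIndependent_iff] at hli
    have h1 := hli (fun i => ⟨Polynomial.aeval x (P f i - P g i), by
      rw [Algebra.adjoin_singleton_eq_range_aeval]; exact ⟨_, rfl⟩⟩) (by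
        change ∑ i, Polynomial.aeval x (P f i - P g i) * u i = 0
        simp only [map_sub, sub_mul, Finset.sum_sub_distrib]
        exact sub_eq_zero.2 hfg)
    funext i j
    have h2 : Polynomial.aeval x (P f i - P g i) = 0 := congrArg Subtype.val (h1 i)
    have h3 := (transcendental_iff.1 hx) _ h2
    have h4 := congrArg (Polynomial.coeff · (j : ℕ)) h3
    simp only [P, Polynomial.coeff_sub, Polynomial.finsetSum_coeff, Polynomial.coeff_monomial,
      Polynomial.coeff_zero] at h4
    simp only [Fin.val_inj, Finset.sum_ite_eq', Finset.mem_univ, if_true] at h4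
    exact sub_eq_zero.1 h4
  have h5 := Nat.card_le_card_of_injective (fun f => (⟨F f, hmem f⟩ : polarSpace x (n + c)))
    (fun f g h => hinj (congrArg Subtype.val h))
  rw [hs]
  simpa [Nat.card_pi, pow_mul] using h5

namespace Datum

variable (D : Datum Fq k)

/-- Of a function with poles at most `m` times those of `x`, demand no pole away from `∞` and one of
order at most `n` at `∞`. What remains lies in the lattice; the index of these conditions is
controlled place by place, and `prod_relIndex_le` for `x⁻¹` bounds the total. -/
theorem card_polarSpace_le (hk : IsGlobalFunctionField Fq k) {x : k}
    (hx : D.inf.abs x = D.inf.card) (n m : ℕ) (hnm : n ≤ m) :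
    Finite (polarSpace x m) ∧ Nat.card (polarSpace x m) * D.inf.card ^ n ≤
      Nat.card (D.lattice ((D.inf.card : ℝ) ^ n)) *
        Nat.card Fq ^ (Module.finrank (IntermediateField.adjoin Fq {x}) k * m) := by
  classical
  have hx1 : 1 < D.inf.abs x := hx ▸ D.inf.one_lt_card'
  have hx0 : x ≠ 0 := by
    rintro rfl
    simp at hx1
    linarith
  have hinv (w : Place k) : w.abs x⁻¹ < 1 ↔ 1 < w.abs x := by
    rw [map_inv₀, inv_lt_one₀ (w.abs.pos hx0)]
  have htr : Transcendental Fq x⁻¹ := fun h =>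
    (((hinv D.inf).2 hx1).ne (D.inf.abs_eq_one_of_isAlgebraic h (inv_ne_zero hx0)))
  have hadj : IntermediateField.adjoin Fq {x} = IntermediateField.adjoin Fq {x⁻¹} := by
    apply le_antisymm <;> rw [IntermediateField.adjoin_simple_le_iff]
    · simpa using inv_mem (IntermediateField.mem_adjoin_simple_self Fq x⁻¹)
    · exact inv_mem (IntermediateField.mem_adjoin_simple_self Fq x)
  have := hk.finiteDimensional htr
  have hfin : {w : Place k | 1 < w.abs x}.Finite := by
    simpa only [hinv] using Place.finite_abs_lt_one htr
  set S := hfin.toFinset with hS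
  have hSmem (w : Place k) : w ∈ S ↔ 1 < w.abs x := by simp [hS]
  have hprod := Place.prod_relIndex_le htr S (fun w hw => (hinv w).2 ((hSmem w).1 hw))
  have hinfS : D.inf ∈ S := (hSmem _).2 hx1
  choose! e he0 he using fun w hw =>
    Place.exists_abs_eq_inv_pow w (inv_ne_zero hx0) ((hinv w).2 ((hSmem w).1 hw))
  have he' : ∀ w ∈ S, w.abs x = (w.card : ℝ) ^ e w := fun w hw => by
    have := he w hw
    rwa [map_inv₀, inv_inj] at this
  rw [Finset.prod_congr rfl fun w hw => w.relIndex_ball_pow (he w hw), ← hadj] at hprod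
  have heinf : e D.inf = 1 := by
    have := he' _ hinfS
    rw [hx] at this
    nth_rw 1 [← pow_one (D.inf.card : ℝ)] at this
    exact (pow_right_injective₀ D.inf.card_pos D.inf.one_lt_card'.ne' this).symm
  -- The pole order still allowed at `w`. As `x` has a simple pole at `∞`, the condition `n ≤ m`
  -- gives `b w ≤ e w * m`.
  let b (w : Place k) : ℕ := if w = D.inf then n else 0
  have hb : ∀ w ∈ S, b w ≤ e w * m := by
    intro w _
    by_cases hw : w = D.inf
    · simp [b, hw, heinf, hnm]
    · simp [b, hw]
  let G (w : S) : AddSubgroup k := w.1.ball ((w.1.card : ℝ) ^ b w)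
  have hG (w : S) : (G w).relIndex (polarSpace x m) ≤ w.1.card ^ (e w * m - b w) ∧
      (G w).relIndex (polarSpace x m) ≠ 0 := by
    have h1 := w.1.relIndex_ball_zpow (b w) (e w * m - b w)
    have h0 : w.1.card ^ (e w * m - b w) ≠ 0 :=
      pow_ne_zero _ (zero_lt_one.trans w.1.one_lt_card).ne'
    have hle : polarSpace x m ≤ w.1.ball ((w.1.card : ℝ) ^ ((b w : ℤ) + (e w * m - b w : ℕ)))
        (w.1.zpow_card_nonneg _) := by
      intro a ha
      refine (ha w).trans (le_of_eq ?_)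
      rw [max_eq_right ((hSmem _).1 w.2).le, he' _ w.2, ← pow_mul, ← zpow_natCast]
      congr 1
      have := hb w.1 w.2
      omega
    have hGe : G w = w.1.ball ((w.1.card : ℝ) ^ (b w : ℤ)) (w.1.zpow_card_nonneg _) := by
      simp only [G, zpow_natCast]
    rw [hGe]
    rw [← h1] at h0 ⊢
    exact ⟨AddSubgroup.relIndex_le_of_le_right hle h0,
      fun h => h0 (AddSubgroup.relIndex_eq_zero_of_le_right hle h)⟩
  have h1 := AddSubgroup.relIndex_iInf_le (L := polarSpace x m) G
  have h1' := AddSubgroup.relIndex_iInf_ne_zero (L := polarSpace x m) (f := G) fun w => (hG w).2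
  have hle : (⨅ w, G w) ⊓ polarSpace x m ≤ D.lattice ((D.inf.card : ℝ) ^ n) := by
    rintro a ⟨ha, ha'⟩
    have ha := fun w => AddSubgroup.mem_iInf.1 ha w
    refine ⟨fun w hw => ?_, ?_⟩
    · by_cases hwS : w ∈ S
      · simpa [G, b, hw] using ha ⟨w, hwS⟩
      · have h2 := ha' w
        rw [hSmem, not_lt] at hwS
        rwa [max_eq_left hwS, one_pow] at h2
    · simpa [G, b] using ha ⟨D.inf, hinfS⟩
  rw [← AddSubgroup.inf_relIndex_right] at h1 h1'
  have hle' : (⨅ w, G w) ⊓ polarSpace x m ≤ polarSpace x m := inf_le_right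
  have hfl := D.finite_lattice hk ((D.inf.card : ℝ) ^ n) (by positivity)
  have hfl' : Finite ((⨅ w, G w) ⊓ polarSpace x m : AddSubgroup k) :=
    Finite.of_injective _ (AddSubgroup.inclusion_injective hle)
  have hcard := AddSubgroup.relIndex_mul_relIndex ⊥ _ _ bot_le hle'
  simp only [AddSubgroup.relIndex_bot_left] at hcard
  refine ⟨Nat.finite_of_card_ne_zero ?_, ?_⟩
  · rw [← hcard]
    exact mul_ne_zero Nat.card_pos.ne' h1'
  rw [← hcard, mul_assoc]
  refine Nat.mul_le_mul (Nat.card_le_card_of_injective _ (AddSubgroup.inclusion_injective hle)) ?_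
  calc _ ≤ (∏ w : S, w.1.card ^ (e w * m - b w)) * D.inf.card ^ n :=
        Nat.mul_le_mul_right _ (h1.trans (Finset.prod_le_prod (fun _ _ => Nat.zero_le _)
          fun w _ => (hG w).1))
    _ = (∏ w : S, w.1.card ^ (e w * m - b w)) * ∏ w : S, w.1.card ^ b w := by
        congr 1
        rw [Finset.prod_coe_sort S (fun w => w.card ^ b w), Finset.prod_eq_single D.inf]
        · simp [b]
        · intro w _ hw
          simp [b, hw]
        · exact fun h => absurd hinfS h
    _ = (∏ w ∈ S, w.card ^ e w) ^ m := by
        rw [← Finset.prod_mul_distrib, ← Finset.prod_pow,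
          ← Finset.prod_coe_sort S (fun w => (w.card ^ e w) ^ m)]
        refine Finset.prod_congr rfl fun w _ => ?_
        rw [← pow_add, ← pow_mul, Nat.sub_add_cancel (hb w.1 w.2)]
    _ ≤ _ := by
        rw [pow_mul]
        exact Nat.pow_le_pow_left hprod m

/-- Riemann's inequality for the multiples of `∞`. -/
theorem exists_card_lattice_ge (hk : IsGlobalFunctionField Fq k) :
    ∃ C : ℕ, 0 < C ∧ ∀ n : ℕ, D.inf.card ^ n ≤ C * Nat.card (D.lattice ((D.inf.card : ℝ) ^ n)) := by
  obtain ⟨ϖ, h0, h1, -⟩ := D.inf.exists_uniformizer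
  have hx : D.inf.abs ϖ⁻¹ = D.inf.card := by rw [map_inv₀, h1, inv_inv]
  have htr : Transcendental Fq ϖ⁻¹ := fun h =>
    D.inf.one_lt_card'.ne' (hx ▸ D.inf.abs_eq_one_of_isAlgebraic h (inv_ne_zero h0))
  have htr' : Transcendental Fq ϖ := fun h => htr h.inv
  have := hk.finiteDimensional htr'
  have hfin : {w : Place k | 1 < w.abs ϖ⁻¹}.Finite := by
    refine (Place.finite_abs_lt_one htr').subset fun w hw => ?_
    have hw : 1 < w.abs ϖ⁻¹ := hw
    rw [map_inv₀, one_lt_inv₀ (w.abs.pos h0)] at hw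
    exact hw
  obtain ⟨c, hc⟩ := card_polarSpace_ge hk htr hfin
    (fun m => (D.card_polarSpace_le hk hx 0 m (Nat.zero_le m)).1)
  set N := Module.finrank (IntermediateField.adjoin Fq {ϖ⁻¹}) k
  have hq : 0 < Nat.card Fq := Nat.card_pos
  -- The upper and lower counts of `polarSpace` for `m = n + c` differ by this factor, which does
  -- not depend on `n`.
  refine ⟨Nat.card Fq ^ (N * c), by positivity, fun n => ?_⟩
  have h2 := (D.card_polarSpace_le hk hx n (n + c) (Nat.le_add_right _ _)).2
  have h3 := (Nat.mul_le_mul_right (D.inf.card ^ n) (hc n)).trans h2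
  rw [mul_add, pow_add, mul_comm N n] at h3
  refine le_of_mul_le_mul_left (a := Nat.card Fq ^ (n * N)) (h3.trans (le_of_eq ?_))
    (by positivity)
  ring

end Datum

end

noncomputable section

/-! ### The ring `A` -/

variable {Fq k : Type*} [Field Fq] [Finite Fq] [Field k] [Algebra Fq k]

namespace Datum

variable (D : Datum Fq k)

theorem lattice_pow_le_succ (n : ℕ) :
    D.lattice ((D.inf.card : ℝ) ^ n) ≤ D.lattice ((D.inf.card : ℝ) ^ (n + 1)) :=
  D.lattice_mono (pow_le_pow_right₀ D.inf.one_lt_card'.le n.le_succ)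

/-- The numbers `L n / Q ^ n` decrease, since each step has index at most `Q`, and stay above a
positive constant by Riemann's inequality, so they converge to a positive limit and their successive
ratios tend to `1`. These ratios are `r / Q` with an integer `r ≤ Q`, which forces `r = Q`
eventually. -/
theorem exists_card_lattice_succ (hk : IsGlobalFunctionField Fq k) :
    ∃ n₀ : ℕ, ∀ n, n₀ ≤ n → Nat.card (D.lattice ((D.inf.card : ℝ) ^ (n + 1))) =
      D.inf.card * Nat.card (D.lattice ((D.inf.card : ℝ) ^ n)) := by
  obtain ⟨C, hC, hge⟩ := D.exists_card_lattice_ge hk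
  set Q := D.inf.card with hQ
  set L : ℕ → ℕ := fun n => Nat.card (D.lattice ((Q : ℝ) ^ n)) with hL
  have hstep (n : ℕ) : ∃ r ≤ Q, L (n + 1) = r * L n := by
    have h1 := D.relIndex_lattice_le n 1
    have h2 := AddSubgroup.relIndex_mul_relIndex ⊥ _ _ bot_le (D.lattice_pow_le_succ n)
    simp only [AddSubgroup.relIndex_bot_left] at h2
    refine ⟨_, ?_, by rw [mul_comm]; exact h2.symm⟩
    refine le_trans (le_of_eq ?_) (h1.1.trans (pow_one _).le)
    congr 2
  have hQ0 : (0 : ℝ) < Q := D.inf.card_pos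
  set a : ℕ → ℝ := fun n => L n / (Q : ℝ) ^ n with ha
  have hanti : Antitone a := by
    refine antitone_nat_of_succ_le fun n => ?_
    obtain ⟨r, hr, h⟩ := hstep n
    simp only [ha, h]
    rw [div_le_div_iff₀ (by positivity) (by positivity), pow_succ]
    have : (r : ℝ) ≤ Q := by exact_mod_cast hr
    push_cast
    nlinarith [mul_le_mul_of_nonneg_right this (by positivity : (0 : ℝ) ≤ L n * Q ^ n)]
  have hlow (n : ℕ) : (C : ℝ)⁻¹ ≤ a n := by
    have hC' : (0 : ℝ) < C := by exact_mod_cast hC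
    simp only [ha]
    rw [le_div_iff₀ (by positivity), inv_mul_le_iff₀ hC']
    have h := (Nat.cast_le (α := ℝ)).2 (hge n)
    rw [Nat.cast_pow, Nat.cast_mul] at h
    exact h
  have hlim := tendsto_atTop_ciInf hanti ⟨(C : ℝ)⁻¹, by rintro _ ⟨n, rfl⟩; exact hlow n⟩
  set ℓ := ⨅ n, a n
  have hℓ : 0 < ℓ := lt_of_lt_of_le (by positivity) (le_ciInf hlow)
  -- A ratio above `1 - Q⁻¹` means `r > Q - 1`.
  have hev : ∀ᶠ n in atTop, (1 - (Q : ℝ)⁻¹) * a n < a (n + 1) := by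
    have h1 := ((tendsto_add_atTop_iff_nat 1).2 hlim).sub (hlim.const_mul (1 - (Q : ℝ)⁻¹))
    have h2 : 0 < ℓ - (1 - (Q : ℝ)⁻¹) * ℓ := by
      have : 0 < (Q : ℝ)⁻¹ * ℓ := by positivity
      linarith
    filter_upwards [h1.eventually (lt_mem_nhds h2)] with n hn
    linarith
  obtain ⟨n₀, hn₀⟩ := eventually_atTop.1 hev
  refine ⟨n₀, fun n hn => ?_⟩
  obtain ⟨r, hr, h⟩ := hstep n
  have h1 := hn₀ n hn
  have hLpos : (0 : ℝ) < L n := by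
    have := (hlow n)
    have h0 : 0 < a n := lt_of_lt_of_le (by positivity) this
    simp only [ha] at h0
    by_contra! h2
    have : (L n : ℝ) = 0 := le_antisymm h2 (Nat.cast_nonneg _)
    rw [this, zero_div] at h0
    exact h0.false
  simp only [ha, h] at h1
  have h2 : (Q : ℝ) - 1 < r := by
    rw [← mul_div_assoc, div_lt_div_iff₀ (by positivity) (by positivity), pow_succ] at h1
    push_cast at h1
    have h3 : (1 - (Q : ℝ)⁻¹) * Q = Q - 1 := by field_simp
    have h4 : ((1 - (Q : ℝ)⁻¹) * Q) * (L n * Q ^ n) < r * (L n * Q ^ n) := by linarith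
    rw [h3] at h4
    exact lt_of_mul_lt_mul_right h4 (by positivity)
  have h3 : Q < r + 1 := by
    have : (Q : ℝ) < r + 1 := by linarith
    exact_mod_cast this
  have h5 : r = Q := by omega
  exact h.trans (by rw [h5])

/-- The image of an ideal of `A` in `k`. -/
def idealGroup (I : Ideal D.A) : AddSubgroup k :=
  I.toAddSubgroup.map D.A.val.toRingHom.toAddMonoidHom

theorem mem_idealGroup {I : Ideal D.A} {x : k} :
    x ∈ D.idealGroup I ↔ ∃ a ∈ I, (a : k) = x := Iff.rfl

theorem mem_idealGroup_top {x : k} : x ∈ D.idealGroup ⊤ ↔ x ∈ D.A := by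
  rw [mem_idealGroup]
  exact ⟨by rintro ⟨a, -, rfl⟩; exact a.2, fun h => ⟨⟨x, h⟩, trivial, rfl⟩⟩

theorem card_quotient_eq (I : Ideal D.A) :
    Nat.card (D.A ⧸ I) = (D.idealGroup I).relIndex (D.idealGroup ⊤) := by
  unfold idealGroup
  rw [AddSubgroup.relIndex_map_map_of_injective _ _ Subtype.val_injective]
  exact (AddSubgroup.relIndex_top_right I.toAddSubgroup).symm

theorem one_le_abs (hk : IsGlobalFunctionField Fq k) {a : k} (ha : a ∈ D.A) (h0 : a ≠ 0) :
    1 ≤ D.inf.abs a := by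
  by_contra! h
  exact h0 (D.eq_zero_of_abs_lt_one hk ha h)

theorem exists_abs_eq_pow (hk : IsGlobalFunctionField Fq k) {a : k} (ha : a ∈ D.A) (h0 : a ≠ 0) :
    ∃ n : ℕ, D.inf.abs a = (D.inf.card : ℝ) ^ n := by
  obtain ⟨n, hn⟩ := D.inf.exists_abs_eq_zpow h0
  have h1 := D.one_le_abs hk ha h0
  have h2 : 0 ≤ n := by
    by_contra! h
    rw [hn] at h1
    exact absurd (zpow_lt_one_of_neg₀ D.inf.one_lt_card' h) h1.not_gt
  exact ⟨n.toNat, by rw [hn, ← zpow_natCast, Int.toNat_of_nonneg h2]⟩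

/-- The product formula for elements of `A`: `#A/(a) = |a|`. -/
theorem card_quotient_span_singleton (hk : IsGlobalFunctionField Fq k) {a : D.A} (h0 : a ≠ 0) :
    (Nat.card (D.A ⧸ Ideal.span {a}) : ℝ) = D.inf.abs (a : k) := by
  have h0' : (a : k) ≠ 0 := fun h => h0 (Subtype.ext h)
  obtain ⟨h, hh⟩ := D.exists_abs_eq_pow hk a.2 h0'
  obtain ⟨n₀, hn₀⟩ := D.exists_card_lattice_succ hk
  set Q := D.inf.card
  have hQ : 0 < Q := zero_lt_one.trans D.inf.one_lt_card
  have hfin (n : ℕ) := D.finite_lattice hk ((Q : ℝ) ^ n) (by positivity)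
  have hcard (n : ℕ) (hn : n₀ ≤ n) (h : ℕ) : Nat.card (D.lattice ((Q : ℝ) ^ (n + h))) =
      Q ^ h * Nat.card (D.lattice ((Q : ℝ) ^ n)) := by
    induction h with
    | zero => simp
    | succ h ih => rw [← add_assoc, hn₀ _ (by omega), ih]; ring
  set G := D.idealGroup (Ideal.span {a}) with hG
  have hGmem (x : k) : x ∈ G ↔ ∃ y ∈ D.A, (a : k) * y = x := by
    rw [hG, mem_idealGroup]
    constructor
    · rintro ⟨b, hb, rfl⟩
      obtain ⟨c, rfl⟩ := Ideal.mem_span_singleton'.1 hb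
      exact ⟨c, c.2, mul_comm _ _⟩
    · rintro ⟨y, hy, rfl⟩
      exact ⟨a * ⟨y, hy⟩, Ideal.mul_mem_right _ _ (Ideal.mem_span_singleton_self a), rfl⟩
  -- Multiplication by `a`, of absolute value `Q ^ h`, shifts the lattice index by `h`.
  have hinter (n : ℕ) : G ⊓ D.lattice ((Q : ℝ) ^ (n + h)) =
      (D.lattice ((Q : ℝ) ^ n)).map (AddMonoidHom.mulLeft (a : k)) := by
    ext x
    rw [AddSubgroup.mem_inf, hGmem, AddSubgroup.mem_map]
    constructor
    · rintro ⟨⟨y, hy, rfl⟩, hx⟩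
      refine ⟨y, ⟨hy, ?_⟩, rfl⟩
      have : D.inf.abs (a * y) ≤ (Q : ℝ) ^ (n + h) := hx.2
      rw [map_mul, hh, pow_add, mul_comm] at this
      exact le_of_mul_le_mul_right this (by positivity)
    · rintro ⟨y, hy, rfl⟩
      refine ⟨⟨y, hy.1, rfl⟩, D.A.mul_mem a.2 hy.1, ?_⟩
      change D.inf.abs (a * y) ≤ _
      rw [map_mul, hh, pow_add, mul_comm]
      exact mul_le_mul_of_nonneg_right hy.2 (by positivity)
  have hrel (n : ℕ) (hn : n₀ ≤ n) : G.relIndex (D.lattice ((Q : ℝ) ^ (n + h))) = Q ^ h := by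
    have h1 := AddSubgroup.relIndex_mul_relIndex ⊥ (G ⊓ D.lattice ((Q : ℝ) ^ (n + h)))
      _ bot_le inf_le_right
    rw [AddSubgroup.relIndex_bot_left, AddSubgroup.relIndex_bot_left,
      AddSubgroup.inf_relIndex_right, hinter, hcard n hn h] at h1
    have h2 : Nat.card ((D.lattice ((Q : ℝ) ^ n)).map (AddMonoidHom.mulLeft (a : k))) =
        Nat.card (D.lattice ((Q : ℝ) ^ n)) :=
      (Nat.card_congr ((D.lattice ((Q : ℝ) ^ n)).equivMapOfInjective _
        (mul_right_injective₀ h0')).toEquiv).symm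
    rw [h2, mul_comm] at h1
    exact Nat.eq_of_mul_eq_mul_right Nat.card_pos h1
  -- The lattices have increasing images in `k / (a)`, all of order `Q ^ h` from `n₀` on, so the
  -- images are equal. Since the lattices exhaust `A`, that common image is `A / (a)`.
  let φ := QuotientAddGroup.mk' G
  have hφ (H : AddSubgroup k) : Nat.card (H.map φ) = G.relIndex H := by
    rw [← AddSubgroup.relIndex_ker, QuotientAddGroup.ker_mk']
  have hmono (n : ℕ) (hn : n₀ ≤ n) : (D.lattice ((Q : ℝ) ^ (n + h))).map φ =
      (D.lattice ((Q : ℝ) ^ (n₀ + h))).map φ := by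
    have hf : Finite ((D.lattice ((Q : ℝ) ^ (n + h))).map φ) := by
      refine Nat.finite_of_card_ne_zero ?_
      rw [hφ, hrel n hn]
      positivity
    refine (AddSubgroup.eq_of_le_of_card_ge (AddSubgroup.map_mono
      (D.lattice_mono (pow_le_pow_right₀ D.inf.one_lt_card'.le (by omega)))) ?_).symm
    rw [hφ, hφ, hrel n hn, hrel n₀ le_rfl]
  have htop : (D.idealGroup ⊤).map φ = (D.lattice ((Q : ℝ) ^ (n₀ + h))).map φ := by
    apply le_antisymm
    · rintro _ ⟨x, hx, rfl⟩
      have hxA := D.mem_idealGroup_top.1 hx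
      obtain ⟨n, hn⟩ := pow_unbounded_of_one_lt (D.inf.abs x) D.inf.one_lt_card'
      rw [← hmono (n + n₀) (by omega)]
      refine ⟨x, ⟨hxA, hn.le.trans ?_⟩, rfl⟩
      exact pow_le_pow_right₀ D.inf.one_lt_card'.le (by omega)
    · exact AddSubgroup.map_mono fun x hx => D.mem_idealGroup_top.2 hx.1
  rw [card_quotient_eq, ← hφ, htop, hφ, hrel n₀ le_rfl, hh]
  push_cast
  rfl

theorem finite_quotient_span_singleton (hk : IsGlobalFunctionField Fq k) {a : D.A} (h0 : a ≠ 0) :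
    Finite (D.A ⧸ Ideal.span {a}) := by
  refine Nat.finite_of_card_ne_zero fun h => ?_
  have h1 := D.card_quotient_span_singleton hk h0
  rw [h] at h1
  exact h0 (Subtype.ext (D.inf.abs.eq_zero.1 (by exact_mod_cast h1.symm)))

theorem finite_quotient (hk : IsGlobalFunctionField Fq k) {I : Ideal D.A} (hI : I ≠ ⊥) :
    Finite (D.A ⧸ I) := by
  obtain ⟨a, haI, ha⟩ := Submodule.exists_mem_ne_zero_of_ne_bot hI
  have := D.finite_quotient_span_singleton hk ha
  exact Finite.of_surjective _ (Ideal.Quotient.factor_surjective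
    ((Ideal.span_singleton_le_iff_mem _).2 haI))

theorem mem_A_of_isIntegral {x : k} (hx : IsIntegral D.A x) : x ∈ D.A := fun w hw =>
  AbsoluteValue.le_one_of_isIntegral w.nonarch (S := D.A) (fun a => a.2 w hw) hx

/-- Finite quotients give Noetherianity and dimension one; `A` is integrally closed as an
intersection of valuation rings. -/
theorem isDedekindDomain (hk : IsGlobalFunctionField Fq k) : IsDedekindDomain D.A := by
  have h1 : IsNoetherianRing D.A := isNoetherianRing_of_finite_quotient
    fun a ha => D.finite_quotient_span_singleton hk ha
  have h2 : Ring.DimensionLEOne D.A := ⟨fun {P} hP hprime => by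
    have := D.finite_quotient hk hP
    exact Ideal.Quotient.maximal_of_isField _ (Finite.isField_of_domain _)⟩
  have h3 : IsIntegrallyClosed D.A := by
    rw [isIntegrallyClosed_iff (FractionRing D.A)]
    intro x hx
    let f : FractionRing D.A →ₐ[D.A] k :=
      IsFractionRing.liftAlgHom (g := Algebra.ofId D.A k) Subtype.val_injective
    refine ⟨⟨f x, D.mem_A_of_isIntegral (hx.map f)⟩, f.toRingHom.injective ?_⟩
    change f _ = f x
    rw [AlgHom.commutes]
    rfl
  exact { }

theorem infinite_A (hk : IsGlobalFunctionField Fq k) : Infinite D.A := by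
  obtain ⟨C, hC, hge⟩ := D.exists_card_lattice_ge hk
  by_contra h
  have hfin : Finite D.A := not_infinite_iff_finite.1 h
  obtain ⟨n, hn⟩ := pow_unbounded_of_one_lt (C * Nat.card D.A) D.inf.one_lt_card
  refine absurd (hge n) (not_le.2 (lt_of_le_of_lt ?_ hn))
  exact Nat.mul_le_mul_left _ (Nat.card_le_card_of_injective
    (fun x : D.lattice ((D.inf.card : ℝ) ^ n) => (⟨x.1, x.2.1⟩ : D.A))
    (fun x y h => Subtype.ext (congrArg (fun z : D.A => (z : k)) h)))

theorem card_quotient_mul (hk : IsGlobalFunctionField Fq k) (I J : Ideal D.A) :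
    Nat.card (D.A ⧸ (I * J)) = Nat.card (D.A ⧸ I) * Nat.card (D.A ⧸ J) := by
  have := D.isDedekindDomain hk
  -- Infinitude of `A` makes the count `0` for the zero ideal, so multiplicativity needs no
  -- nonvanishing hypothesis.
  have := D.infinite_A hk
  simp only [← Submodule.cardQuot_apply]
  exact UniqueFactorizationMonoid.multiplicative_of_coprime Submodule.cardQuot I J
      (Submodule.cardQuot_bot _ _)
      (fun {I J} hI => by simp [Ideal.isUnit_iff.mp hI, Ideal.mul_top])
      (fun {I} i hI =>
        have : Ideal.IsPrime I := Ideal.isPrime_of_prime hI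
        cardQuot_pow_of_prime hI.ne_zero)
      fun {I J} hIJ => cardQuot_mul_of_coprime <| Ideal.isCoprime_iff_sup_eq.mpr
        (Ideal.isUnit_iff.mp
          (hIJ (Ideal.dvd_iff_le.mpr le_sup_left) (Ideal.dvd_iff_le.mpr le_sup_right)))

/-- Minkowski's pigeonhole: two lattice elements congruent modulo `I` differ by an element of `I` in
the same ball. -/
theorem exists_mem_lattice_mem (I : Ideal D.A) (ρ : ℝ) (hρ : 0 ≤ ρ) [Finite (D.A ⧸ I)]
    (h : Nat.card (D.A ⧸ I) < Nat.card (D.lattice ρ hρ)) :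
    ∃ a ∈ I, a ≠ 0 ∧ D.inf.abs (a : k) ≤ ρ := by
  by_contra! hcon
  refine absurd (Nat.card_le_card_of_injective
    (fun x : D.lattice ρ hρ => Ideal.Quotient.mk I ⟨x.1, x.2.1⟩) ?_) h.not_ge
  intro x y hxy
  have h1 := Ideal.Quotient.eq.1 hxy
  by_contra hne
  have h2 := hcon _ h1 (fun h => hne (Subtype.ext (sub_eq_zero.1 (congrArg Subtype.val h))))
  exact h2.not_ge ((D.lattice ρ hρ).sub_mem x.2 y.2).2

/-- One fixed finite lattice exceeds all the residue rings in question, so every such ideal contains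
a nonzero element of it; each of these elements lies in finitely many ideals. -/
theorem finite_ideals_card_le (hk : IsGlobalFunctionField Fq k) (B : ℕ) :
    {I : Ideal D.A | I ≠ ⊥ ∧ Nat.card (D.A ⧸ I) ≤ B}.Finite := by
  obtain ⟨C, hC, hge⟩ := D.exists_card_lattice_ge hk
  obtain ⟨n, hn⟩ := pow_unbounded_of_one_lt (C * B) D.inf.one_lt_card
  have hB : B < Nat.card (D.lattice ((D.inf.card : ℝ) ^ n)) :=
    lt_of_mul_lt_mul_left (hn.trans_le (hge n)) (Nat.zero_le C)
  have hfin := D.finite_lattice hk ((D.inf.card : ℝ) ^ n) (by positivity)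
  have hS : {a : D.A | D.inf.abs (a : k) ≤ (D.inf.card : ℝ) ^ n}.Finite :=
    Set.Finite.of_injOn (f := Subtype.val) (t := (D.lattice ((D.inf.card : ℝ) ^ n) (pow_nonneg (Nat.cast_nonneg _) n) : Set k))
      (fun a ha => ⟨a.2, ha⟩) (Subtype.val_injective.injOn) (Set.toFinite _)
  refine ((hS.sep (fun a => a ≠ 0)).biUnion (t := fun a => {I : Ideal D.A | a ∈ I})
    ?_).subset ?_
  · rintro a ⟨-, ha⟩
    have := D.finite_quotient_span_singleton hk ha
    have hfI : Finite (Ideal (D.A ⧸ Ideal.span {a})) :=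
      Finite.of_injective (fun I => (I : Set (D.A ⧸ Ideal.span {a}))) SetLike.coe_injective
    refine (Set.finite_range (Ideal.comap (Ideal.Quotient.mk (Ideal.span {a})))).subset ?_
    intro I hI
    refine ⟨I.map (Ideal.Quotient.mk (Ideal.span {a})), ?_⟩
    exact Ideal.comap_map_mk ((Ideal.span_singleton_le_iff_mem _).2 hI)
  · rintro I ⟨hI, hIB⟩
    have := D.finite_quotient hk hI
    obtain ⟨a, haI, ha0, ha⟩ := D.exists_mem_lattice_mem I _ _ (hIB.trans_lt hB)
    exact Set.mem_biUnion (show a ∈ {a ∈ _ | a ≠ 0} from ⟨ha, ha0⟩) haI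

/-- Every nonzero ideal has a multiple which is principal, with bounded cofactor. -/
theorem exists_mul_eq_span (hk : IsGlobalFunctionField Fq k) :
    ∃ B : ℕ, ∀ I : Ideal D.A, I ≠ ⊥ → ∃ (J : Ideal D.A) (a : D.A),
      J ≠ ⊥ ∧ a ≠ 0 ∧ Nat.card (D.A ⧸ J) ≤ B ∧ I * J = Ideal.span {a} := by
  have := D.isDedekindDomain hk
  obtain ⟨C, hC, hge⟩ := D.exists_card_lattice_ge hk
  refine ⟨C * D.inf.card, fun I hI => ?_⟩
  have hfI := D.finite_quotient hk hI
  have hN : 0 < Nat.card (D.A ⧸ I) := Nat.card_pos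
  -- The first power of the residue order beyond `C * #(A/I)`: large enough for the pigeonhole, and
  -- overshooting by at most one factor `D.inf.card`, which bounds the cofactor.
  set n := Nat.log D.inf.card (C * Nat.card (D.A ⧸ I)) + 1 with hn
  have h1 : C * Nat.card (D.A ⧸ I) < D.inf.card ^ n := Nat.lt_pow_succ_log_self D.inf.one_lt_card _
  have h2 : D.inf.card ^ n ≤ C * Nat.card (D.A ⧸ I) * D.inf.card := by
    rw [hn, pow_succ]
    exact Nat.mul_le_mul_right _ (Nat.pow_log_le_self _ (by positivity))
  obtain ⟨a, haI, ha0, ha⟩ := D.exists_mem_lattice_mem I ((D.inf.card : ℝ) ^ n) (by positivity)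
    (lt_of_mul_lt_mul_left (h1.trans_le (hge n)) (Nat.zero_le C))
  obtain ⟨J, hJ⟩ := Ideal.dvd_span_singleton.2 haI
  have hJ0 : J ≠ ⊥ := by
    rintro rfl
    rw [Ideal.mul_bot, Ideal.span_singleton_eq_bot] at hJ
    exact ha0 hJ
  refine ⟨J, a, hJ0, ha0, ?_, hJ.symm⟩
  have h3 : Nat.card (D.A ⧸ I) * Nat.card (D.A ⧸ J) ≤ D.inf.card ^ n := by
    rw [← D.card_quotient_mul hk, ← hJ]
    have := D.card_quotient_span_singleton hk ha0
    rw [← this] at ha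
    exact_mod_cast ha
  refine le_of_mul_le_mul_left (h3.trans (h2.trans (le_of_eq ?_))) hN
  ring

theorem exists_pow_eq_span (hk : IsGlobalFunctionField Fq k) :
    ∃ N : ℕ, 0 < N ∧ ∀ I : Ideal D.A, I ≠ ⊥ → ∃ a : D.A, a ≠ 0 ∧ I ^ N = Ideal.span {a} := by
  have := D.isDedekindDomain hk
  obtain ⟨B, hB⟩ := D.exists_mul_eq_span hk
  have hfin := D.finite_ideals_card_le hk B
  have : Finite (ClassGroup D.A) := by
    have := hfin.to_subtype
    -- The bounded cofactor of an ideal represents the inverse of its class.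
    refine Finite.of_surjective (fun J : {I : Ideal D.A | I ≠ ⊥ ∧ Nat.card (D.A ⧸ I) ≤ B} =>
      (ClassGroup.mk0 ⟨J.1, mem_nonZeroDivisors_of_ne_zero J.2.1⟩)⁻¹) ?_
    intro c
    obtain ⟨⟨I, hI⟩, rfl⟩ := ClassGroup.mk0_surjective c
    obtain ⟨J, a, hJ, ha, hcard, h⟩ := hB I (nonZeroDivisors.ne_zero hI)
    refine ⟨⟨J, hJ, hcard⟩, ?_⟩
    refine inv_eq_iff_mul_eq_one.2 ((MonoidHom.map_mul ClassGroup.mk0 _ _).symm.trans ?_)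
    rw [ClassGroup.mk0_eq_one_iff]
    exact ⟨⟨a, ((mul_comm J I).trans h : J * I = Ideal.span {a})⟩⟩
  refine ⟨Nat.card (ClassGroup D.A), Nat.card_pos, fun I hI => ?_⟩
  have h1 := pow_card_eq_one' (x := ClassGroup.mk0 ⟨I, mem_nonZeroDivisors_of_ne_zero hI⟩)
  rw [← MonoidHom.map_pow, ClassGroup.mk0_eq_one_iff] at h1
  obtain ⟨a, ha⟩ := h1.principal
  refine ⟨a, ?_, ha⟩
  rintro rfl
  have h2 : I ^ Nat.card (ClassGroup D.A) = ⊥ := by simpa using ha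
  exact hI (pow_eq_zero_iff (Nat.card_pos.ne') |>.1 h2)

end Datum

end

noncomputable section

/-! ### Completions -/

namespace AbsoluteValue

variable {K : Type*} [Field K] {v : AbsoluteValue K ℝ} (hv : IsNonarchimedean v)

theorem mem_maximalIdeal_absRing (x : absRing v hv) :
    x ∈ IsLocalRing.maximalIdeal (absRing v hv) ↔ v x < 1 := by
  rw [IsLocalRing.mem_maximalIdeal, mem_nonunits_iff, isUnit_iff_exists_inv]
  constructor
  · intro h1
    refine lt_of_le_of_ne x.2 fun h2 => h1 ?_
    have hx0 : (x : K) ≠ 0 := fun h => by simp [h] at h2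
    refine ⟨⟨(x : K)⁻¹, ?_⟩, Subtype.ext (mul_inv_cancel₀ hx0)⟩
    change v (x : K)⁻¹ ≤ 1
    rw [map_inv₀, h2, inv_one]
  · rintro h1 ⟨y, hxy⟩
    have h2 : v x * v y = 1 := by
      rw [← map_mul, show (x : K) * y = 1 from congrArg Subtype.val hxy, map_one]
    have h3 : v x * v y ≤ v x := mul_le_of_le_one_right (v.nonneg _) y.2
    exact absurd h1 (h2 ▸ h3).not_gt

theorem pow_card_sub_one [Finite (IsLocalRing.ResidueField (absRing v hv))] {x : K} (hx : v x = 1) :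
    v (x ^ (Nat.card (IsLocalRing.ResidueField (absRing v hv)) - 1) - 1) < 1 := by
  set y : absRing v hv := ⟨x, hx.le⟩
  have h1 : IsLocalRing.residue _ y ≠ 0 := by
    rw [Ne, IsLocalRing.residue_eq_zero_iff, mem_maximalIdeal_absRing hv]
    exact hx.not_lt
  have h2 := congrArg Units.val (pow_card_eq_one' (x := Units.mk0 _ h1))
  rw [Nat.card_units] at h2
  simp only [Units.val_pow_eq_pow_val, Units.val_mk0, Units.val_one] at h2
  rw [← map_pow, ← map_one (IsLocalRing.residue _), ← sub_eq_zero, ← map_sub,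
    IsLocalRing.residue_eq_zero_iff, mem_maximalIdeal_absRing hv] at h2
  exact h2

end AbsoluteValue

namespace Place

variable {k : Type*} [Field k] (w : Place k)

theorem norm_algebraMap_local (x : k) : ‖algebraMap k w.Local x‖ = w.abs x := by
  rw [UniformSpace.Completion.algebraMap_def, UniformSpace.Completion.norm_coe]
  rfl

theorem norm_algebraMap_algCl (x : w.Local) : ‖algebraMap w.Local w.AlgCl x‖ = ‖x‖ :=
  spectralNorm_extends x

theorem norm_algebraMap_cp (x : w.AlgCl) : ‖algebraMap w.AlgCl w.Cp x‖ = ‖x‖ :=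
  UniformSpace.Completion.norm_coe x

instance : IsScalarTower k w.Local w.AlgCl := inferInstance

instance : IsScalarTower w.Local w.AlgCl w.Cp := IsScalarTower.of_algebraMap_eq' rfl

instance : IsScalarTower k w.AlgCl w.Cp := IsScalarTower.of_algebraMap_eq' rfl

instance : IsScalarTower k w.Local w.Cp := IsScalarTower.of_algebraMap_eq fun x => by
  rw [IsScalarTower.algebraMap_apply k w.AlgCl w.Cp, IsScalarTower.algebraMap_apply k w.Local w.AlgCl,
    ← IsScalarTower.algebraMap_apply w.Local w.AlgCl w.Cp]

theorem norm_algebraMap_local_cp (x : w.Local) : ‖algebraMap w.Local w.Cp x‖ = ‖x‖ := by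
  rw [IsScalarTower.algebraMap_apply w.Local w.AlgCl w.Cp, norm_algebraMap_cp,
    norm_algebraMap_algCl]

theorem norm_algebraMap (x : k) : ‖algebraMap k w.Cp x‖ = w.abs x := by
  rw [IsScalarTower.algebraMap_apply k w.Local w.Cp, norm_algebraMap_local_cp,
    norm_algebraMap_local]

theorem norm_algebraMap_k_algCl (x : k) : ‖algebraMap k w.AlgCl x‖ = w.abs x := by
  rw [IsScalarTower.algebraMap_apply k w.Local w.AlgCl, norm_algebraMap_algCl,
    norm_algebraMap_local]

instance : IsUltrametricDist w.Cp := by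
  refine IsUltrametricDist.isUltrametricDist_of_forall_norm_add_le_max_norm fun x y => ?_
  induction x, y using UniformSpace.Completion.induction_on₂ with
  | hp => exact isClosed_le (by fun_prop) (by fun_prop)
  | ih a b =>
    rw [← UniformSpace.Completion.coe_add]
    simpa only [UniformSpace.Completion.norm_coe] using IsUltrametricDist.norm_add_le_max a b

/-- Every element of the completion is close to an element of `k`. -/
theorem exists_approx_local (x : w.Local) {ε : ℝ} (hε : 0 < ε) :
    ∃ y : k, ‖x - algebraMap k w.Local y‖ < ε := by
  obtain ⟨y, hy⟩ := Metric.denseRange_iff.1 (UniformSpace.Completion.denseRange_coe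
    (α := WithAbs w.abs)) x ε hε
  refine ⟨y.ofAbs, ?_⟩
  rw [dist_eq_norm] at hy
  exact hy

theorem abs_pow_card_sub_one {x : k} (hx : w.abs x = 1) : w.abs (x ^ (w.card - 1) - 1) < 1 :=
  AbsoluteValue.pow_card_sub_one w.nonarch hx

end Place

/-! ### One-units -/

section OneUnit

variable {C : Type*} [NormedField C] [IsUltrametricDist C]

theorem norm_eq_one_of_norm_sub_one_lt {u : C} (hu : ‖u - 1‖ < 1) : ‖u‖ = 1 := by
  have h := IsUltrametricDist.norm_eq_of_add_norm_lt_max (x := u) (y := -1) (by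
    rw [← sub_eq_add_neg]
    exact hu.trans_le (by simp))
  simpa using h

theorem norm_sub_one_mul_lt {u v : C} {ρ : ℝ} (hu : ‖u - 1‖ < ρ) (hv : ‖v - 1‖ < ρ) (hρ : ρ ≤ 1) :
    ‖u * v - 1‖ < ρ := by
  have h1 : u * v - 1 = u * (v - 1) + (u - 1) := by ring
  rw [h1]
  refine (IsUltrametricDist.norm_add_le_max _ _).trans_lt (max_lt ?_ hu)
  rw [norm_mul, norm_eq_one_of_norm_sub_one_lt (hu.trans_le hρ), one_mul]
  exact hv

theorem norm_sub_one_pow_lt {u : C} {ρ : ℝ} (hu : ‖u - 1‖ < ρ) (hρ : ρ ≤ 1) (n : ℕ) :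
    ‖u ^ n - 1‖ < ρ := by
  induction n with
  | zero => simpa using (norm_nonneg _).trans_lt hu
  | succ n ih => rw [pow_succ]; exact norm_sub_one_mul_lt ih hu hρ

theorem norm_inv_sub_one {u : C} (hu : ‖u - 1‖ < 1) : ‖u⁻¹ - 1‖ = ‖u - 1‖ := by
  have h0 : u ≠ 0 := by
    rintro rfl
    simp at hu
  have : u⁻¹ - 1 = u⁻¹ * -(u - 1) := by field_simp; ring
  rw [this, norm_mul, norm_inv, norm_eq_one_of_norm_sub_one_lt hu, norm_neg]
  simp

/-- In characteristic `p`, extracting a root of a `1`-unit moves it away from `1` by a controlled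
amount. -/
theorem norm_sub_one_pow_le (p : ℕ) [Fact p.Prime] [CharP C p] {u : C} (hu : ‖u - 1‖ < 1) {N : ℕ} (hN : 0 < N) :
    ‖u - 1‖ ^ N ≤ ‖u ^ N - 1‖ := by
  -- The exponent `m` prime to `p` preserves the distance to `1`, because the geometric sum is
  -- congruent to `m`, of norm `1`. Frobenius raises that distance to the power `p ^ e ≤ N`.
  obtain ⟨e, m, hm, rfl⟩ := Nat.exists_eq_pow_mul_and_not_dvd hN.ne' p (Fact.out : p.Prime).ne_one
  have h1 : ‖u ^ m - 1‖ = ‖u - 1‖ := by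
    have h2 : u ^ m - 1 = (u - 1) * ∑ i ∈ Finset.range m, u ^ i := (mul_geom_sum u m).symm
    have h3 : ‖(∑ i ∈ Finset.range m, u ^ i) - m‖ < 1 := by
      have : (∑ i ∈ Finset.range m, u ^ i) - m = ∑ i ∈ Finset.range m, (u ^ i - 1) := by
        simp
      rw [this]
      obtain ⟨i, -, hi⟩ := IsUltrametricDist.exists_norm_finsetSum_le (Finset.range m)
        (fun i => u ^ i - 1)
      exact hi.trans_lt (norm_sub_one_pow_lt hu le_rfl i)
    have h4 : ‖(m : C)‖ = 1 := by
      have hp := (Fact.out : p.Prime).two_le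
      have hm' : (m : ZMod p) ≠ 0 := by rwa [Ne, ZMod.natCast_eq_zero_iff]
      have h6 := congrArg (ZMod.castHom (dvd_refl p) C) (ZMod.pow_card_sub_one_eq_one hm')
      rw [map_pow, map_natCast, map_one] at h6
      refine (pow_eq_one_iff_of_nonneg (norm_nonneg _) (by omega : p - 1 ≠ 0)).1 ?_
      rw [← norm_pow, h6, norm_one]
    have h5 : ‖∑ i ∈ Finset.range m, u ^ i‖ = 1 := by
      rw [← h4, ← norm_neg (m : C)]
      refine IsUltrametricDist.norm_eq_of_add_norm_lt_max ?_
      rw [← sub_eq_add_neg, norm_neg, h4]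
      exact h3.trans_le (le_max_right _ _)
    rw [h2, norm_mul, h5, mul_one]
  have h2 : u ^ (p ^ e * m) - 1 = (u ^ m - 1) ^ (p ^ e) := by
    rw [sub_pow_expChar_pow, one_pow, ← pow_mul, mul_comm]
  rw [h2, norm_pow, h1]
  have hm0 : m ≠ 0 := by
    rintro rfl
    simp at hN
  exact pow_le_pow_of_le_one (norm_nonneg _) hu.le (Nat.le_mul_of_pos_right _ (Nat.pos_of_ne_zero hm0))

/-- Roots of `1`-units within the `1`-units are unique in characteristic `p`; this is what makes
`⟨I⟩` well defined. -/
theorem eq_of_pow_eq_of_norm_sub_one_lt (p : ℕ) [Fact p.Prime] [CharP C p] {u v : C} (hu : ‖u - 1‖ < 1) (hv : ‖v - 1‖ < 1) {N : ℕ}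
    (hN : 0 < N) (h : u ^ N = v ^ N) : u = v := by
  have hv0 : v ≠ 0 := by
    rintro rfl
    simp at hv
  have h1 : ‖u * v⁻¹ - 1‖ < 1 := norm_sub_one_mul_lt hu ((norm_inv_sub_one hv).trans_lt hv) le_rfl
  have h2 := norm_sub_one_pow_le p h1 hN
  rw [mul_pow, inv_pow, h, mul_inv_cancel₀ (pow_ne_zero _ hv0), sub_self, norm_zero] at h2
  have h3 := (pow_eq_zero_iff hN.ne').1 (le_antisymm h2 (by positivity))
  rw [norm_eq_zero, sub_eq_zero] at h3
  exact (mul_inv_eq_one₀ hv0).1 h3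

end OneUnit

/-- If `P` is monic and splits, and `|P(x)| < 1`, then `x` is close to a root of `P`. -/
theorem exists_root_norm_sub_lt_one {C : Type*} [NormedField C] [IsAlgClosed C] {P : C[X]}
    (hP : P.Monic) {x : C} (h : ‖P.eval x‖ < 1) : ∃ y, P.IsRoot y ∧ ‖x - y‖ < 1 := by
  by_contra! hcon
  have h1 : P.eval x = (P.roots.map (fun y => x - y)).prod := by
    conv_lhs => rw [(IsAlgClosed.splits P).eq_prod_roots_of_monic hP]
    rw [Polynomial.eval_multiset_prod, Multiset.map_map]
    simp
  rw [h1] at h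
  refine absurd h (not_lt.2 ?_)
  have h2 : ∀ s : Multiset C, (∀ y ∈ s, 1 ≤ ‖x - y‖) → 1 ≤ ‖(s.map (fun y => x - y)).prod‖ := by
    intro s
    induction s using Multiset.induction with
    | empty => simp
    | cons a s ih =>
      intro hs
      rw [Multiset.map_cons, Multiset.prod_cons, norm_mul]
      exact one_le_mul_of_one_le_of_one_le (hs a (Multiset.mem_cons_self a s))
        (ih fun y hy => hs y (Multiset.mem_cons_of_mem hy))
  exact h2 _ fun y hy => hcon y (Polynomial.isRoot_of_mem_roots hy)

end

noncomputable section

/-! ### Positive elements and the values `⟨I⟩` -/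

theorem Place.charP_cp {Fq k : Type*} [Field Fq] [Field k] [Algebra Fq k] (w : Place k) (p : ℕ)
    [CharP Fq p] : CharP w.Cp p :=
  charP_of_injective_ringHom ((algebraMap k w.Cp).comp (algebraMap Fq k)).injective p

namespace Place

variable {k : Type*} [Field k] (w : Place k)

theorem norm_pow_card_sub_one {x : w.Local} (hx : ‖x‖ = 1) : ‖x ^ (w.card - 1) - 1‖ < 1 := by
  obtain ⟨y, hy⟩ := w.exists_approx_local x one_pos
  set y' := algebraMap k w.Local y
  have hy1 : ‖y'‖ = 1 := by
    rw [← hx, eq_comm, ← norm_neg y']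
    refine IsUltrametricDist.norm_eq_of_add_norm_lt_max ?_
    rw [← sub_eq_add_neg]
    exact hy.trans_le (le_max_of_le_left hx.ge)
  have hy0 : y' ≠ 0 := by
    intro h
    simp [h] at hy1
  have h1 : ‖x / y' - 1‖ < 1 := by
    rw [div_sub_one hy0, norm_div, hy1, div_one]
    exact hy
  have h2 : ‖y' ^ (w.card - 1) - 1‖ < 1 := by
    rw [← map_pow, ← map_one (algebraMap k w.Local), ← map_sub, norm_algebraMap_local]
    refine w.abs_pow_card_sub_one ?_
    rw [← norm_algebraMap_local]
    exact hy1
  have h3 : x ^ (w.card - 1) = (x / y') ^ (w.card - 1) * y' ^ (w.card - 1) := by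
    rw [← mul_pow, div_mul_cancel₀ _ hy0]
  rw [h3]
  exact norm_sub_one_mul_lt (norm_sub_one_pow_lt h1 le_rfl _) h2 le_rfl

end Place

namespace Datum

variable {Fq k : Type*} [Field Fq] [Finite Fq] [Field k] [Algebra Fq k] (D : Datum Fq k)

theorem norm_unif_eq : ‖D.unif‖ = (D.inf.card : ℝ)⁻¹ := D.norm_unif

theorem unif_ne_zero : D.unif ≠ 0 := by
  rw [← norm_pos_iff, norm_unif_eq]
  exact inv_pos.2 D.inf.card_pos

theorem norm_unif_zpow (n : ℤ) : ‖D.unif ^ n‖ = (D.inf.card : ℝ) ^ (-n) := by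
  rw [norm_zpow, norm_unif_eq, inv_zpow, zpow_neg]

theorem deg_inf_pos : 0 < D.inf.deg Fq := by
  by_contra! h
  have h1 := D.inf.card_eq (Fq := Fq)
  rw [Nat.le_zero.1 h, pow_zero] at h1
  exact D.inf.one_lt_card.ne' h1

theorem norm_root : ‖D.root‖ = (Nat.card Fq : ℝ)⁻¹ := by
  have h1 := congrArg norm D.root_pow
  rw [norm_pow, D.inf.norm_algebraMap_local_cp, norm_unif_eq, D.inf.card_eq (Fq := Fq),
    Nat.cast_pow, ← inv_pow] at h1
  exact (pow_left_inj₀ (by positivity) (by positivity) D.deg_inf_pos.ne').1 h1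

theorem root_ne_zero : D.root ≠ 0 := by
  rw [← norm_pos_iff, norm_root]
  have : 0 < Nat.card Fq := Nat.card_pos
  positivity

variable {D}

theorem PositiveWith.norm_eq {α u : D.inf.Local} (h : D.PositiveWith α u) :
    ∃ n : ℤ, α = D.unif ^ n * u ∧ ‖α‖ = (D.inf.card : ℝ) ^ (-n) := by
  obtain ⟨hu, n, hn⟩ := h
  refine ⟨n, hn, ?_⟩
  rw [hn, norm_mul, norm_eq_one_of_norm_sub_one_lt hu, mul_one, norm_unif_zpow]

theorem PositiveWith.ne_zero {α u : D.inf.Local} (h : D.PositiveWith α u) : α ≠ 0 := by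
  obtain ⟨n, -, hn⟩ := h.norm_eq
  rw [← norm_pos_iff, hn]
  exact zpow_pos D.inf.card_pos _

theorem PositiveWith.pow {α u : D.inf.Local} (h : D.PositiveWith α u) (t : ℕ) :
    D.PositiveWith (α ^ t) (u ^ t) := by
  obtain ⟨hu, n, hn⟩ := h
  refine ⟨norm_sub_one_pow_lt hu le_rfl t, n * t, ?_⟩
  rw [hn, mul_pow, zpow_mul, zpow_natCast]

theorem PositiveWith.div {α β u v : D.inf.Local} (h : D.PositiveWith α u)
    (h' : D.PositiveWith β v) : D.PositiveWith (α / β) (u / v) := by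
  obtain ⟨hu, n, hn⟩ := h
  obtain ⟨hv, m, hm⟩ := h'
  refine ⟨?_, n - m, ?_⟩
  · rw [div_eq_mul_inv]
    exact norm_sub_one_mul_lt hu ((norm_inv_sub_one hv).trans_lt hv) le_rfl
  · rw [hn, hm, zpow_sub₀ D.unif_ne_zero, mul_div_mul_comm]

theorem PositiveWith.norm_sub_one_lt {α u : D.inf.Local} (h : D.PositiveWith α u) (h1 : ‖α‖ = 1) :
    α = u ∧ ‖α - 1‖ < 1 := by
  obtain ⟨n, hn, hn'⟩ := h.norm_eq
  have h0 : n = 0 := by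
    rw [h1] at hn'
    have := (zpow_eq_one_iff_right₀ D.inf.card_pos.le D.inf.one_lt_card'.ne').1 hn'.symm
    omega
  rw [h0, zpow_zero, one_mul] at hn
  exact ⟨hn, hn ▸ h.1⟩

theorem PositiveWith.unique {α u v : D.inf.Local} (h : D.PositiveWith α u)
    (h' : D.PositiveWith α v) : u = v := by
  have h1 := h.div h'
  rw [div_self h.ne_zero] at h1
  have h2 := (h1.norm_sub_one_lt norm_one).1
  have hv : v ≠ 0 := by
    rintro rfl
    simpa using h'.1
  exact ((div_eq_one_iff_eq hv).1 h2.symm)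

/-- A positive generator of an ideal is unique. -/
theorem eq_of_span_eq (hk : IsGlobalFunctionField Fq k) {a b : D.A} {u v : D.inf.Local}
    (h : Ideal.span {a} = Ideal.span {b})
    (ha : D.PositiveWith (algebraMap k D.inf.Local a) u)
    (hb : D.PositiveWith (algebraMap k D.inf.Local b) v) : a = b := by
  have ha0 : (a : k) ≠ 0 := fun h => ha.ne_zero (by rw [h, map_zero])
  have hb0 : (b : k) ≠ 0 := fun h => hb.ne_zero (by rw [h, map_zero])
  obtain ⟨c, hc⟩ := Ideal.mem_span_singleton'.1 (h ▸ Ideal.mem_span_singleton_self a)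
  have hc' : (c : k) * b = a := congrArg Subtype.val hc
  have h1 := ha.div hb
  -- By the product formula the cofactor `c` has absolute value `1`, and it is positive, so `c - 1`
  -- is an element of `A` of absolute value below `1` at `∞`.
  rw [← map_div₀, ← hc', mul_div_cancel_right₀ _ hb0] at h1
  have hn : D.inf.abs (a : k) = D.inf.abs (b : k) := by
    rw [← D.card_quotient_span_singleton hk (fun h => ha0 (by rw [h]; rfl)), h,
      D.card_quotient_span_singleton hk (fun h => hb0 (by rw [h]; rfl))]
  rw [← hc', map_mul] at hn
  have hc1 : D.inf.abs (c : k) = 1 :=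
    mul_right_cancel₀ (D.inf.abs.ne_zero hb0) (hn.trans (one_mul _).symm)
  have h2 := (h1.norm_sub_one_lt (by rw [D.inf.norm_algebraMap_local, hc1])).2
  rw [← map_one (algebraMap k D.inf.Local), ← map_sub, D.inf.norm_algebraMap_local] at h2
  have h3 := D.eq_zero_of_abs_lt_one hk (D.A.sub_mem c.2 D.A.one_mem) h2
  apply Subtype.val_injective
  rw [← hc', sub_eq_zero.1 h3, one_mul]

variable (D)

/-- The leading coefficient lives in the residue field at `∞`, and the exponent `card - 1` turns it
into `1`. -/
theorem exists_positiveWith_pow {a : D.A} (h0 : a ≠ 0) :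
    ∃ u, D.PositiveWith (algebraMap k D.inf.Local ((a ^ (D.inf.card - 1) : D.A) : k)) u := by
  have h0' : (a : k) ≠ 0 := fun h => h0 (Subtype.ext h)
  obtain ⟨n, hn⟩ := D.inf.exists_abs_eq_zpow h0'
  set α := algebraMap k D.inf.Local (a : k)
  have h1 : ‖D.unif ^ n * α‖ = 1 := by
    rw [norm_mul, norm_unif_zpow, D.inf.norm_algebraMap_local, hn, zpow_neg, inv_mul_cancel₀]
    exact (zpow_pos D.inf.card_pos _).ne'
  refine ⟨_, D.inf.norm_pow_card_sub_one h1, (-n) * (D.inf.card - 1 : ℕ), ?_⟩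
  rw [zpow_mul, zpow_natCast, ← mul_pow, ← mul_assoc, ← zpow_add₀ D.unif_ne_zero,
    neg_add_cancel, zpow_zero, one_mul, SubmonoidClass.coe_pow, map_pow]

/-- There is an exponent which makes every ideal principal with a positive generator. -/
theorem exists_positive_generator (hk : IsGlobalFunctionField Fq k) :
    ∃ N : ℕ, 0 < N ∧ ∀ I : D.Ideals, ∃ (a : D.A) (u : D.inf.Local), I.1 ^ N = Ideal.span {a} ∧
      D.PositiveWith (algebraMap k D.inf.Local (a : k)) u := by
  obtain ⟨N, hN, h⟩ := D.exists_pow_eq_span hk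
  have hQ := D.inf.one_lt_card
  refine ⟨N * (D.inf.card - 1), Nat.mul_pos hN (by omega), fun I => ?_⟩
  obtain ⟨a, ha0, ha⟩ := h I.1 I.2
  obtain ⟨u, hu⟩ := D.exists_positiveWith_pow ha0
  exact ⟨_, u, by rw [pow_mul, ha, Ideal.span_singleton_pow], hu⟩

theorem card_quotient_ideal (hk : IsGlobalFunctionField Fq k) (I : D.Ideals) :
    Nat.card (D.A ⧸ I.1) = Nat.card Fq ^ D.degI I := by
  have := D.finite_quotient hk I.2
  have : Module.Finite Fq (D.A ⧸ I.1) := Module.Finite.of_finite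
  exact Module.natCard_eq_pow_finrank

theorem card_quotient_pow (hk : IsGlobalFunctionField Fq k) (I : D.Ideals) (N : ℕ) :
    Nat.card (D.A ⧸ (I.1 ^ N)) = Nat.card Fq ^ (D.degI I * N) := by
  induction N with
  | zero =>
    rw [pow_zero, mul_zero, pow_zero, Ideal.one_eq_top, Nat.card_eq_one_iff_unique]
    exact ⟨Ideal.Quotient.subsingleton_iff.2 rfl, ⟨0⟩⟩
  | succ N ih =>
    rw [pow_succ, D.card_quotient_mul hk, ih, D.card_quotient_ideal hk, ← pow_add]
    rfl

theorem abs_generator (hk : IsGlobalFunctionField Fq k) {I : D.Ideals} {N : ℕ} {a : D.A}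
    (h : I.1 ^ N = Ideal.span {a}) (ha : a ≠ 0) :
    D.inf.abs (a : k) = (Nat.card Fq : ℝ) ^ (D.degI I * N) := by
  rw [← D.card_quotient_span_singleton hk ha, ← h, D.card_quotient_pow hk]
  push_cast
  rfl

theorem finite_ideals_degI (hk : IsGlobalFunctionField Fq k) (n : ℕ) :
    {I : D.Ideals | D.degI I = n}.Finite := by
  refine Set.Finite.of_finite_image (f := Subtype.val)
    ((D.finite_ideals_card_le hk (Nat.card Fq ^ n)).subset ?_) Subtype.val_injective.injOn
  rintro _ ⟨I, hI, rfl⟩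
  refine ⟨I.2, ?_⟩
  rw [D.card_quotient_ideal hk, hI]

/-- The polynomial `X ^ N - u` takes the small value `1 - u` at `1`, so one of its roots is close to
`1`. -/
theorem exists_root_of_norm_sub_one_lt {u : D.inf.Local} (hu : ‖u - 1‖ < 1) {N : ℕ} (hN : 0 < N) :
    ∃ z : D.inf.Cp, ‖z - 1‖ < 1 ∧ z ^ N = algebraMap D.inf.Local D.inf.Cp u := by
  set u' := algebraMap D.inf.Local D.inf.AlgCl u
  obtain ⟨y, hy, hy1⟩ := exists_root_norm_sub_lt_one (P := Polynomial.X ^ N - Polynomial.C u')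
    (Polynomial.monic_X_pow_sub_C _ hN.ne') (x := 1) (by
      simp only [Polynomial.eval_sub, Polynomial.eval_pow, Polynomial.eval_X, Polynomial.eval_C,
        one_pow]
      rw [← map_one (algebraMap D.inf.Local D.inf.AlgCl), ← map_sub, D.inf.norm_algebraMap_algCl,
        norm_sub_rev]
      exact hu)
  refine ⟨algebraMap _ _ y, ?_, ?_⟩
  · rw [← map_one (algebraMap D.inf.AlgCl D.inf.Cp), ← map_sub, D.inf.norm_algebraMap_cp,
      norm_sub_rev]
    exact hy1
  · rw [IsScalarTower.algebraMap_apply D.inf.Local D.inf.AlgCl D.inf.Cp, ← map_pow]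
    congr 1
    simpa [sub_eq_zero] using hy

theorem bracket_spec (hk : IsGlobalFunctionField Fq k) (I : D.Ideals) :
    ‖D.bracket I - 1‖ < 1 ∧
    ∃ (t : ℕ) (a : D.A) (u : D.inf.Local), 0 < t ∧ I.1 ^ t = Ideal.span {a} ∧
      D.PositiveWith (algebraMap k D.inf.Local (a : k)) u ∧
      D.bracket I ^ t = algebraMap D.inf.Local D.inf.Cp u := by
  obtain ⟨N, hN, h⟩ := D.exists_positive_generator hk
  obtain ⟨a, u, hI, hu⟩ := h I
  obtain ⟨z, hz, hzN⟩ := D.exists_root_of_norm_sub_one_lt hu.1 hN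
  exact Classical.epsilon_spec (p := fun z : D.inf.Cp => ‖z - 1‖ < 1 ∧
    ∃ (t : ℕ) (a : D.A) (u : D.inf.Local), 0 < t ∧ I.1 ^ t = Ideal.span {a} ∧
      D.PositiveWith (algebraMap k D.inf.Local (a : k)) u ∧
      z ^ t = algebraMap D.inf.Local D.inf.Cp u) ⟨z, hz, N, a, u, hN, hI, hu, hzN⟩

/-- Independence of the choice made in `bracket`: suitable powers of `a` and of the chosen generator
are positive generators of the same ideal, hence equal, and roots of `1`-units are unique. -/
theorem bracket_pow (p : ℕ) [Fact p.Prime] [CharP Fq p] (hk : IsGlobalFunctionField Fq k) {I : D.Ideals} {N : ℕ} {a : D.A}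
    {u : D.inf.Local} (h : I.1 ^ N = Ideal.span {a})
    (ha : D.PositiveWith (algebraMap k D.inf.Local (a : k)) u) :
    D.bracket I ^ N = algebraMap D.inf.Local D.inf.Cp u := by
  have := D.inf.charP_cp (Fq := Fq) p
  obtain ⟨hz, t, b, v, ht, hI, hv, hzt⟩ := D.bracket_spec hk I
  have h1 : a ^ t = b ^ N := by
    refine eq_of_span_eq hk (u := u ^ t) (v := v ^ N) ?_ ?_ ?_
    · rw [← Ideal.span_singleton_pow, ← Ideal.span_singleton_pow, ← h, ← hI, ← pow_mul, ← pow_mul,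
        mul_comm]
    · simpa using ha.pow t
    · simpa using hv.pow N
  have h2 : u ^ t = v ^ N := by
    have h3 : algebraMap k D.inf.Local (a : k) ^ t = algebraMap k D.inf.Local (b : k) ^ N := by
      rw [← map_pow, ← map_pow]
      exact congrArg (fun x : D.A => algebraMap k D.inf.Local (x : k)) h1
    exact (h3 ▸ ha.pow t).unique (hv.pow N)
  refine eq_of_pow_eq_of_norm_sub_one_lt p (norm_sub_one_pow_lt hz le_rfl N) ?_ ht ?_
  · rw [← map_one (algebraMap D.inf.Local D.inf.Cp), ← map_sub, D.inf.norm_algebraMap_local_cp]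
    exact ha.1
  · rw [← map_pow, h2, map_pow, ← hzt, ← pow_mul, ← pow_mul, mul_comm]

/-- By the product formula the factor `π_* ^ (- deg I * N)` is exactly the power of `π` split off
from `a`. Thus `I ^ (s₁)` is an ordinary root of an element of `A`, and its size under every
embedding can be read off. -/
theorem idealOne_pow (p : ℕ) [Fact p.Prime] [CharP Fq p] (hk : IsGlobalFunctionField Fq k) {I : D.Ideals} {N : ℕ} {a : D.A}
    {u : D.inf.Local} (h : I.1 ^ N = Ideal.span {a})
    (ha : D.PositiveWith (algebraMap k D.inf.Local (a : k)) u) :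
    D.idealOne I ^ N = algebraMap k D.inf.Cp (a : k) := by
  obtain ⟨n, hn, hn'⟩ := ha.norm_eq
  have ha0 : a ≠ 0 := by
    rintro rfl
    exact ha.ne_zero (by simp)
  have hq : 1 < Nat.card Fq := Finite.one_lt_card
  have hq' : (1 : ℝ) < Nat.card Fq := by exact_mod_cast hq
  have h1 : ((D.degI I * N : ℕ) : ℤ) = -(D.inf.deg Fq * n) := by
    rw [D.inf.norm_algebraMap_local, D.abs_generator hk h ha0, D.inf.card_eq (Fq := Fq),
      Nat.cast_pow, ← zpow_natCast, ← zpow_natCast, ← zpow_mul] at hn'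
    rw [zpow_right_injective₀ (zero_lt_one.trans hq') hq'.ne' hn', mul_neg]
  unfold idealOne
  rw [mul_pow, D.bracket_pow p hk h ha, IsScalarTower.algebraMap_apply k D.inf.Local D.inf.Cp, hn,
    map_mul, map_zpow₀, ← D.root_pow, ← pow_mul, inv_pow, ← zpow_natCast, ← zpow_natCast, h1,
    zpow_neg, inv_inv, zpow_mul]

end Datum

end

noncomputable section

/-! ### Finiteness of the value field -/

/-- A substitute for the reduction map on the completion; only its finitely many values and the
closeness of elements in one fibre are needed. -/
theorem Place.exists_residue_map {k : Type*} [Field k] (w : Place k) :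
    ∃ f : w.Local → w.Residue, ∀ x y, ‖x‖ ≤ 1 → ‖y‖ ≤ 1 → f x = f y → ‖x - y‖ < 1 := by
  have h (x : w.Local) : ∃ r : w.Residue, ‖x‖ ≤ 1 → ∃ y : absRing w.abs w.nonarch,
      ‖x - algebraMap k w.Local y‖ < 1 ∧ IsLocalRing.residue _ y = r := by
    by_cases hx : ‖x‖ ≤ 1
    · obtain ⟨y, hy⟩ := w.exists_approx_local x one_pos
      have hy1 : w.abs y ≤ 1 := by
        rw [← w.norm_algebraMap_local]
        have h1 := IsUltrametricDist.norm_add_le_max x (-(x - algebraMap k w.Local y))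
        rw [norm_neg, ← sub_eq_add_neg, sub_sub_cancel] at h1
        exact h1.trans (max_le hx hy.le)
      exact ⟨_, fun _ => ⟨⟨y, hy1⟩, hy, rfl⟩⟩
    · exact ⟨0, fun h => absurd h hx⟩
  choose f hf using h
  refine ⟨f, fun x y hx hy hxy => ?_⟩
  obtain ⟨x', hx', hx2⟩ := hf x hx
  obtain ⟨y', hy', hy2⟩ := hf y hy
  have h1 : w.abs ((x' : k) - y') < 1 := by
    refine (AbsoluteValue.mem_maximalIdeal_absRing w.nonarch (x' - y')).1 ?_
    rw [← IsLocalRing.residue_eq_zero_iff, map_sub, hx2, hy2, hxy, sub_self]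
  have h2 : x - y = (x - algebraMap k w.Local x') + (algebraMap k w.Local ((x' : k) - y') -
      (y - algebraMap k w.Local y')) := by
    rw [map_sub]
    ring
  rw [h2]
  refine (IsUltrametricDist.norm_add_le_max _ _).trans_lt (max_lt hx' ?_)
  rw [sub_eq_add_neg]
  refine (IsUltrametricDist.norm_add_le_max _ _).trans_lt (max_lt ?_ ((norm_neg _).trans_lt hy'))
  rwa [w.norm_algebraMap_local]

namespace Datum

variable {Fq k : Type*} [Field Fq] [Finite Fq] [Field k] [Algebra Fq k] {D : Datum Fq k}

theorem PositiveWith.mul {α β u v : D.inf.Local} (h : D.PositiveWith α u)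
    (h' : D.PositiveWith β v) : D.PositiveWith (α * β) (u * v) := by
  obtain ⟨hu, n, hn⟩ := h
  obtain ⟨hv, m, hm⟩ := h'
  refine ⟨norm_sub_one_mul_lt hu hv le_rfl, n + m, ?_⟩
  rw [hn, hm, zpow_add₀ D.unif_ne_zero, mul_mul_mul_comm]

variable (D)

/-- If `I (a₀) = I₀ (a)` with `a / a₀` positive, then `I ^ (s₁) = I₀ ^ (s₁) a / a₀`. -/
theorem idealOne_eq_mul (p : ℕ) [Fact p.Prime] [CharP Fq p] (hk : IsGlobalFunctionField Fq k)
    {I I₀ : D.Ideals} {a a₀ : D.A} (ha : a ≠ 0) (ha₀ : a₀ ≠ 0)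
    (h : I.1 * Ideal.span {a₀} = I₀.1 * Ideal.span {a}) {u : D.inf.Local}
    (hu : D.PositiveWith (algebraMap k D.inf.Local (a / a₀ : k)) u) :
    D.idealOne I = D.idealOne I₀ * algebraMap k D.inf.Cp (a / a₀ : k) := by
  have := D.inf.charP_cp (Fq := Fq) p
  have ha' : (a : k) ≠ 0 := fun h => ha (Subtype.ext h)
  have ha₀' : (a₀ : k) ≠ 0 := fun h => ha₀ (Subtype.ext h)
  have hc0 : (a / a₀ : k) ≠ 0 := div_ne_zero ha' ha₀'
  obtain ⟨N, hN, hgen⟩ := D.exists_positive_generator hk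
  have hQ := D.inf.one_lt_card
  obtain ⟨b, x, hb, hx⟩ := hgen I
  obtain ⟨b₀, x₀, hb₀, hx₀⟩ := hgen I₀
  obtain ⟨y, hy⟩ := D.exists_positiveWith_pow ha
  obtain ⟨y₀, hy₀⟩ := D.exists_positiveWith_pow ha₀
  set M := D.inf.card - 1 with hM
  have hMpos : 0 < M := by omega
  -- Both sides are positive generators of one ideal. The exponent `M` is there because `a` and `a₀`
  -- need not be positive individually.
  have h1 : b ^ M * (a₀ ^ M) ^ N = b₀ ^ M * (a ^ M) ^ N := by
    refine eq_of_span_eq hk (u := x ^ M * y₀ ^ N) (v := x₀ ^ M * y ^ N) ?_ ?_ ?_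
    · simp only [← Ideal.span_singleton_mul_span_singleton, ← Ideal.span_singleton_pow]
      rw [← hb, ← hb₀, ← pow_mul, ← pow_mul, ← pow_mul, ← pow_mul, mul_comm M N, ← mul_pow, h,
        mul_pow]
    · simpa using (hx.pow M).mul (hy₀.pow N)
    · simpa using (hx₀.pow M).mul (hy.pow N)
  have hI := D.idealOne_pow p hk hb hx
  have hI₀ := D.idealOne_pow p hk hb₀ hx₀
  have h2 : D.idealOne I ^ (N * M) = (D.idealOne I₀ * algebraMap k D.inf.Cp (a / a₀ : k)) ^ (N * M) := by
    rw [mul_pow, pow_mul, pow_mul (D.idealOne I₀), hI, hI₀, ← map_pow, ← map_pow, ← map_pow,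
      ← map_mul]
    congr 1
    rw [div_pow, ← mul_div_assoc, eq_div_iff (pow_ne_zero _ ha₀')]
    have h3 := congrArg Subtype.val h1
    simp only [MulMemClass.coe_mul, SubmonoidClass.coe_pow, ← pow_mul, mul_comm M N] at h3
    exact h3
  -- the degrees match
  have hq : 1 < Nat.card Fq := Finite.one_lt_card
  have hq' : (1 : ℝ) < Nat.card Fq := by exact_mod_cast hq
  obtain ⟨n, hn, hn'⟩ := hu.norm_eq
  have hdeg : (D.degI I : ℤ) - D.degI I₀ = -(D.inf.deg Fq * n) := by
    have h3 := congrArg (fun J : Ideal D.A => (Nat.card (D.A ⧸ J) : ℝ)) h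
    simp only [D.card_quotient_mul hk, Nat.cast_mul, D.card_quotient_span_singleton hk ha,
      D.card_quotient_span_singleton hk ha₀, D.card_quotient_ideal hk] at h3
    rw [D.inf.norm_algebraMap_local, map_div₀, div_eq_iff (D.inf.abs.ne_zero ha₀')] at hn'
    rw [hn', D.inf.card_eq (Fq := Fq), Nat.cast_pow, Nat.cast_pow, Nat.cast_pow, ← zpow_natCast,
      ← zpow_natCast, ← zpow_natCast, ← zpow_mul, ← mul_assoc, ← zpow_add₀ (by positivity)] at h3
    have h4 := mul_right_cancel₀ (D.inf.abs.ne_zero ha₀') h3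
    have h5 := zpow_right_injective₀ (zero_lt_one.trans hq') hq'.ne' h4
    rw [h5]
    ring
  have hroot : D.root⁻¹ ^ D.degI I = D.root⁻¹ ^ D.degI I₀ * algebraMap D.inf.Local D.inf.Cp D.unif ^ n := by
    rw [← D.root_pow, ← zpow_natCast, ← zpow_natCast, ← zpow_natCast, ← zpow_mul, inv_zpow',
      inv_zpow', ← zpow_add₀ D.root_ne_zero]
    congr 1
    linarith
  have hbI := (D.bracket_spec hk I).1
  have hbI₀ := (D.bracket_spec hk I₀).1
  have hu1 : ‖algebraMap D.inf.Local D.inf.Cp u - 1‖ < 1 := by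
    rw [← map_one (algebraMap D.inf.Local D.inf.Cp), ← map_sub, D.inf.norm_algebraMap_local_cp]
    exact hu.1
  have hc : algebraMap k D.inf.Cp (a / a₀ : k) =
      algebraMap D.inf.Local D.inf.Cp D.unif ^ n * algebraMap D.inf.Local D.inf.Cp u := by
    rw [IsScalarTower.algebraMap_apply k D.inf.Local D.inf.Cp, hn, map_mul, map_zpow₀]
  have h6 : D.idealOne I₀ * algebraMap k D.inf.Cp (a / a₀ : k) =
      D.root⁻¹ ^ D.degI I * (D.bracket I₀ * algebraMap D.inf.Local D.inf.Cp u) := by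
    rw [hc, hroot]
    unfold idealOne
    ring
  -- With equal degrees the powers of `π_*` cancel, and an equality of powers of `1`-units remains.
  rw [h6] at h2 ⊢
  unfold idealOne at h2 ⊢
  congr 1
  rw [mul_pow, mul_pow _ (_ * _)] at h2
  exact eq_of_pow_eq_of_norm_sub_one_lt p hbI (norm_sub_one_mul_lt hbI₀ hu1 le_rfl)
    (Nat.mul_pos hN hMpos) (mul_left_cancel₀
      (pow_ne_zero _ (pow_ne_zero _ (inv_ne_zero D.root_ne_zero))) h2)

/-- Attach to `I` its bounded cofactor `J`, with `I J = (a)`, and the leading coefficient of `a`.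
There are finitely many such data, and ideals sharing them differ by a positive element of `k`. -/
theorem exists_finite_idealOne (p : ℕ) [Fact p.Prime] [CharP Fq p]
    (hk : IsGlobalFunctionField Fq k) : ∃ S : Set D.Ideals, S.Finite ∧
      ∀ I, ∃ I₀ ∈ S, ∃ c : k, D.idealOne I = D.idealOne I₀ * algebraMap k D.inf.Cp c := by
  obtain ⟨B, hB⟩ := D.exists_mul_eq_span hk
  have hB' (I : D.Ideals) := hB I.1 I.2
  choose J a hJ ha hJB hJa using hB'
  obtain ⟨f, hf⟩ := D.inf.exists_residue_map
  have ha' (I : D.Ideals) : (a I : k) ≠ 0 := fun h => ha I (Subtype.ext h)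
  choose n hn using fun I => D.inf.exists_abs_eq_zpow (ha' I)
  have := (D.finite_ideals_card_le hk B).to_subtype
  let w (I : D.Ideals) : D.inf.Local := D.unif ^ n I * algebraMap k D.inf.Local (a I : k)
  have hw (I) : ‖w I‖ = 1 := by
    rw [norm_mul, norm_unif_zpow, D.inf.norm_algebraMap_local, hn, zpow_neg, inv_mul_cancel₀]
    exact (zpow_pos D.inf.card_pos _).ne'
  let Φ (I : D.Ideals) : {I : Ideal D.A | I ≠ ⊥ ∧ Nat.card (D.A ⧸ I) ≤ B} × D.inf.Residue :=
    (⟨J I, hJ I, hJB I⟩, f (w I))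
  choose g hg using fun x : Set.range Φ => x.2
  refine ⟨Set.range g, Set.finite_range g, fun I => ⟨g ⟨Φ I, I, rfl⟩, ⟨_, rfl⟩, ?_⟩⟩
  set I₀ := g ⟨Φ I, I, rfl⟩
  have hΦ : Φ I₀ = Φ I := hg ⟨Φ I, I, rfl⟩
  have hJJ : J I₀ = J I := congrArg (fun x => x.1.1) hΦ
  have hff : f (w I) = f (w I₀) := (congrArg Prod.snd hΦ).symm
  have h1 := hf _ _ (hw I).le (hw I₀).le hff
  have hw0 : w I₀ ≠ 0 := by
    rw [← norm_pos_iff, hw]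
    exact one_pos
  refine ⟨(a I : k) / a I₀, D.idealOne_eq_mul p hk (ha I) (ha I₀) ?_ (u := w I / w I₀) ⟨?_, ?_⟩⟩
  · rw [← hJa, ← hJa, hJJ]
    ring
  · rw [div_sub_one hw0, norm_div, hw, div_one]
    exact h1
  · refine ⟨n I₀ - n I, ?_⟩
    have h2 := D.unif_ne_zero
    have h3 : algebraMap k D.inf.Local (a I₀ : k) ≠ 0 := by
      simpa using ha' I₀
    simp only [w]
    rw [zpow_sub₀ h2, map_div₀]
    field_simp

theorem isIntegral_idealOne (p : ℕ) [Fact p.Prime] [CharP Fq p]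
    (hk : IsGlobalFunctionField Fq k) (I : D.Ideals) : IsIntegral D.A (D.idealOne I) := by
  obtain ⟨N, hN, hgen⟩ := D.exists_positive_generator hk
  obtain ⟨a, u, ha, hu⟩ := hgen I
  refine IsIntegral.of_pow hN ?_
  rw [D.idealOne_pow p hk ha hu]
  exact isIntegral_algebraMap (R := D.A) (x := a)

theorem finiteDimensional_valueField (p : ℕ) [Fact p.Prime] [CharP Fq p]
    (hk : IsGlobalFunctionField Fq k) : FiniteDimensional k D.valueField := by
  obtain ⟨S, hS, h⟩ := D.exists_finite_idealOne p hk
  have hle : D.valueField ≤ IntermediateField.adjoin k (D.idealOne '' S) := by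
    refine IntermediateField.adjoin_le_iff.2 ?_
    rintro _ ⟨I, rfl⟩
    obtain ⟨I₀, hI₀, c, hc⟩ := h I
    rw [hc]
    exact mul_mem (IntermediateField.subset_adjoin k _ ⟨I₀, hI₀, rfl⟩)
      (IntermediateField.algebraMap_mem _ c)
  have := (hS.image D.idealOne).to_subtype
  have hfd : FiniteDimensional k (IntermediateField.adjoin k (D.idealOne '' S)) := by
    refine IntermediateField.finiteDimensional_adjoin ?_
    rintro _ ⟨I, -, rfl⟩
    exact (D.isIntegral_idealOne p hk I).tower_top
  exact Module.Finite.of_injective (IntermediateField.inclusion hle).toLinearMap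
    (IntermediateField.inclusion hle).injective

end Datum

end

noncomputable section

/-! ### A weak form of the product formula -/

theorem Multiset.prod_nonneg_and_le_pow_card {s : Multiset ℝ} {B : ℝ} (hB : 0 ≤ B)
    (h : ∀ x ∈ s, 0 ≤ x ∧ x ≤ B) : 0 ≤ s.prod ∧ s.prod ≤ B ^ Multiset.card s := by
  induction s using Multiset.induction_on with
  | empty => simp
  | cons a s ih =>
    obtain ⟨h1, h2⟩ := ih fun x hx => h x (Multiset.mem_cons_of_mem hx)
    obtain ⟨h3, h4⟩ := h a (Multiset.mem_cons_self a s)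
    rw [Multiset.prod_cons, Multiset.card_cons, pow_succ']
    exact ⟨mul_nonneg h3 h1, mul_le_mul h4 h2 h1 hB⟩

theorem Place.abs_algebraMap_of_ne_zero {Fq k : Type*} [Field Fq] [Finite Fq] [Field k]
    [Algebra Fq k] (w : Place k) {c : Fq} (hc : c ≠ 0) : w.abs (algebraMap Fq k c) = 1 := by
  refine le_antisymm (w.abs_algebraMap_le Fq c) ?_
  have h1 := w.abs_algebraMap_le Fq c⁻¹
  rw [map_inv₀, map_inv₀] at h1
  exact (inv_le_one₀ (w.abs.pos (by simpa using hc))).1 h1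

namespace Place

variable {Fq k : Type*} [Field Fq] [Finite Fq] [Field k] [Algebra Fq k] (w : Place k)

/-- The lowest nonzero term of `P` at `x` dominates, its coefficient has absolute value `1`, and its
exponent is at most `h`. -/
theorem pow_le_abs_aeval {x : k} (hx : w.abs x < 1) (h : ℕ) :
    ∀ P : Fq[X], P ≠ 0 → P.natDegree ≤ h → w.abs x ^ h ≤ w.abs (Polynomial.aeval x P) := by
  have hint (P : Fq[X]) : w.abs (Polynomial.aeval x P) ≤ 1 := by
    have : Polynomial.aeval x P ∈ absRing w.abs w.nonarch := by
      rw [Polynomial.aeval_eq_sum_range]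
      refine sum_mem fun i _ => ?_
      rw [Algebra.smul_def]
      exact mul_mem (w.abs_algebraMap_le Fq _) (pow_mem (show x ∈ absRing w.abs w.nonarch from hx.le) i)
    exact this
  induction h with
  | zero =>
    intro P hP hd
    rw [Polynomial.eq_C_of_natDegree_le_zero hd, Polynomial.aeval_C, pow_zero,
      w.abs_algebraMap_of_ne_zero]
    intro h
    exact hP (by rw [Polynomial.eq_C_of_natDegree_le_zero hd, h, map_zero])
  | succ h ih =>
    intro P hP hd
    have h1 : Polynomial.aeval x P = Polynomial.aeval x P.divX * x +
        algebraMap Fq k (P.coeff 0) := by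
      conv_lhs => rw [← P.divX_mul_X_add]
      simp
    by_cases h0 : P.coeff 0 = 0
    · rw [h1, h0, map_zero, add_zero, map_mul, pow_succ]
      refine mul_le_mul_of_nonneg_right (ih _ ?_ ?_) (w.abs.nonneg _)
      · intro h2
        apply hP
        rw [← P.divX_mul_X_add, h2, h0]
        simp
      · rw [Polynomial.natDegree_divX_eq_natDegree_tsub_one]
        omega
    · have h2 : w.abs (Polynomial.aeval x P) = 1 := by
        refine le_antisymm (hint P) ?_
        by_contra! hlt
        have h3 : algebraMap Fq k (P.coeff 0) = Polynomial.aeval x P +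
            -(Polynomial.aeval x P.divX * x) := by
          rw [h1]
          ring
        have h4 := w.nonarch (Polynomial.aeval x P) (-(Polynomial.aeval x P.divX * x))
        rw [← h3, w.abs_algebraMap_of_ne_zero h0, map_neg_eq_map, map_mul] at h4
        refine absurd h4 (not_le.2 (max_lt hlt ?_))
        exact (mul_le_of_le_one_left (w.abs.nonneg _) (hint _)).trans_lt hx
      rw [h2]
      exact pow_le_one₀ (w.abs.nonneg _) hx.le

end Place

namespace Datum

variable {Fq k : Type*} [Field Fq] [Finite Fq] [Field k] [Algebra Fq k] (D : Datum Fq k)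

/-- Two elements of the infinite ring `A` coincide in the finite residue field. -/
theorem exists_mem_A_abs_lt_one (hk : IsGlobalFunctionField Fq k) {v : Place k} (hv : v ≠ D.inf) :
    ∃ a : D.A, a ≠ 0 ∧ v.abs a < 1 := by
  have := D.infinite_A hk
  let f : D.A → v.Residue := fun a => IsLocalRing.residue _ ⟨a, a.2 v hv⟩
  obtain ⟨a, b, hab, h⟩ := Finite.exists_ne_map_eq_of_infinite f
  refine ⟨a - b, sub_ne_zero.2 hab, ?_⟩
  refine (AbsoluteValue.mem_maximalIdeal_absRing v.nonarch
    ((⟨a, a.2 v hv⟩ : absRing v.abs v.nonarch) - ⟨b, b.2 v hv⟩)).1 ?_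
  rw [← IsLocalRing.residue_eq_zero_iff, map_sub, sub_eq_zero]
  exact h

/-- A nonzero element of `A` which is small at `v ≠ ∞` is large at `∞`. -/
theorem exists_pow_le_abs (hk : IsGlobalFunctionField Fq k) {v : Place k} (hv : v ≠ D.inf) :
    ∃ θ : ℝ, 0 < θ ∧ θ < 1 ∧ ∀ (a : D.A) (h : ℕ), a ≠ 0 →
      D.inf.abs a ≤ (Nat.card Fq : ℝ) ^ h → θ ^ h ≤ v.abs a := by
  obtain ⟨x, hx0, hx⟩ := D.exists_mem_A_abs_lt_one hk hv
  have hx0' : (x : k) ≠ 0 := fun h => hx0 (Subtype.ext h)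
  refine ⟨v.abs x, v.abs.pos hx0', hx, fun a h ha hah => ?_⟩
  by_contra! hlt
  have := D.finite_quotient_span_singleton hk ha
  -- If `|a|_v < θ ^ h` with `θ = |x|_v`, every nonzero multiple of `a` is smaller at `v` than every
  -- nonzero polynomial value in `x` of degree at most `h`, so `f` is injective. But there are `q ^
  -- (h + 1)` such polynomials and only `|a| ≤ q ^ h` residues.
  let f : Polynomial.degreeLT Fq (h + 1) → D.A ⧸ Ideal.span {a} := fun P =>
    Ideal.Quotient.mk _ (Polynomial.aeval x P.1)
  have hf : Function.Injective f := by
    intro P P' hPP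
    by_contra hne
    have hne' : P.1 - P'.1 ≠ 0 := sub_ne_zero.2 fun h => hne (Subtype.ext h)
    have h1 : Polynomial.aeval x (P.1 - P'.1) ∈ Ideal.span {a} := by
      rw [map_sub]
      exact Ideal.Quotient.eq.1 hPP
    obtain ⟨c, hc⟩ := Ideal.mem_span_singleton'.1 h1
    have hd : (P.1 - P'.1).natDegree ≤ h := by
      have h2 := Polynomial.mem_degreeLT.1 (sub_mem P.2 P'.2)
      exact Nat.lt_succ_iff.1 ((Polynomial.natDegree_lt_iff_degree_lt hne').2 h2)
    have h2 := v.pow_le_abs_aeval hx h (P.1 - P'.1) hne' hd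
    have h3 : Polynomial.aeval (x : k) (P.1 - P'.1) = c * a := by
      rw [← Subalgebra.coe_mul, hc]
      exact Polynomial.aeval_algHom_apply D.A.val x _
    rw [h3, map_mul] at h2
    exact absurd (h2.trans (mul_le_of_le_one_left (v.abs.nonneg _) (c.2 v hv))) (not_le.2 hlt)
  have h1 := Nat.card_le_card_of_injective f hf
  rw [Nat.card_congr (Polynomial.degreeLTEquiv Fq (h + 1)).toEquiv, Nat.card_fun,
    Nat.card_fin] at h1
  have h2 : ((Nat.card Fq ^ (h + 1) : ℕ) : ℝ) ≤ (Nat.card Fq : ℝ) ^ h := by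
    rw [← D.card_quotient_span_singleton hk ha] at hah
    exact (Nat.cast_le.2 h1).trans hah
  rw [Nat.cast_pow] at h2
  exact absurd ((pow_le_pow_iff_right₀ (Nat.one_lt_cast.2 Finite.one_lt_card)).1 h2) (by omega)

theorem abs_coeff_zero_minpoly (w : Place k) {x : D.valueField} (hx : IsIntegral k x) :
    w.abs ((minpoly k x).coeff 0) =
      ((((minpoly k x).map (algebraMap k w.AlgCl)).roots.map norm).prod) := by
  have h1 : Polynomial.eval 0 ((minpoly k x).map (algebraMap k w.AlgCl)) =
      algebraMap k w.AlgCl ((minpoly k x).coeff 0) := by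
    rw [← Polynomial.coeff_zero_eq_eval_zero, Polynomial.coeff_map]
  have h2 := congrArg norm h1
  rw [w.norm_algebraMap_k_algCl] at h2
  have h3 (s : Multiset w.AlgCl) :
      ‖Polynomial.eval 0 (s.map (fun y => Polynomial.X - Polynomial.C y)).prod‖ =
        (s.map norm).prod := by
    induction s using Multiset.induction_on with
    | empty => simp
    | cons y s ih =>
      rw [Multiset.map_cons, Multiset.map_cons, Multiset.prod_cons, Multiset.prod_cons,
        Polynomial.eval_mul, norm_mul, ih]
      simp
  rw [← h2, ← h3, ← (IsAlgClosed.splits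
    ((minpoly k x).map (algebraMap k w.AlgCl))).eq_prod_roots_of_monic ((minpoly.monic hx).map _)]

theorem exists_algHom_of_mem_roots [FiniteDimensional k D.valueField] (w : Place k)
    {x : D.valueField} {y : w.AlgCl}
    (hy : y ∈ ((minpoly k x).map (algebraMap k w.AlgCl)).roots) :
    ∃ τ : D.valueField →ₐ[k] w.AlgCl, τ x = y := by
  have h := Algebra.IsAlgebraic.range_eval_eq_rootSet_minpoly (F := k) (K := D.valueField) w.AlgCl x
  have h2 : y ∈ (minpoly k x).rootSet w.AlgCl := by
    rw [Polynomial.mem_rootSet']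
    have := Polynomial.mem_roots'.1 hy
    refine ⟨this.1, ?_⟩
    rw [Polynomial.aeval_def, ← Polynomial.eval_map]
    exact this.2
  rw [← h] at h2
  exact h2

theorem norm_algHom_le_one {w : Place k} (hw : w ≠ D.inf) {x : D.valueField}
    (hx : IsIntegral D.A (x : D.inf.Cp)) (τ : D.valueField →ₐ[k] w.AlgCl) : ‖τ x‖ ≤ 1 := by
  have h1 : IsIntegral D.A x := (isIntegral_algebraMap_iff
    (algebraMap D.valueField D.inf.Cp).injective).1 hx
  have h2 : IsIntegral D.A (τ x) := h1.map (τ.restrictScalars D.A)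
  refine AbsoluteValue.le_one_of_isIntegral
    (v := NormedField.toAbsoluteValue w.AlgCl)
    (fun a b => IsUltrametricDist.norm_add_le_max (a : w.AlgCl) (b : w.AlgCl)) (S := D.A) (fun a => ?_) h2
  change ‖algebraMap k w.AlgCl a‖ ≤ 1
  rw [w.norm_algebraMap_k_algCl]
  exact a.2 w hw

/-- An integral element of `𝕍` that is very small at `v` vanishes. -/
theorem pow_le_norm_algHom [FiniteDimensional k D.valueField] {v : Place k} (hv : v ≠ D.inf) {θ : ℝ}
    (hθ : ∀ (a : D.A) (h : ℕ), a ≠ 0 → D.inf.abs a ≤ (Nat.card Fq : ℝ) ^ h → θ ^ h ≤ v.abs a)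
    (σ : D.valueField →ₐ[k] v.AlgCl) {x : D.valueField} (hx : IsIntegral D.A (x : D.inf.Cp))
    (hx0 : x ≠ 0) {H : ℕ}
    (hH : ∀ τ : D.valueField →ₐ[k] D.inf.AlgCl, ‖τ x‖ ≤ (Nat.card Fq : ℝ) ^ H) :
    θ ^ (H * Module.finrank k D.valueField) ≤ ‖σ x‖ := by
  have hxk : IsIntegral k x := Algebra.IsIntegral.isIntegral x
  -- Up to sign `c` is the product of the conjugates of `x`. It lies in `A`; at `∞` it is bounded
  -- through `hH`, with at most `[𝕍 : k]` factors; at `v` all factors other than `σ x` have norm at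
  -- most `1`.
  set c := (minpoly k x).coeff 0 with hc
  have hc0 : c ≠ 0 := minpoly.coeff_zero_ne_zero hxk hx0
  have hr : (1 : ℝ) ≤ Nat.card Fq := Nat.one_le_cast.2 Nat.card_pos
  have hle (w : Place k) (hw : w ≠ D.inf) : ∀ t ∈ (((minpoly k x).map (algebraMap k w.AlgCl)).roots.map norm),
      0 ≤ t ∧ t ≤ 1 := by
    intro t ht
    obtain ⟨y, hy, rfl⟩ := Multiset.mem_map.1 ht
    obtain ⟨τ, rfl⟩ := D.exists_algHom_of_mem_roots w hy
    exact ⟨norm_nonneg _, D.norm_algHom_le_one hw hx τ⟩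
  have hcA : c ∈ D.A := fun w hw => by
    rw [hc, D.abs_coeff_zero_minpoly w hxk]
    refine (Multiset.prod_nonneg_and_le_pow_card zero_le_one (hle w hw)).2.trans (by simp)
  have h1 : D.inf.abs c ≤ (Nat.card Fq : ℝ) ^ (H * Module.finrank k D.valueField) := by
    rw [hc, D.abs_coeff_zero_minpoly D.inf hxk]
    refine (Multiset.prod_nonneg_and_le_pow_card (B := (Nat.card Fq : ℝ) ^ H) (by positivity) ?_).2.trans ?_
    · intro t ht
      obtain ⟨y, hy, rfl⟩ := Multiset.mem_map.1 ht
      obtain ⟨τ, rfl⟩ := D.exists_algHom_of_mem_roots D.inf hy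
      exact ⟨norm_nonneg _, hH τ⟩
    · rw [← pow_mul]
      refine pow_le_pow_right₀ hr (Nat.mul_le_mul_left _ ?_)
      rw [Multiset.card_map]
      refine (Polynomial.card_roots' _).trans ?_
      rw [Polynomial.natDegree_map]
      exact minpoly.natDegree_le x
  refine (hθ ⟨c, hcA⟩ _ (fun h => hc0 (congrArg Subtype.val h)) h1).trans ?_
  change v.abs c ≤ _
  have hmem : σ x ∈ ((minpoly k x).map (algebraMap k v.AlgCl)).roots := by
    rw [Polynomial.mem_roots ((minpoly.monic hxk).map _).ne_zero, Polynomial.IsRoot,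
      Polynomial.eval_map, ← Polynomial.aeval_def, Polynomial.aeval_algHom_apply, minpoly.aeval, map_zero]
  rw [hc, D.abs_coeff_zero_minpoly v hxk]
  have hl := hle v hv
  obtain ⟨s, hs⟩ := Multiset.exists_cons_of_mem hmem
  rw [hs, Multiset.map_cons] at hl ⊢
  rw [Multiset.prod_cons]
  refine mul_le_of_le_one_right (norm_nonneg _) ?_
  refine (Multiset.prod_nonneg_and_le_pow_card zero_le_one
    fun t ht => hl t (Multiset.mem_cons_of_mem ht)).2.trans (by simp)

theorem idealOneV_pow (p : ℕ) [Fact p.Prime] [CharP Fq p] (hk : IsGlobalFunctionField Fq k)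
    {I : D.Ideals} {N : ℕ} {a : D.A} {u : D.inf.Local} (h : I.1 ^ N = Ideal.span {a})
    (ha : D.PositiveWith (algebraMap k D.inf.Local (a : k)) u) :
    D.idealOneV I ^ N = algebraMap k D.valueField a :=
  Subtype.ext (D.idealOne_pow p hk h ha)

theorem norm_algHom_idealOneV_pow (p : ℕ) [Fact p.Prime] [CharP Fq p]
    (hk : IsGlobalFunctionField Fq k) {I : D.Ideals} {N : ℕ} {a : D.A} {u : D.inf.Local}
    (h : I.1 ^ N = Ideal.span {a})
    (ha : D.PositiveWith (algebraMap k D.inf.Local (a : k)) u) {w : Place k}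
    (τ : D.valueField →ₐ[k] w.AlgCl) : ‖τ (D.idealOneV I)‖ ^ N = w.abs a := by
  rw [← norm_pow, ← map_pow, D.idealOneV_pow p hk h ha, AlgHom.commutes, w.norm_algebraMap_k_algCl]

theorem norm_algHom_inf_idealOneV (p : ℕ) [Fact p.Prime] [CharP Fq p]
    (hk : IsGlobalFunctionField Fq k) (I : D.Ideals) (τ : D.valueField →ₐ[k] D.inf.AlgCl) :
    ‖τ (D.idealOneV I)‖ = (Nat.card Fq : ℝ) ^ D.degI I := by
  obtain ⟨N, hN, h⟩ := D.exists_positive_generator hk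
  obtain ⟨a, u, hI, ha⟩ := h I
  have ha0 : a ≠ 0 := by
    rintro rfl
    exact ha.ne_zero (by simp)
  refine (pow_left_inj₀ (norm_nonneg _) (by positivity) hN.ne').1 ?_
  rw [D.norm_algHom_idealOneV_pow p hk hI ha, D.abs_generator hk hI ha0, pow_mul]

theorem abs_eq_one_of_prime_to {v : Place k} (hv : v ≠ D.inf) {I : Ideal D.A} {N : ℕ} {a : D.A}
    (hI : I ^ N = Ideal.span {a}) (h : ∃ c ∈ I, v.abs (c : k) = 1) : v.abs a = 1 := by
  refine le_antisymm (a.2 v hv) ?_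
  obtain ⟨c, hc, hc1⟩ := h
  have h1 := Ideal.pow_mem_pow hc N
  rw [hI] at h1
  obtain ⟨d, hd⟩ := Ideal.mem_span_singleton'.1 h1
  have h2 : v.abs ((d : k) * a) = 1 := by
    rw [← Subalgebra.coe_mul, hd, Subalgebra.coe_pow, map_pow, hc1, one_pow]
  rw [← h2, map_mul]
  exact mul_le_of_le_one_left (v.abs.nonneg _) (d.2 v hv)

theorem abs_lt_one_of_not_prime_to {v : Place k} (hv : v ≠ D.inf) {I : Ideal D.A} {N : ℕ} (hN : 0 < N)
    {a : D.A} (hI : I ^ N = Ideal.span {a}) (h : ¬ ∃ c ∈ I, v.abs (c : k) = 1) : v.abs a < 1 := by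
  push Not at h
  have h1 : a ∈ I := Ideal.pow_le_self hN.ne' (hI ▸ Ideal.mem_span_singleton_self a)
  exact lt_of_le_of_ne (a.2 v hv) (h a h1)

theorem norm_algHom_idealOneV_eq_one (p : ℕ) [Fact p.Prime] [CharP Fq p]
    (hk : IsGlobalFunctionField Fq k) {v : Place k} (hv : v ≠ D.inf)
    (σ : D.valueField →ₐ[k] v.AlgCl) {I : D.Ideals} (hI : ∃ c ∈ I.1, v.abs (c : k) = 1) :
    ‖σ (D.idealOneV I)‖ = 1 := by
  obtain ⟨N, hN, h⟩ := D.exists_positive_generator hk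
  obtain ⟨a, u, hIa, ha⟩ := h I
  have h1 := D.norm_algHom_idealOneV_pow p hk hIa ha σ
  rw [D.abs_eq_one_of_prime_to hv hIa hI] at h1
  exact (pow_eq_one_iff_of_nonneg (norm_nonneg _) hN.ne').1 h1

/-- One exponent `N` serves all ideals, so the gap below `1` in the values of `v` on `k` gives a
uniform gap for the `N`-th roots. -/
theorem exists_norm_algHom_idealOneV_le (p : ℕ) [Fact p.Prime] [CharP Fq p]
    (hk : IsGlobalFunctionField Fq k) {v : Place k} (hv : v ≠ D.inf)
    (σ : D.valueField →ₐ[k] v.AlgCl) :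
    ∃ ρ : ℝ, 0 < ρ ∧ ρ < 1 ∧ ∀ I : D.Ideals, (¬ ∃ c ∈ I.1, v.abs (c : k) = 1) →
      ‖σ (D.idealOneV I)‖ ≤ ρ := by
  obtain ⟨N, hN, h⟩ := D.exists_positive_generator hk
  have hc : (0 : ℝ) ≤ (v.card : ℝ)⁻¹ := (inv_pos.2 v.card_pos).le
  refine ⟨((v.card : ℝ)⁻¹) ^ ((N : ℝ)⁻¹), Real.rpow_pos_of_pos (inv_pos.2 v.card_pos) _,
    Real.rpow_lt_one hc (inv_lt_one_of_one_lt₀ v.one_lt_card') (by positivity), fun I hI => ?_⟩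
  obtain ⟨a, u, hIa, ha⟩ := h I
  have h1 := D.norm_algHom_idealOneV_pow p hk hIa ha σ
  have h2 := v.abs_le_inv_card (D.abs_lt_one_of_not_prime_to hv hN hIa hI)
  rw [← h1] at h2
  rw [← Real.pow_rpow_inv_natCast (norm_nonneg (σ (D.idealOneV I))) hN.ne']
  exact Real.rpow_le_rpow (by positivity) h2 (by positivity)

end Datum
end

noncomputable section

/-! ### The local fields at a finite prime -/

theorem dvd_natCard_of_natCast_eq_zero {R : Type*} [Field R] [Finite R] {p : ℕ} [Fact p.Prime]
    (h : (p : R) = 0) : p ∣ Nat.card R := by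
  have := Fintype.ofFinite R
  have h1 := Nat.cast_card_eq_zero R
  rw [← Nat.card_eq_fintype_card] at h1
  by_contra hd
  obtain ⟨a, b, hab⟩ := ((Fact.out : p.Prime).coprime_iff_not_dvd.2 hd).isCoprime
  have h2 := congrArg (Int.cast : ℤ → R) hab
  push_cast at h2
  rw [h1, h] at h2
  simp at h2

theorem finite_of_card_le_of_linearIndependent {F R : Type*} [Field F] [Finite F] [Field R]
    (φ : F →+* R) (n : ℕ) (h : ∀ s : Finset R, (∀ (t : Finset s) (c : s → F),
      ∑ i ∈ t, φ (c i) * (i : R) = 0 → ∀ i ∈ t, c i = 0) → s.card ≤ n) : Finite R := by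
  let := φ.toAlgebra
  have h1 : Module.rank F R ≤ n := by
    refine rank_le fun s hs => h s fun t c hc => ?_
    refine linearIndependent_iff'.1 hs t c ?_
    rw [← hc]
    exact Finset.sum_congr rfl fun i _ => Algebra.smul_def _ _
  have : Module.Finite F R := Module.rank_lt_aleph0_iff.1 (h1.trans_lt (Cardinal.natCast_lt_aleph0))
  exact Module.finite_of_finite F

namespace Place

variable {k : Type*} [Field k] (w : Place k)

theorem norm_le_inv_card {x : w.Local} (hx : ‖x‖ < 1) : ‖x‖ ≤ (w.card : ℝ)⁻¹ := by
  obtain ⟨y, hy⟩ := w.exists_approx_local x (inv_pos.2 w.card_pos)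
  have h1 : ‖algebraMap k w.Local y‖ < 1 := by
    have h2 : algebraMap k w.Local y = x + -(x - algebraMap k w.Local y) := by ring
    rw [h2]
    refine (IsUltrametricDist.norm_add_le_max _ _).trans_lt (max_lt hx ?_)
    rw [norm_neg]
    exact hy.trans (inv_lt_one_of_one_lt₀ w.one_lt_card')
  rw [w.norm_algebraMap_local] at h1
  have h2 : x = (x - algebraMap k w.Local y) + algebraMap k w.Local y := by ring
  rw [h2]
  refine (IsUltrametricDist.norm_add_le_max _ _).trans (max_le hy.le ?_)
  rw [w.norm_algebraMap_local]
  exact w.abs_le_inv_card h1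

theorem isNonarchimedean_norm (E : IntermediateField w.Local w.AlgCl) :
    IsNonarchimedean (NormedField.toAbsoluteValue E) :=
  fun a b => IsUltrametricDist.norm_add_le_max (a : w.AlgCl) (b : w.AlgCl)

/-- The valuation ring of a subfield of the algebraic closure of the completion. -/
abbrev integers (E : IntermediateField w.Local w.AlgCl) : ValuationSubring E :=
  absRing (NormedField.toAbsoluteValue E) (w.isNonarchimedean_norm E)

theorem norm_coe_intermediateField (E : IntermediateField w.Local w.AlgCl) (x : k) :
    ‖(algebraMap k E x)‖ = w.abs x := by
  rw [← w.norm_algebraMap_k_algCl]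
  rfl

/-- Reduction of the inclusion of `k` into `E`. -/
def toIntegers (E : IntermediateField w.Local w.AlgCl) :
    absRing w.abs w.nonarch →+* w.integers E :=
  ((algebraMap k E).comp (absRing w.abs w.nonarch).subtype).codRestrict (w.integers E).toSubring
    fun x => (w.norm_coe_intermediateField E x).le.trans x.2

instance (E : IntermediateField w.Local w.AlgCl) : IsLocalHom (w.toIntegers E) := ⟨fun x hx => by
  by_contra h
  have h1 := (IsLocalRing.mem_maximalIdeal x).2 h
  rw [AbsoluteValue.mem_maximalIdeal_absRing] at h1
  have h2 : w.toIntegers E x ∈ IsLocalRing.maximalIdeal (w.integers E) := by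
    rw [AbsoluteValue.mem_maximalIdeal_absRing]
    exact (w.norm_coe_intermediateField E x).trans_lt h1
  exact (IsLocalRing.mem_maximalIdeal _).1 h2 hx⟩

/-- A relation over the completion, divided by its largest coefficient, would reduce to a nontrivial
relation over the residue field. -/
theorem linearIndependent_of_residue (E : IntermediateField w.Local w.AlgCl) {ι : Type*}
    (x : ι → w.integers E)
    (hx : ∀ (s : Finset ι) (c : ι → w.Residue), ∑ i ∈ s,
      IsLocalRing.ResidueField.map (w.toIntegers E) (c i) * IsLocalRing.residue _ (x i) = 0 →
        ∀ i ∈ s, c i = 0) :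
    LinearIndependent w.Local fun i => (x i : E) := by
  rw [linearIndependent_iff']
  intro s c hc
  by_contra! hne
  obtain ⟨i₀, hi₀, hi₀'⟩ := hne
  obtain ⟨m, hm, hmax⟩ := s.exists_max_image (fun i => ‖c i‖) ⟨i₀, hi₀⟩
  have hm0 : c m ≠ 0 := by
    intro h
    have := hmax i₀ hi₀
    rw [h, norm_zero] at this
    exact hi₀' (norm_le_zero_iff.1 this)
  have hd1 (i) (hi : i ∈ s) : ‖c i / c m‖ ≤ 1 := by
    rw [norm_div]
    exact div_le_one_of_le₀ (hmax i hi) (norm_nonneg _)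
  choose y hy using fun i => w.exists_approx_local (c i / c m) one_pos
  have hy1 (i) (hi : i ∈ s) : w.abs (y i) ≤ 1 := by
    rw [← w.norm_algebraMap_local]
    have h2 : algebraMap k w.Local (y i) = c i / c m + -(c i / c m - algebraMap k w.Local (y i)) := by
      ring
    rw [h2]
    refine (IsUltrametricDist.norm_add_le_max _ _).trans (max_le (hd1 i hi) ?_)
    rw [norm_neg]
    exact (hy i).le
  classical
  let z : ι → absRing w.abs w.nonarch := fun i => if hi : i ∈ s then ⟨y i, hy1 i hi⟩ else 0
  have hz (i) (hi : i ∈ s) : (z i : k) = y i := by simp [z, hi]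
  have hsum : ∑ i ∈ s, IsLocalRing.ResidueField.map (w.toIntegers E) (IsLocalRing.residue _ (z i)) *
      IsLocalRing.residue _ (x i) = 0 := by
    have h1 : ∑ i ∈ s, IsLocalRing.ResidueField.map (w.toIntegers E) (IsLocalRing.residue _ (z i)) *
      IsLocalRing.residue _ (x i) =
        IsLocalRing.residue _ (∑ i ∈ s, w.toIntegers E (z i) * x i) := by
      rw [map_sum]
      refine Finset.sum_congr rfl fun i _ => ?_
      rw [map_mul, IsLocalRing.ResidueField.map_residue]
    rw [h1, IsLocalRing.residue_eq_zero_iff, AbsoluteValue.mem_maximalIdeal_absRing]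
    have h2 : ((∑ i ∈ s, w.toIntegers E (z i) * x i : w.integers E) : E) =
        -∑ i ∈ s, algebraMap w.Local E (c i / c m - algebraMap k w.Local (y i)) * x i := by
      have h3 : ∑ i ∈ s, algebraMap w.Local E (c i / c m) * (x i : E) = 0 := by
        have h4 := congrArg (fun t => algebraMap w.Local E (c m)⁻¹ * t) hc
        simp only [mul_zero, Finset.mul_sum] at h4
        rw [← h4]
        refine Finset.sum_congr rfl fun i _ => ?_
        rw [Algebra.smul_def, ← mul_assoc, ← map_mul, div_eq_inv_mul]
      simp only [map_sub, sub_mul, Finset.sum_sub_distrib, h3, zero_sub, neg_neg]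
      rw [AddSubmonoidClass.coe_finsetSum]
      refine Finset.sum_congr rfl fun i hi => ?_
      have h5 : ((w.toIntegers E (z i) : w.integers E) : E) = algebraMap k E (z i : k) := rfl
      rw [MulMemClass.coe_mul, h5, hz i hi, IsScalarTower.algebraMap_apply k w.Local E]
    rw [h2]
    change ‖(-∑ i ∈ s, algebraMap w.Local E (c i / c m - algebraMap k w.Local (y i)) * x i : E)‖ < 1
    rw [norm_neg]
    change ‖((∑ i ∈ s, algebraMap w.Local E (c i / c m - algebraMap k w.Local (y i)) * x i : E) : w.AlgCl)‖ < 1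
    rw [AddSubmonoidClass.coe_finsetSum]
    refine (Finset.Nonempty.norm_sum_le_sup'_norm ⟨m, hm⟩ _).trans_lt
      ((Finset.sup'_lt_iff _).2 fun i _ => ?_)
    rw [MulMemClass.coe_mul, norm_mul]
    refine (mul_le_of_le_one_right (norm_nonneg _) (x i).2).trans_lt ?_
    change ‖algebraMap w.Local w.AlgCl _‖ < 1
    rw [w.norm_algebraMap_algCl]
    exact hy i
  have h1 := hx s (fun i => IsLocalRing.residue _ (z i)) hsum m hm
  rw [IsLocalRing.residue_eq_zero_iff, AbsoluteValue.mem_maximalIdeal_absRing, hz m hm,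
    ← w.norm_algebraMap_local] at h1
  have h2 := hy m
  rw [div_self hm0] at h2
  have h3 : (1 : w.Local) = (1 - algebraMap k w.Local (y m)) + algebraMap k w.Local (y m) := by ring
  have h4 := (IsUltrametricDist.norm_add_le_max (1 - algebraMap k w.Local (y m))
    (algebraMap k w.Local (y m))).trans_lt (max_lt h2 h1)
  rw [← h3, norm_one] at h4
  exact lt_irrefl _ h4

theorem finite_residueField (E : IntermediateField w.Local w.AlgCl)
    [FiniteDimensional w.Local E] : Finite (IsLocalRing.ResidueField (w.integers E)) := by
  refine finite_of_card_le_of_linearIndependent (IsLocalRing.ResidueField.map (w.toIntegers E))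
    (Module.finrank w.Local E) fun s hs => ?_
  choose x hx using fun i : IsLocalRing.ResidueField (w.integers E) =>
    IsLocalRing.residue_surjective i
  have h2 := w.linearIndependent_of_residue E (fun i : s => x i) (by simpa only [hx] using hs)
  simpa using h2.fintype_card_le_finrank

end Place

namespace Datum

variable {Fq k : Type*} [Field Fq] [Finite Fq] [Field k] [Algebra Fq k] (D : Datum Fq k)

theorem finiteDimensional_sigmaField [FiniteDimensional k D.valueField] (v : Place k)
    (σ : D.valueField →ₐ[k] v.AlgCl) : FiniteDimensional v.Local (D.sigmaField v σ) := by
  let B := Module.finBasis k D.valueField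
  have h1 : D.sigmaField v σ = IntermediateField.adjoin v.Local (Set.range fun i => σ (B i)) := by
    refine le_antisymm (IntermediateField.adjoin_le_iff.2 ?_)
      (IntermediateField.adjoin.mono _ _ _ (by rintro _ ⟨i, rfl⟩; exact ⟨_, rfl⟩))
    rintro _ ⟨x, rfl⟩
    rw [← B.sum_repr x, map_sum]
    refine sum_mem fun i _ => ?_
    rw [map_smul, Algebra.smul_def, IsScalarTower.algebraMap_apply k v.Local v.AlgCl]
    exact mul_mem (IntermediateField.algebraMap_mem _ _)
      (IntermediateField.subset_adjoin _ _ ⟨i, rfl⟩)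
  rw [h1]
  exact IntermediateField.finiteDimensional_adjoin fun x _ => Algebra.IsIntegral.isIntegral x

section

variable [FiniteDimensional k D.valueField] {v : Place k} (σ : D.valueField →ₐ[k] v.AlgCl)

theorem one_lt_sigmaCard : 1 < D.sigmaCard v σ := by
  have := D.finiteDimensional_sigmaField v σ
  have := v.finite_residueField (D.sigmaField v σ)
  exact Finite.one_lt_card

/-- The residue field has characteristic `p`, so its order is divisible by `p`. Coprimality allows
integers to approximate both components of `S_σ` at once. -/
theorem coprime_sigmaCard_sub_one (p : ℕ) [Fact p.Prime] [CharP Fq p] :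
    (D.sigmaCard v σ - 1).Coprime p := by
  have := D.finiteDimensional_sigmaField v σ
  have := v.finite_residueField (D.sigmaField v σ)
  let R := IsLocalRing.ResidueField (v.integers (D.sigmaField v σ))
  have h2 : (p : R) = 0 := by
    have : CharP v.Cp p := v.charP_cp (Fq := Fq) p
    have h3 : (p : v.integers (D.sigmaField v σ)) = 0 := by
      apply Subtype.ext
      apply Subtype.ext
      apply (algebraMap v.AlgCl v.Cp).injective
      simp
    rw [← map_natCast (IsLocalRing.residue (v.integers (D.sigmaField v σ))), h3, map_zero]
  have hdvd : p ∣ D.sigmaCard v σ := dvd_natCard_of_natCast_eq_zero h2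
  obtain ⟨c, hc⟩ := hdvd
  have h3 := D.one_lt_sigmaCard σ
  refine Nat.Coprime.symm (((Fact.out : p.Prime).coprime_iff_not_dvd).2 fun h => ?_)
  have h4 := (Nat.dvd_sub_iff_right h3.le ⟨c, hc⟩).1 h
  exact (Fact.out : p.Prime).one_lt.ne' (Nat.dvd_one.1 h4)

theorem omega_spec {x : D.valueField} (hx : ‖σ x‖ = 1) :
    D.omega v σ (algebraMap v.AlgCl v.Cp (σ x)) ^ (D.sigmaCard v σ - 1) = 1 ∧
      ‖algebraMap v.AlgCl v.Cp (σ x) - D.omega v σ (algebraMap v.AlgCl v.Cp (σ x))‖ < 1 := by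
  have := D.finiteDimensional_sigmaField v σ
  have := v.finite_residueField (D.sigmaField v σ)
  let β : D.sigmaField v σ := ⟨σ x, IntermediateField.subset_adjoin _ _ ⟨x, rfl⟩⟩
  have h1 : ‖σ x ^ (D.sigmaCard v σ - 1) - 1‖ < 1 :=
    AbsoluteValue.pow_card_sub_one (v.isNonarchimedean_norm (D.sigmaField v σ)) (x := β) hx
  have hQ : D.sigmaCard v σ - 1 ≠ 0 := by have := D.one_lt_sigmaCard σ; omega
  obtain ⟨y, hy, hy1⟩ := exists_root_norm_sub_lt_one
    (P := Polynomial.X ^ (D.sigmaCard v σ - 1) - Polynomial.C (1 : v.AlgCl))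
    (Polynomial.monic_X_pow_sub_C _ hQ) (x := σ x) (by simpa using h1)
  refine Classical.epsilon_spec (p := fun ζ : v.Cp => ζ ^ (D.sigmaCard v σ - 1) = 1 ∧
    ‖algebraMap v.AlgCl v.Cp (σ x) - ζ‖ < 1) ⟨algebraMap v.AlgCl v.Cp y, ?_, ?_⟩
  · rw [← map_pow, ← map_one (algebraMap v.AlgCl v.Cp)]
    congr 1
    simpa [sub_eq_zero] using hy
  · rwa [← map_sub, v.norm_algebraMap_cp]

/-- The `1`-unit parts of the `σ(I ^ (s₁))` for `I` prime to `v` stay away from the boundary. -/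
theorem exists_norm_div_omega_sub_one_le (p : ℕ) [Fact p.Prime] [CharP Fq p]
    (hk : IsGlobalFunctionField Fq k) (hv : v ≠ D.inf) :
    ∃ ρ : ℝ, 0 < ρ ∧ ρ < 1 ∧ ∀ I : D.Ideals, (∃ c ∈ I.1, v.abs (c : k) = 1) →
      ‖algebraMap v.AlgCl v.Cp (σ (D.idealOneV I)) /
        D.omega v σ (algebraMap v.AlgCl v.Cp (σ (D.idealOneV I))) - 1‖ ≤ ρ := by
  have := v.charP_cp (Fq := Fq) p
  obtain ⟨N, hN, h⟩ := D.exists_positive_generator hk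
  have hQ : 0 < D.sigmaCard v σ - 1 := by have := D.one_lt_sigmaCard σ; omega
  have hq : 0 < v.card - 1 := by have := v.one_lt_card; omega
  -- The factor `N` brings `β` into `A`, `v.card - 1` makes it a `1`-unit, and `sigmaCard - 1`
  -- removes `ω`. So `(β / ω) ^ M` is a `1`-unit of `k`, at distance at most `card⁻¹` from `1`, with
  -- `M` independent of `I`.
  set M := N * ((v.card - 1) * (D.sigmaCard v σ - 1)) with hMdef
  have hM : 0 < M := by positivity
  have hc : (0 : ℝ) ≤ (v.card : ℝ)⁻¹ := (inv_pos.2 v.card_pos).le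
  refine ⟨((v.card : ℝ)⁻¹) ^ ((M : ℝ)⁻¹), Real.rpow_pos_of_pos (inv_pos.2 v.card_pos) _,
    Real.rpow_lt_one hc (inv_lt_one_of_one_lt₀ v.one_lt_card') (by positivity), fun I hI => ?_⟩
  obtain ⟨a, u, hIa, ha⟩ := h I
  have hβ1 := D.norm_algHom_idealOneV_eq_one p hk hv σ hI
  obtain ⟨h1, h2⟩ := D.omega_spec σ hβ1
  set β := algebraMap v.AlgCl v.Cp (σ (D.idealOneV I)) with hβ
  set ω := D.omega v σ β
  have hω : ‖ω‖ = 1 := by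
    have := congrArg norm h1
    rw [norm_pow, norm_one] at this
    exact (pow_eq_one_iff_of_nonneg (norm_nonneg _) hQ.ne').1 this
  have hω0 : ω ≠ 0 := norm_pos_iff.1 (hω ▸ one_pos)
  have h3 : ‖β / ω - 1‖ < 1 := by
    rw [div_sub_one hω0, norm_div, hω, div_one]
    exact h2
  have h4 := norm_sub_one_pow_le p h3 hM
  have h5 : (β / ω) ^ M = algebraMap k v.Cp ((a : k) ^ ((v.card - 1) * (D.sigmaCard v σ - 1))) := by
    have h6 : β ^ N = algebraMap k v.Cp (a : k) := by
      rw [hβ, ← map_pow, ← map_pow, D.idealOneV_pow p hk hIa ha, AlgHom.commutes,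
        ← IsScalarTower.algebraMap_apply]
    rw [div_pow, hMdef, pow_mul β, h6, ← map_pow,
      show N * ((v.card - 1) * (D.sigmaCard v σ - 1)) =
        (D.sigmaCard v σ - 1) * (N * (v.card - 1)) by ring, pow_mul ω, h1, one_pow, div_one]
  have h6 : ‖(β / ω) ^ M - 1‖ ≤ (v.card : ℝ)⁻¹ := by
    rw [h5, ← map_one (algebraMap k v.Cp), ← map_sub, v.norm_algebraMap]
    refine v.abs_le_inv_card ?_
    rw [pow_mul, ← v.norm_algebraMap, map_sub, map_one, map_pow]
    refine norm_sub_one_pow_lt ?_ le_rfl _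
    rw [← map_one (algebraMap k v.Cp), ← map_sub, v.norm_algebraMap]
    exact v.abs_pow_card_sub_one (D.abs_eq_one_of_prime_to hv hIa hI)
  rw [← Real.pow_rpow_inv_natCast (norm_nonneg (β / ω - 1)) hM.ne']
  exact Real.rpow_le_rpow (by positivity) (h4.trans h6) (by positivity)

end

/-- Uniform because `⟨I⟩ ^ N` is a `1`-unit of the discretely valued field `K` for one `N` valid for
all `I`. -/
theorem exists_norm_bracket_sub_one_le (p : ℕ) [Fact p.Prime] [CharP Fq p]
    (hk : IsGlobalFunctionField Fq k) :
    ∃ ρ : ℝ, 0 < ρ ∧ ρ < 1 ∧ ∀ I : D.Ideals, ‖D.bracket I - 1‖ ≤ ρ := by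
  have := D.inf.charP_cp (Fq := Fq) p
  obtain ⟨N, hN, h⟩ := D.exists_positive_generator hk
  have hc : (0 : ℝ) ≤ (D.inf.card : ℝ)⁻¹ := (inv_pos.2 D.inf.card_pos).le
  refine ⟨((D.inf.card : ℝ)⁻¹) ^ ((N : ℝ)⁻¹), Real.rpow_pos_of_pos (inv_pos.2 D.inf.card_pos) _,
    Real.rpow_lt_one hc (inv_lt_one_of_one_lt₀ D.inf.one_lt_card') (by positivity), fun I => ?_⟩
  obtain ⟨a, u, hIa, ha⟩ := h I
  have h1 := norm_sub_one_pow_le p (D.bracket_spec hk I).1 hN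
  rw [D.bracket_pow p hk hIa ha, ← map_one (algebraMap D.inf.Local D.inf.Cp), ← map_sub,
    D.inf.norm_algebraMap_local_cp, map_one] at h1
  rw [← Real.pow_rpow_inv_natCast (norm_nonneg (D.bracket I - 1)) hN.ne']
  exact Real.rpow_le_rpow (by positivity) (h1.trans (D.inf.norm_le_inv_card ha.1)) (by positivity)

end Datum
end

noncomputable section

/-! ### `p`-adic powers of `1`-units -/

theorem PadicInt.span_pow_mem_nhds {p : ℕ} [Fact p.Prime] (n : ℕ) :
    (Ideal.span {(p : ℤ_[p]) ^ n} : Set ℤ_[p]) ∈ 𝓝 (0 : ℤ_[p]) := by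
  have hp : (0 : ℝ) < p := Nat.cast_pos.2 (Fact.out : p.Prime).pos
  refine Filter.mem_of_superset (Metric.closedBall_mem_nhds 0 (zpow_pos hp (-n : ℤ))) fun y hy => ?_
  rw [mem_closedBall_zero_iff] at hy
  exact (PadicInt.norm_le_pow_iff_mem_span_pow y n).1 hy

section OneUnitPow

variable {C : Type*} [NormedField C] [IsUltrametricDist C]

theorem norm_pow_sub_one_le {u : C} (hu : ‖u‖ ≤ 1) (n : ℕ) : ‖u ^ n - 1‖ ≤ ‖u - 1‖ := by
  rw [← mul_geom_sum, norm_mul]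
  refine mul_le_of_le_one_right (norm_nonneg _) ?_
  refine IsUltrametricDist.norm_sum_le_of_forall_le_of_nonneg zero_le_one fun i _ => ?_
  rw [norm_pow]
  exact pow_le_one₀ (norm_nonneg _) hu

variable {p : ℕ} [Fact p.Prime] [CharP C p]

/-- By Frobenius, `u ^ p ^ n - 1 = (u - 1) ^ p ^ n`. -/
theorem norm_pow_sub_pow_le {u : C} (hu : ‖u - 1‖ < 1) {a b n : ℕ} (h : a ≡ b [MOD p ^ n]) :
    ‖u ^ a - u ^ b‖ ≤ ‖u - 1‖ ^ p ^ n := by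
  wlog hab : b ≤ a generalizing a b
  · rw [norm_sub_rev]
    exact this h.symm (le_of_not_ge hab)
  obtain ⟨m, hm⟩ := (Nat.modEq_iff_dvd' hab).1 h.symm
  have h1 : u ^ a - u ^ b = u ^ b * ((u ^ p ^ n) ^ m - 1) := by
    rw [mul_sub, ← pow_mul, ← hm, ← pow_add, Nat.add_sub_cancel' hab, mul_one]
  have hu1 := norm_eq_one_of_norm_sub_one_lt hu
  rw [h1, norm_mul, norm_pow, hu1, one_pow, one_mul]
  refine (norm_pow_sub_one_le (by rw [norm_pow, hu1, one_pow]) m).trans (le_of_eq ?_)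
  rw [← norm_pow, sub_pow_char_pow, one_pow]

variable [CompleteSpace C]

theorem tendsto_oneUnitPow {u : C} (hu : ‖u - 1‖ < 1) (y : ℤ_[p]) :
    Tendsto (fun n => u ^ y.appr n) atTop (𝓝 (oneUnitPow u y)) := by
  have hp := (Fact.out : p.Prime).one_lt
  have h1 : CauchySeq fun n => u ^ y.appr n := by
    refine cauchySeq_of_le_geometric ‖u - 1‖ 1 hu fun n => ?_
    rw [dist_eq_norm, one_mul]
    refine (norm_pow_sub_pow_le (p := p) (n := n) hu ?_).trans
      (pow_le_pow_of_le_one (norm_nonneg _) hu.le (Nat.lt_pow_self hp).le)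
    exact (Nat.modEq_iff_dvd' (y.appr_mono n.le_succ)).2
      (PadicInt.dvd_appr_sub_appr y n (n + 1) n.le_succ)
  exact tendsto_nhds_limUnder (cauchySeq_tendsto_of_complete h1)

theorem appr_modEq {y : ℤ_[p]} {a n m : ℕ} (hnm : n ≤ m)
    (h : y - a ∈ Ideal.span {(p : ℤ_[p]) ^ n}) : y.appr m ≡ a [MOD p ^ n] := by
  have h1 := PadicInt.appr_spec m y
  have h2 : ((y.appr m : ℤ) - a : ℤ_[p]) ∈ Ideal.span {(p : ℤ_[p]) ^ n} := by
    have h3 : y - y.appr m ∈ Ideal.span {(p : ℤ_[p]) ^ n} :=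
      Ideal.span_singleton_le_span_singleton.2 (pow_dvd_pow _ hnm) h1
    have h4 := sub_mem h h3
    rw [sub_sub_sub_cancel_left] at h4
    simpa using h4
  rw [Ideal.mem_span_singleton] at h2
  have h3 : ((p ^ n : ℕ) : ℤ) ∣ (y.appr m : ℤ) - a := by
    rw [Nat.cast_pow]
    refine (PadicInt.pow_p_dvd_int_iff n _).1 ?_
    simpa using h2
  exact ((Nat.modEq_iff_dvd).2 h3).symm

theorem norm_oneUnitPow_sub_pow_le {u : C} (hu : ‖u - 1‖ < 1) {y : ℤ_[p]} {a n : ℕ}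
    (h : y - a ∈ Ideal.span {(p : ℤ_[p]) ^ n}) :
    ‖oneUnitPow u y - u ^ a‖ ≤ ‖u - 1‖ ^ p ^ n := by
  refine le_of_tendsto ((tendsto_oneUnitPow hu y).sub_const (u ^ a)).norm ?_
  filter_upwards [eventually_ge_atTop n] with m hm
  exact norm_pow_sub_pow_le hu (appr_modEq hm h)

theorem tendsto_pow_prime_pow {ρ : ℝ} (h0 : 0 ≤ ρ) (h1 : ρ < 1) :
    Tendsto (fun n => ρ ^ p ^ n) atTop (𝓝 0) :=
  (tendsto_pow_atTop_nhds_zero_of_lt_one h0 h1).comp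
    (tendsto_pow_atTop_atTop_of_one_lt (Fact.out : p.Prime).one_lt)

theorem oneUnitPow_natCast {u : C} (hu : ‖u - 1‖ < 1) (j : ℕ) :
    oneUnitPow u (j : ℤ_[p]) = u ^ j := by
  rw [← sub_eq_zero, ← norm_le_zero_iff]
  refine ge_of_tendsto' (tendsto_pow_prime_pow (p := p) (norm_nonneg _) hu) fun n => ?_
  exact norm_oneUnitPow_sub_pow_le hu (by simp)

theorem norm_oneUnitPow {u : C} (hu : ‖u - 1‖ < 1) (y : ℤ_[p]) : ‖oneUnitPow u y‖ = 1 := by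
  refine tendsto_nhds_unique (tendsto_oneUnitPow hu y).norm ?_
  simp [norm_eq_one_of_norm_sub_one_lt hu]

theorem norm_oneUnitPow_sub_oneUnitPow_le {u : C} (hu : ‖u - 1‖ < 1) {y y' : ℤ_[p]} {n : ℕ}
    (h : y - y' ∈ Ideal.span {(p : ℤ_[p]) ^ n}) :
    ‖oneUnitPow u y - oneUnitPow u y'‖ ≤ ‖u - 1‖ ^ p ^ n := by
  have h1 := PadicInt.appr_spec n y
  have h2 : y' - y.appr n ∈ Ideal.span {(p : ℤ_[p]) ^ n} := by
    have := sub_mem h1 h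
    rwa [sub_sub_sub_cancel_left] at this
  have h3 : oneUnitPow u y - oneUnitPow u y' = (oneUnitPow u y - u ^ y.appr n) +
    -(oneUnitPow u y' - u ^ y.appr n) := by ring
  rw [h3]
  refine (IsUltrametricDist.norm_add_le_max _ _).trans
    (max_le (norm_oneUnitPow_sub_pow_le hu h1) ?_)
  rw [norm_neg]
  exact norm_oneUnitPow_sub_pow_le hu h2

theorem exists_nhds_norm_oneUnitPow_sub_lt {u : C} (hu : ‖u - 1‖ < 1) {ε : ℝ} (hε : 0 < ε) :
    ∃ U ∈ 𝓝 (0 : ℤ_[p]), ∀ y₀ y₁ : ℤ_[p], y₀ - y₁ ∈ U →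
      ‖oneUnitPow u y₀ - oneUnitPow u y₁‖ < ε := by
  obtain ⟨n, hn⟩ := ((tendsto_pow_prime_pow (p := p) (norm_nonneg _) hu).eventually_lt_const hε).exists
  exact ⟨_, PadicInt.span_pow_mem_nhds n, fun y₀ y₁ h =>
    (norm_oneUnitPow_sub_oneUnitPow_le hu h).trans_lt hn⟩

end OneUnitPow

/-! ### Sums of powers of `1`-units -/

section PowerSums

variable {C ι : Type*} [NormedField C] [IsUltrametricDist C]

/-- Bounds for finitely many exponents propagate to all. The binomial theorem passes from the sums
of `b * u ^ j` to those of `b * (u - 1) ^ m` and back, with integer coefficients, hence without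
loss. The latter sums are at most `η` for `m < M` by hypothesis and at most `B * ρ ^ M` for `m ≥ M`
trivially. -/
theorem norm_sum_mul_pow_le {s : Finset ι} {b u : ι → C} {ρ B η : ℝ} (hρ0 : 0 ≤ ρ) (hρ : ρ ≤ 1)
    (hu : ∀ i ∈ s, ‖u i - 1‖ ≤ ρ) (hB : 0 ≤ B) (hb : ∀ i ∈ s, ‖b i‖ ≤ B) (hη : 0 ≤ η) {M : ℕ}
    (h : ∀ j < M, ‖∑ i ∈ s, b i * u i ^ j‖ ≤ η) (j : ℕ) :
    ‖∑ i ∈ s, b i * u i ^ j‖ ≤ max η (B * ρ ^ M) := by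
  have hmax : 0 ≤ max η (B * ρ ^ M) := le_max_of_le_left hη
  have hd (m : ℕ) : ‖∑ i ∈ s, b i * (u i - 1) ^ m‖ ≤ max η (B * ρ ^ M) := by
    rcases lt_or_ge m M with hm | hm
    · have h1 : ∑ i ∈ s, b i * (u i - 1) ^ m = ∑ l ∈ Finset.range (m + 1),
          ((-1) ^ (m - l) * (m.choose l : C)) * ∑ i ∈ s, b i * u i ^ l := by
        simp_rw [Finset.mul_sum]
        rw [Finset.sum_comm]
        refine Finset.sum_congr rfl fun i _ => ?_
        rw [sub_eq_add_neg, add_pow, Finset.mul_sum]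
        refine Finset.sum_congr rfl fun l _ => ?_
        ring
      rw [h1]
      refine IsUltrametricDist.norm_sum_le_of_forall_le_of_nonneg hmax fun l hl => ?_
      refine le_max_of_le_left ?_
      rw [norm_mul]
      refine (mul_le_of_le_one_left (norm_nonneg _) ?_).trans
        (h l ((Nat.lt_succ_iff.1 (Finset.mem_range.1 hl)).trans_lt hm))
      rw [norm_mul, norm_pow, norm_neg, norm_one, one_pow, one_mul]
      exact IsUltrametricDist.norm_natCast_le_one C _
    · refine IsUltrametricDist.norm_sum_le_of_forall_le_of_nonneg hmax fun i hi => ?_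
      refine le_max_of_le_right ?_
      rw [norm_mul, norm_pow]
      refine mul_le_mul (hb i hi) ?_ (by positivity) hB
      exact (pow_le_pow_left₀ (norm_nonneg _) (hu i hi) m).trans (pow_le_pow_of_le_one hρ0 hρ hm)
  have h1 : ∑ i ∈ s, b i * u i ^ j = ∑ l ∈ Finset.range (j + 1),
      (j.choose l : C) * ∑ i ∈ s, b i * (u i - 1) ^ l := by
    simp_rw [Finset.mul_sum]
    rw [Finset.sum_comm]
    refine Finset.sum_congr rfl fun i _ => ?_
    rw [show u i ^ j = ((u i - 1) + 1) ^ j by ring, add_pow, Finset.mul_sum]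
    refine Finset.sum_congr rfl fun l _ => ?_
    ring
  rw [h1]
  refine IsUltrametricDist.norm_sum_le_of_forall_le_of_nonneg hmax fun l _ => ?_
  rw [norm_mul]
  exact (mul_le_of_le_one_left (norm_nonneg _) (IsUltrametricDist.norm_natCast_le_one C _)).trans (hd l)

end PowerSums

/-! ### Dirichlet series and families of entire power series -/

section Dirichlet

variable {ι Y C : Type*} [NormedField C] [IsUltrametricDist C] [CompleteSpace C]

theorem summable_of_tendsto_zero {α : Type*} {f : α → C} (h : Tendsto f cofinite (𝓝 0)) :
    Summable f :=
  NonarchimedeanAddGroup.summable_of_tendsto_cofinite_zero h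

theorem tendsto_cofinite_of_finite_fibers {deg : ι → ℕ} (hfin : ∀ n, {i | deg i = n}.Finite) :
    cofinite ≤ comap deg atTop := by
  rw [← tendsto_iff_comap, ← Nat.cofinite_eq_atTop]
  exact Filter.Tendsto.cofinite_of_finite_preimage_singleton fun n => hfin n

variable {deg : ι → ℕ} {c : ι → Y → C} {g : Y → C⟦X⟧}

/-- Terms tending to `0` are summable in an ultrametric field, and the sum may be regrouped by
degree. -/
theorem continues_of_coeff {L : Cˣ × Y → ι → C} (hL : HasHalfPlane deg L)
    (hLc : ∀ s i, L s i = (((s.1⁻¹ : Cˣ) : C)) ^ deg i * c i s.2)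
    (hfin : ∀ n, {i | deg i = n}.Finite)
    (hg : ∀ y n, PowerSeries.coeff n (g y) = ∑ᶠ i : {i // deg i = n}, c i y) :
    Continues deg L g := by
  refine ⟨hL, fun s hs => ?_⟩
  have h1 : Summable (L s) :=
    summable_of_tendsto_zero (hs.mono_left (tendsto_cofinite_of_finite_fibers hfin))
  have h2 := h1.hasSum.tsum_fiberwise deg
  have h3 (n : ℕ) : ∑' i : deg ⁻¹' {n}, L s i = PowerSeries.coeff n (g s.2) * (s.1 : C)⁻¹ ^ n := by
    have : Finite (deg ⁻¹' {n}) := hfin n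
    have := Fintype.ofFinite (deg ⁻¹' {n})
    have h4 : PowerSeries.coeff n (g s.2) = ∑ i : deg ⁻¹' {n}, c i s.2 :=
      (hg s.2 n).trans (finsum_eq_sum_of_fintype (fun i : deg ⁻¹' {n} => c i s.2))
    rw [tsum_fintype, h4, Finset.sum_mul]
    refine Finset.sum_congr rfl fun i _ => ?_
    rw [hLc, show deg i = n from i.2, Units.val_inv_eq_inv_val, mul_comm]
  simp_rw [h3] at h2
  unfold seriesEval
  rw [h2.tsum_eq]
  exact h1.hasSum

variable [AddGroup Y] [TopologicalSpace Y]

/-- By `hbound` the tails are small on bounded sets uniformly in `y`; finitely many ideals remain,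
and each of their terms is uniformly continuous in `y`. -/
theorem isEntireFamily_of_coeff (hfin : ∀ n, {i | deg i = n}.Finite)
    (hg : ∀ y n, PowerSeries.coeff n (g y) = ∑ᶠ i : {i // deg i = n}, c i y)
    (hc : ∀ i, ∀ ε : ℝ, 0 < ε → ∃ U ∈ 𝓝 (0 : Y), ∀ y₀ y₁, y₀ - y₁ ∈ U → ‖c i y₀ - c i y₁‖ < ε)
    (hbound : ∀ R : ℝ, 0 < R → ∀ ε : ℝ, 0 < ε → ∀ᶠ n in atTop, ∀ y,
      ‖PowerSeries.coeff n (g y)‖ * R ^ n ≤ ε) : IsEntireFamily g := by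
  have hsum (y : Y) (u : C) : Summable fun n => PowerSeries.coeff n (g y) * u ^ n := by
    refine summable_of_tendsto_zero ?_
    rw [Nat.cofinite_eq_atTop, Metric.tendsto_nhds]
    intro ε hε
    filter_upwards [hbound (‖u‖ + 1) (by positivity) (ε / 2) (by positivity)] with n hn
    rw [dist_zero_right, norm_mul, norm_pow]
    refine (mul_le_mul_of_nonneg_left (pow_le_pow_left₀ (norm_nonneg _) ?_ n)
      (norm_nonneg _)).trans_lt ((hn y).trans_lt (half_lt_self hε))
    linarith
  refine ⟨hsum, fun B hB ε hε => ?_⟩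
  obtain ⟨R, hR0, hR⟩ := hB.exists_pos_norm_le
  obtain ⟨n₀, hn₀⟩ := eventually_atTop.1 (hbound R hR0 (ε / 2) (by positivity))
  have hδ (n : ℕ) : 0 < ε / 2 / R ^ n := by positivity
  choose U hU hUc using fun i => hc i _ (hδ (deg i))
  have hfin' : {i | deg i < n₀}.Finite := by
    refine ((Set.finite_lt_nat n₀).biUnion fun n _ => hfin n).subset fun i hi => ?_
    exact Set.mem_biUnion (show deg i ∈ {m | m < n₀} from hi) rfl
  refine ⟨⋂ i ∈ {i | deg i < n₀}, U i, (Filter.biInter_mem hfin').2 fun i _ => hU i,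
    fun y₀ y₁ hy u hu => ?_⟩
  unfold seriesEval
  rw [← (hsum y₀ u).tsum_sub (hsum y₁ u)]
  refine (IsUltrametricDist.norm_tsum_le_of_forall_le_of_nonneg (half_pos hε).le fun n => ?_).trans_lt
    (half_lt_self hε)
  rw [← sub_mul, norm_mul, norm_pow]
  refine (mul_le_mul_of_nonneg_left (pow_le_pow_left₀ (norm_nonneg _) (hR u hu) n)
    (norm_nonneg _)).trans ?_
  rcases lt_or_ge n n₀ with hn | hn
  · rw [← le_div_iff₀ (by positivity)]
    have : Finite {i // deg i = n} := hfin n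
    have := Fintype.ofFinite {i // deg i = n}
    rw [hg, hg, finsum_eq_sum_of_fintype, finsum_eq_sum_of_fintype, ← Finset.sum_sub_distrib]
    refine IsUltrametricDist.norm_sum_le_of_forall_le_of_nonneg (hδ n).le fun i _ => ?_
    have h1 := hUc i y₀ y₁ (Set.mem_iInter₂.1 hy i (i.2.trans_lt hn))
    rw [i.2] at h1
    exact h1.le
  · rw [sub_eq_add_neg]
    refine (mul_le_mul_of_nonneg_right (IsUltrametricDist.norm_add_le_max _ _) (by positivity)).trans ?_
    rw [norm_neg, max_mul_of_nonneg _ _ (by positivity)]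
    exact max_le (hn₀ n hn y₀) (hn₀ n hn y₁)

end Dirichlet
end

noncomputable section

/-! ### Growth estimates -/

theorem eventually_forall_lt_mul_of_isBigO_log {d : ℕ → ℕ}
    (h : (fun j : ℕ => (d j : ℝ)) =O[atTop] (fun j : ℕ => Real.log j)) (K : ℕ) :
    ∀ᶠ n : ℕ in atTop, ∀ j < K * n, d j < n := by
  rcases Nat.eq_zero_or_pos K with rfl | hK
  · simp
  obtain ⟨c, hc, hO⟩ := h.exists_pos
  obtain ⟨j₀, hj₀⟩ := eventually_atTop.1 hO.bound
  have hKn : Tendsto (fun n : ℕ => ((K * n : ℕ) : ℝ)) atTop atTop :=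
    tendsto_natCast_atTop_atTop.comp (tendsto_id.const_mul_atTop' hK)
  -- With this constant, `c * log (K * n)` is at most `n / 2`.
  have hlog := (Real.isLittleO_log_id_atTop.comp_tendsto hKn).bound
    (show 0 < 1 / (2 * c * K) by positivity)
  filter_upwards [hlog, eventually_gt_atTop ((Finset.range j₀).sup d), eventually_gt_atTop 0]
    with n hn hn1 hn0 j hj
  rcases lt_or_ge j j₀ with hlt | hge
  · exact (Finset.le_sup (f := d) (Finset.mem_range.2 hlt)).trans_lt hn1
  · have h1 := hj₀ j hge
    have h2 : ‖Real.log j‖ ≤ Real.log (K * n : ℕ) := by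
      rw [Real.norm_eq_abs, abs_of_nonneg (Real.log_natCast_nonneg j)]
      rcases Nat.eq_zero_or_pos j with rfl | hj1
      · simpa using Real.log_natCast_nonneg (K * n)
      · exact Real.log_le_log (Nat.cast_pos.2 hj1) (Nat.cast_le.2 hj.le)
    have h3 : Real.log (K * n : ℕ) ≤ 1 / (2 * c * K) * (K * n) := by
      have h4 := (le_abs_self _).trans hn
      simpa using h4
    have h5 : (d j : ℝ) < n := by
      rw [Real.norm_natCast] at h1
      have hn' : (0 : ℝ) < n := Nat.cast_pos.2 hn0
      calc (d j : ℝ) ≤ c * (1 / (2 * c * K) * (K * n)) :=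
            h1.trans (mul_le_mul_of_nonneg_left (h2.trans h3) hc.le)
        _ = n / 2 := by field_simp
        _ < n := half_lt_self hn'
    exact_mod_cast h5

theorem exists_pow_mul_lt {X ρ : ℝ} (hρ0 : 0 ≤ ρ) (hρ : ρ < 1) {δ : ℝ} (hδ : 0 < δ) :
    ∃ K : ℕ, X * ρ ^ K < δ := by
  have h := (tendsto_pow_atTop_nhds_zero_of_lt_one hρ0 hρ).const_mul X
  rw [mul_zero] at h
  exact (h.eventually_lt_const hδ).exists

/-- Super-exponential decay kills every exponential factor. -/
theorem eventually_mul_pow_le_of_forall {Y : Type*} {f : ℕ → Y → ℝ} {A X ρ : ℝ}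
    (hX : 0 ≤ X) (hρ0 : 0 ≤ ρ) (hρ : ρ < 1)
    (h : ∀ K : ℕ, ∀ᶠ n : ℕ in atTop, ∀ y, f n y ≤ A * X ^ n * ρ ^ (K * n)) {R : ℝ} (hR : 0 < R)
    {ε : ℝ} (hε : 0 < ε) : ∀ᶠ n : ℕ in atTop, ∀ y, f n y * R ^ n ≤ ε := by
  obtain ⟨K, hK⟩ := exists_pow_mul_lt (X := X * R) hρ0 hρ (half_pos one_pos)
  have h1 := (tendsto_pow_atTop_nhds_zero_of_lt_one (r := X * R * ρ ^ K) (by positivity)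
    (by linarith)).const_mul A
  rw [mul_zero] at h1
  filter_upwards [h K, h1.eventually_lt_const hε] with n hn hn1 y
  refine (mul_le_mul_of_nonneg_right (hn y) (by positivity)).trans (le_trans (le_of_eq ?_) hn1.le)
  rw [pow_mul]
  ring

/-! ### The interpolation at `∞` -/

namespace Datum

variable {Fq k : Type*} [Field Fq] [Finite Fq] [Field k] [Algebra Fq k] (D : Datum Fq k)
  {p : ℕ} [Fact p.Prime] [CharP Fq p]

/-- Convergence at the single point `x = π_* ^ (-m₀)`, `y = 0` already bounds `b_I` exponentially in
the degree, apart from finitely many ideals. The `+ 1` leaves room for those of degree zero. -/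
theorem exists_abs_coeff_le (hk : IsGlobalFunctionField Fq k) {b : D.Ideals → D.A}
    (h : HasHalfPlane D.degI (D.term (p := p) b)) :
    ∃ m : ℕ, ∀ I, D.inf.abs (b I : k) ≤ (Nat.card Fq : ℝ) ^ (m * (D.degI I + 1)) := by
  have := D.inf.charP_cp (Fq := Fq) p
  have hr : (1 : ℝ) < Nat.card Fq := Nat.one_lt_cast.2 Finite.one_lt_card
  obtain ⟨t, ht, h⟩ := h
  obtain ⟨m₀, hm₀⟩ := pow_unbounded_of_one_lt t hr
  have hx : ‖D.root⁻¹ ^ m₀‖ = (Nat.card Fq : ℝ) ^ m₀ := by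
    rw [norm_pow, norm_inv, D.norm_root, inv_inv]
  have h1 := h (Units.mk0 (D.root⁻¹ ^ m₀) (pow_ne_zero _ (inv_ne_zero D.root_ne_zero)), 0)
    (hm₀.le.trans hx.ge)
  have h2 := h1.norm.eventually_lt_const (show ‖(0 : D.inf.Cp)‖ < 1 by simp)
  obtain ⟨n₀, -, hn₀⟩ := (atTop_basis.comap D.degI).eventually_iff.1 h2
  have hbig (I : D.Ideals) (hI : n₀ ≤ D.degI I) :
      D.inf.abs (b I : k) ≤ (Nat.card Fq : ℝ) ^ (m₀ * D.degI I) := by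
    have h3 := (hn₀ (show I ∈ D.degI ⁻¹' Set.Ici n₀ from hI)).le
    unfold term idealPow at h3
    rw [norm_mul, norm_mul, D.inf.norm_algebraMap, norm_oneUnitPow (D.bracket_spec hk I).1, mul_one,
      norm_pow, Units.val_inv_eq_inv_val, Units.val_mk0, norm_inv, hx, inv_pow, ← div_eq_mul_inv,
      div_le_one (by positivity), ← pow_mul] at h3
    exact h3
  have hfin : {I : D.Ideals | D.degI I < n₀}.Finite := by
    refine ((Set.finite_lt_nat n₀).biUnion fun n _ => D.finite_ideals_degI hk n).subset
      fun i hi => ?_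
    exact Set.mem_biUnion (show D.degI i ∈ {m | m < n₀} from hi) rfl
  obtain ⟨B, hB⟩ := (hfin.image fun I => D.inf.abs (b I : k)).bddAbove
  obtain ⟨m₁, hm₁⟩ := pow_unbounded_of_one_lt B hr
  refine ⟨max m₀ m₁, fun I => ?_⟩
  rcases lt_or_ge (D.degI I) n₀ with hI | hI
  · refine (hB ⟨I, hI, rfl⟩).trans (hm₁.le.trans (pow_le_pow_right₀ hr.le ?_))
    exact (le_max_right _ _).trans (Nat.le_mul_of_pos_right _ (Nat.succ_pos _))
  · exact (hbig I hI).trans (pow_le_pow_right₀ hr.le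
      (Nat.mul_le_mul (le_max_left _ _) (Nat.le_succ _)))

theorem coeff_formalSeries_neg (hk : IsGlobalFunctionField Fq k) (b : D.Ideals → D.A) (j n : ℕ) :
    PowerSeries.coeff n (D.formalSeries b (-(j : ℤ_[p]))) =
      ∑ᶠ I : {I : D.Ideals // D.degI I = n},
        algebraMap k D.inf.Cp (b I.1) * D.bracket I.1 ^ j := by
  have := D.inf.charP_cp (Fq := Fq) p
  unfold formalSeries
  rw [PowerSeries.coeff_mk]
  refine finsum_congr fun I => ?_
  rw [neg_neg, oneUnitPow_natCast (D.bracket_spec hk I.1).1]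

/-- The place where the logarithmic degree bound enters: for `j < K * n` the polynomial `P j` has
degree below `n`. The twist only multiplies coefficients by nonzero factors. -/
theorem eventually_coeff_eq_zero (hk : IsGlobalFunctionField Fq k) {b : D.Ideals → D.A}
    (hb : D.IsMotivic p b) (K : ℕ) : ∀ᶠ n : ℕ in atTop, ∀ j < K * n,
      ∑ᶠ I : {I : D.Ideals // D.degI I = n},
        algebraMap k D.inf.Cp (b I.1) * D.bracket I.1 ^ j = 0 := by
  obtain ⟨-, P, hP, -, hO⟩ := hb
  filter_upwards [eventually_forall_lt_mul_of_isBigO_log hO K] with n hn j hj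
  have h1 := congrArg (PowerSeries.coeff n) (hP j)
  rw [Polynomial.coeff_coe, Polynomial.coeff_map, Polynomial.coeff_eq_zero_of_natDegree_lt (hn j hj),
    map_zero, twist, PowerSeries.coeff_rescale, D.coeff_formalSeries_neg hk] at h1
  exact (mul_eq_zero.1 h1.symm).resolve_left
    (pow_ne_zero _ (inv_ne_zero (pow_ne_zero _ D.root_ne_zero)))

theorem norm_coeff_formalSeries_le (hk : IsGlobalFunctionField Fq k) {b : D.Ideals → D.A}
    (hb : D.IsMotivic p b) : ∃ A X ρ : ℝ, 0 ≤ X ∧ 0 ≤ ρ ∧ ρ < 1 ∧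
      ∀ K : ℕ, ∀ᶠ n : ℕ in atTop, ∀ y : ℤ_[p],
        ‖PowerSeries.coeff n (D.formalSeries b y)‖ ≤ A * X ^ n * ρ ^ (K * n) := by
  have := D.inf.charP_cp (Fq := Fq) p
  obtain ⟨m, hm⟩ := D.exists_abs_coeff_le hk hb.1
  obtain ⟨ρ, hρ0, hρ1, hρ⟩ := D.exists_norm_bracket_sub_one_le p hk
  refine ⟨(Nat.card Fq : ℝ) ^ m, (Nat.card Fq : ℝ) ^ m, ρ, by positivity, hρ0.le, hρ1,
    fun K => ?_⟩
  filter_upwards [D.eventually_coeff_eq_zero hk hb K] with n hn y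
  have : Finite {I : D.Ideals // D.degI I = n} := D.finite_ideals_degI hk n
  have := Fintype.ofFinite {I : D.Ideals // D.degI I = n}
  simp_rw [finsum_eq_sum_of_fintype] at hn
  unfold formalSeries
  rw [PowerSeries.coeff_mk, finsum_eq_sum_of_fintype]
  -- Exact vanishing allows `η = 0`, and the bound on the `b_I` grows only exponentially in `n`. The
  -- estimate then passes to `p`-adic exponents through the approximations `appr`.
  have h1 (j : ℕ) := norm_sum_mul_pow_le (s := Finset.univ)
    (b := fun I : {I : D.Ideals // D.degI I = n} => algebraMap k D.inf.Cp (b I.1))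
    (u := fun I => D.bracket I.1) (B := (Nat.card Fq : ℝ) ^ (m * (n + 1))) hρ0.le hρ1.le
    (fun I _ => hρ I.1) (by positivity) (fun I _ => by
      rw [D.inf.norm_algebraMap]
      exact (hm I.1).trans_eq (by rw [I.2])) le_rfl
    (fun j hj => (norm_le_zero_iff.2 (hn j hj))) j
  refine le_of_tendsto' (tendsto_finsetSum _ fun I _ =>
    (tendsto_oneUnitPow (D.bracket_spec hk I.1).1 (-y)).const_mul _).norm fun j => (h1 _).trans ?_
  rw [max_eq_right (by positivity), mul_add, mul_one, pow_add, ← pow_mul]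
  apply le_of_eq
  ring

theorem exists_entire_inf (hk : IsGlobalFunctionField Fq k) {b : D.Ideals → D.A}
    (hb : D.IsMotivic p b) : ∃ g : ℤ_[p] → D.inf.Cp⟦X⟧,
      IsEntireFamily g ∧ Continues D.degI (D.term b) g ∧ D.IsEssAlgebraic g := by
  have := D.inf.charP_cp (Fq := Fq) p
  have hcoeff (y : ℤ_[p]) (n : ℕ) : PowerSeries.coeff n (D.formalSeries b y) =
      ∑ᶠ I : {I : D.Ideals // D.degI I = n},
        algebraMap k D.inf.Cp (b I.1) * oneUnitPow (D.bracket I.1) (-y) :=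
    PowerSeries.coeff_mk _ _
  refine ⟨D.formalSeries b, ?_, ?_, fun j => ?_⟩
  · refine isEntireFamily_of_coeff (deg := D.degI)
      (c := fun I y => algebraMap k D.inf.Cp (b I) * oneUnitPow (D.bracket I) (-y))
      (D.finite_ideals_degI hk) hcoeff (fun I ε hε => ?_) ?_
    · obtain ⟨U, hU, h⟩ := exists_nhds_norm_oneUnitPow_sub_lt (p := p) (D.bracket_spec hk I).1
        (show 0 < ε / (‖algebraMap k D.inf.Cp (b I)‖ + 1) by positivity)
      refine ⟨-U, by simpa using neg_mem_nhds_zero _ hU, fun y₀ y₁ hy => ?_⟩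
      have h1 := h (-y₀) (-y₁) (by
        rw [Set.mem_neg] at hy
        convert hy using 1
        ring)
      rw [← mul_sub, norm_mul]
      rw [lt_div_iff₀ (by positivity)] at h1
      refine lt_of_le_of_lt ?_ h1
      rw [mul_comm]
      exact mul_le_mul_of_nonneg_left (by linarith) (norm_nonneg _)
    · obtain ⟨A, X, ρ, hX, hρ0, hρ1, h⟩ := D.norm_coeff_formalSeries_le hk hb
      intro R hR ε hε
      exact eventually_mul_pow_le_of_forall hX hρ0 hρ1 h hR hε
  · refine continues_of_coeff (c := fun I y => algebraMap k D.inf.Cp (b I) *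
      oneUnitPow (D.bracket I) (-y)) hb.1 (fun s I => ?_) (D.finite_ideals_degI hk) hcoeff
    unfold term idealPow
    ring
  · obtain ⟨-, P, hP, -⟩ := hb
    exact ⟨P j, (hP j).symm⟩

end Datum
end

noncomputable section

/-! ### The interpolation at a finite prime -/

/-- Chinese remainder theorem; adding multiples of `q * p ^ n` makes the integer as large as
desired. -/
theorem exists_natCast_approx {p : ℕ} [Fact p.Prime] {q : ℕ} (hq : 0 < q) (hqp : q.Coprime p)
    (y : ℤ_[p] × ZMod q) (n J : ℕ) :
    ∃ j : ℕ, J ≤ j ∧ (j : ZMod q) = y.2 ∧ y.1 - j ∈ Ideal.span {(p : ℤ_[p]) ^ n} := by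
  have : NeZero q := ⟨hq.ne'⟩
  obtain ⟨j₀, h1, h2⟩ := Nat.chineseRemainder (hqp.pow_right n) y.2.val (y.1.appr n)
  refine ⟨j₀ + q * p ^ n * J, ?_, ?_, ?_⟩
  · have : 0 < q * p ^ n := Nat.mul_pos hq (pow_pos (Fact.out : p.Prime).pos n)
    exact (Nat.le_mul_of_pos_left J this).trans (Nat.le_add_left _ _)
  · rw [Nat.cast_add, Nat.cast_mul, Nat.cast_mul, ZMod.natCast_self, zero_mul, zero_mul, add_zero,
      ← ZMod.natCast_zmod_val y.2]
    exact (ZMod.natCast_eq_natCast_iff _ _ _).2 h1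
  · have h3 : (p : ℤ_[p]) ^ n ∣ ((y.1.appr n : ℤ) - j₀ : ℤ) := by
      rw [PadicInt.pow_p_dvd_int_iff, ← Nat.cast_pow]
      exact (Nat.modEq_iff_dvd).1 h2
    have h4 := sub_mem (add_mem (PadicInt.appr_spec n y.1) (Ideal.mem_span_singleton.2 h3))
      (Ideal.mem_span_singleton.2 (Dvd.intro ((q * J : ℕ) : ℤ_[p]) rfl))
    convert h4 using 1
    push_cast
    ring

namespace Datum

variable {Fq k : Type*} [Field Fq] [Finite Fq] [Field k] [Algebra Fq k] (D : Datum Fq k)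

/-! ### Powers with exponents in `S_σ`. -/

section UnitPow

variable {p : ℕ} [Fact p.Prime] {v : Place k} {σ : D.valueField →ₐ[k] v.AlgCl} {β : v.Cp}

theorem norm_omega (hQ : 1 < D.sigmaCard v σ) (h1 : D.omega v σ β ^ (D.sigmaCard v σ - 1) = 1) :
    ‖D.omega v σ β‖ = 1 := by
  have h2 := congrArg norm h1
  rw [norm_pow, norm_one] at h2
  exact (pow_eq_one_iff_of_nonneg (norm_nonneg _) (by omega)).1 h2

theorem omega_ne_zero (hQ : 1 < D.sigmaCard v σ)
    (h1 : D.omega v σ β ^ (D.sigmaCard v σ - 1) = 1) : D.omega v σ β ≠ 0 :=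
  norm_pos_iff.1 ((D.norm_omega hQ h1).symm ▸ one_pos)

variable [CharP v.Cp p]

theorem norm_unitPow (hQ : 1 < D.sigmaCard v σ) (h1 : D.omega v σ β ^ (D.sigmaCard v σ - 1) = 1)
    (h2 : ‖β / D.omega v σ β - 1‖ < 1) (y : D.SSigma v σ p) : ‖D.unitPow v σ β y‖ = 1 := by
  unfold unitPow
  rw [norm_mul, norm_pow, D.norm_omega hQ h1, one_pow, one_mul, norm_oneUnitPow h2]

theorem omega_pow_val (hQ : 1 < D.sigmaCard v σ)
    (h1 : D.omega v σ β ^ (D.sigmaCard v σ - 1) = 1) {z : ZMod (D.sigmaCard v σ - 1)} {j : ℕ}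
    (hj : (j : ZMod (D.sigmaCard v σ - 1)) = z) : D.omega v σ β ^ z.val = D.omega v σ β ^ j := by
  have : NeZero (D.sigmaCard v σ - 1) := ⟨by omega⟩
  rw [← hj, ZMod.val_natCast]
  conv_rhs => rw [← Nat.mod_add_div j (D.sigmaCard v σ - 1), pow_add, pow_mul, h1, one_pow, mul_one]

theorem norm_unitPow_sub_pow_le (hQ : 1 < D.sigmaCard v σ)
    (h1 : D.omega v σ β ^ (D.sigmaCard v σ - 1) = 1) (h2 : ‖β / D.omega v σ β - 1‖ < 1)
    {y : D.SSigma v σ p} {j n : ℕ} (hj : (j : ZMod (D.sigmaCard v σ - 1)) = y.2)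
    (hjn : y.1 - j ∈ Ideal.span {(p : ℤ_[p]) ^ n}) :
    ‖D.unitPow v σ β y - β ^ j‖ ≤ ‖β / D.omega v σ β - 1‖ ^ p ^ n := by
  have h3 : β ^ j = D.omega v σ β ^ j * (β / D.omega v σ β) ^ j := by
    rw [← mul_pow, mul_div_cancel₀ _ (D.omega_ne_zero hQ h1)]
  unfold unitPow
  rw [D.omega_pow_val hQ h1 hj, h3, ← mul_sub, norm_mul, norm_pow, D.norm_omega hQ h1, one_pow,
    one_mul]
  exact norm_oneUnitPow_sub_pow_le h2 hjn

theorem unitPow_natCast (hQ : 1 < D.sigmaCard v σ)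
    (h1 : D.omega v σ β ^ (D.sigmaCard v σ - 1) = 1) (h2 : ‖β / D.omega v σ β - 1‖ < 1) (j : ℕ) :
    D.unitPow v σ β (j : D.SSigma v σ p) = β ^ j := by
  rw [← sub_eq_zero, ← norm_le_zero_iff]
  refine ge_of_tendsto' (tendsto_pow_prime_pow (p := p) (norm_nonneg _) h2) fun n => ?_
  exact D.norm_unitPow_sub_pow_le hQ h1 h2 (by simp) (by simp)

theorem exists_nhds_norm_unitPow_sub_lt (hQ : 1 < D.sigmaCard v σ)
    (h1 : D.omega v σ β ^ (D.sigmaCard v σ - 1) = 1) (h2 : ‖β / D.omega v σ β - 1‖ < 1) {ε : ℝ}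
    (hε : 0 < ε) : ∃ U ∈ 𝓝 (0 : D.SSigma v σ p), ∀ y₀ y₁ : D.SSigma v σ p, y₀ - y₁ ∈ U →
      ‖D.unitPow v σ β y₀ - D.unitPow v σ β y₁‖ < ε := by
  obtain ⟨U, hU, h⟩ := exists_nhds_norm_oneUnitPow_sub_lt (p := p) h2 hε
  refine ⟨U ×ˢ {0}, prod_mem_nhds hU (mem_nhds_discrete.2 rfl), fun y₀ y₁ hy => ?_⟩
  have h3 : y₀.2 = y₁.2 := sub_eq_zero.1 hy.2
  unfold unitPow
  rw [h3, ← mul_sub, norm_mul, norm_pow, D.norm_omega hQ h1, one_pow, one_mul]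
  exact h _ _ hy.1

end UnitPow

/-! ### Power sums over the ideals prime to `v`. -/

section Sums

variable {v : Place k}

open scoped Classical in
/-- The ideals of degree `n` which are prime to `v`. -/
def idealsPrimeTo (hk : IsGlobalFunctionField Fq k) (v : Place k) (n : ℕ) : Finset D.Ideals :=
  (D.finite_ideals_degI hk n).toFinset.filter fun I => ∃ c ∈ I.1, v.abs (c : k) = 1

theorem mem_idealsPrimeTo {hk : IsGlobalFunctionField Fq k} {n : ℕ} {I : D.Ideals} :
    I ∈ D.idealsPrimeTo hk v n ↔ D.degI I = n ∧ ∃ c ∈ I.1, v.abs (c : k) = 1 := by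
  simp [idealsPrimeTo]

theorem finsum_idealsPrimeTo (hk : IsGlobalFunctionField Fq k) {M : Type*} [AddCommMonoid M]
    (f : D.Ideals → M) (n : ℕ) :
    ∑ᶠ I : {I : D.IdealsPrimeTo v // D.degI I.1 = n}, f I.1.1 =
      ∑ I ∈ D.idealsPrimeTo hk v n, f I := by
  rw [← Finset.sum_coe_sort, ← finsum_eq_sum_of_fintype]
  let e : {I : D.IdealsPrimeTo v // D.degI I.1 = n} ≃ D.idealsPrimeTo hk v n :=
    { toFun := fun I => ⟨I.1.1, D.mem_idealsPrimeTo.2 ⟨I.2, I.1.2⟩⟩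
      invFun := fun I => ⟨⟨I.1, (D.mem_idealsPrimeTo.1 I.2).2⟩, (D.mem_idealsPrimeTo.1 I.2).1⟩
      left_inv := fun _ => rfl
      right_inv := fun _ => rfl }
  exact finsum_comp_equiv (f := fun I : D.idealsPrimeTo hk v n => f I) e

theorem finite_degI_primeTo (hk : IsGlobalFunctionField Fq k) (n : ℕ) :
    {I : D.IdealsPrimeTo v | D.degI I.1 = n}.Finite :=
  (D.finite_ideals_degI hk n).preimage Subtype.val_injective.injOn

/-- The image in `ℂ_v` of `σ(I ^ (s₁))`. -/
abbrev idealOneSigma (σ : D.valueField →ₐ[k] v.AlgCl) (I : D.Ideals) : v.Cp :=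
  algebraMap v.AlgCl v.Cp (σ (D.idealOneV I))

theorem norm_algebraMap_coeff_le (hv : v ≠ D.inf) (a : D.A) : ‖algebraMap k v.Cp a‖ ≤ 1 := by
  rw [v.norm_algebraMap]
  exact a.2 v hv

variable {p : ℕ} [Fact p.Prime] [CharP Fq p] (σ : D.valueField →ₐ[k] v.AlgCl)

/-- Ideals of equal degree share the factor `π_* ^ (-n)`, so the relations among the `⟨I⟩` hold for
the elements `I ^ (s₁)` of `𝕍`, to which `σ` can be applied. -/
theorem eventually_sum_idealOneV_eq_zero (hk : IsGlobalFunctionField Fq k) {b : D.Ideals → D.A}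
    (hb : D.IsMotivic p b) (K : ℕ) : ∀ᶠ n : ℕ in atTop, ∀ j < K * n,
      ∑ I ∈ (D.finite_ideals_degI hk n).toFinset,
        algebraMap k D.valueField (b I) * D.idealOneV I ^ j = 0 := by
  filter_upwards [D.eventually_coeff_eq_zero hk hb K] with n hn j hj
  have h1 := hn j hj
  have : Finite {I : D.Ideals // D.degI I = n} := D.finite_ideals_degI hk n
  have h2 : ∑ I ∈ (D.finite_ideals_degI hk n).toFinset,
      algebraMap k D.inf.Cp (b I) * D.bracket I ^ j = 0 := by
    rw [← h1, ← finsum_mem_eq_finite_toFinset_sum]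
    exact (finsum_set_coe_eq_finsum_mem _).symm
  apply (algebraMap D.valueField D.inf.Cp).injective
  rw [map_sum, map_zero, ← mul_zero ((D.root⁻¹ ^ n) ^ j), ← h2, Finset.mul_sum]
  refine Finset.sum_congr rfl fun I hI => ?_
  rw [Set.Finite.mem_toFinset] at hI
  have h3 : algebraMap D.valueField D.inf.Cp (D.idealOneV I) = D.root⁻¹ ^ n * D.bracket I := by
    rw [← show D.degI I = n from hI]
    rfl
  rw [map_mul, map_pow, h3, mul_pow, ← IsScalarTower.algebraMap_apply]
  ring

/-- The full sum vanishes, so the part prime to `v` is minus the rest, whose terms are at most `ρ ^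
j`. -/
theorem eventually_norm_sum_idealOneSigma_le (hk : IsGlobalFunctionField Fq k)
    {b : D.Ideals → D.A} (hb : D.IsMotivic p b) (hv : v ≠ D.inf) {ρ : ℝ} (hρ0 : 0 ≤ ρ)
    (hρ : ∀ I : D.Ideals, (¬ ∃ c ∈ I.1, v.abs (c : k) = 1) → ‖σ (D.idealOneV I)‖ ≤ ρ) (K : ℕ) :
    ∀ᶠ n : ℕ in atTop, ∀ j < K * n,
      ‖∑ I ∈ D.idealsPrimeTo hk v n, algebraMap k v.Cp (b I) * D.idealOneSigma σ I ^ j‖ ≤ ρ ^ j := by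
  classical
  filter_upwards [D.eventually_sum_idealOneV_eq_zero hk hb K] with n hn j hj
  have h1 := congrArg (fun x => algebraMap v.AlgCl v.Cp (σ x)) (hn j hj)
  simp only [map_sum, map_mul, map_pow, map_zero, AlgHom.commutes,
    ← IsScalarTower.algebraMap_apply] at h1
  rw [← Finset.sum_filter_add_sum_filter_not _ fun I : D.Ideals => ∃ c ∈ I.1, v.abs (c : k) = 1]
    at h1
  have h2 : D.idealsPrimeTo hk v n = (D.finite_ideals_degI hk n).toFinset.filter
      fun I : D.Ideals => ∃ c ∈ I.1, v.abs (c : k) = 1 := by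
    ext I
    rw [mem_idealsPrimeTo, Finset.mem_filter, Set.Finite.mem_toFinset]
    rfl
  rw [h2, eq_neg_of_add_eq_zero_left h1, norm_neg]
  refine IsUltrametricDist.norm_sum_le_of_forall_le_of_nonneg (by positivity) fun I hI => ?_
  rw [norm_mul, norm_pow, v.norm_algebraMap_cp]
  refine (mul_le_of_le_one_left (by positivity) (D.norm_algebraMap_coeff_le hv _)).trans ?_
  exact pow_le_pow_left₀ (norm_nonneg _) (hρ I (Finset.mem_filter.1 hI).2) j

variable [FiniteDimensional k D.valueField]

/-- The power sums of the `σ(I ^ (s₁))` over the ideals of degree `n` prime to `v` are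
super-exponentially small. -/
theorem exists_norm_sum_idealOneSigma_le (hk : IsGlobalFunctionField Fq k)
    {b : D.Ideals → D.A} (hb : D.IsMotivic p b) (hv : v ≠ D.inf) :
    ∃ δ : ℝ, 0 < δ ∧ δ < 1 ∧ ∀ K : ℕ, ∀ᶠ n : ℕ in atTop, ∀ j, K * n ≤ j →
      ‖∑ I ∈ D.idealsPrimeTo hk v n, algebraMap k v.Cp (b I) * D.idealOneSigma σ I ^ j‖ ≤
        δ ^ (K * n) := by
  obtain ⟨ρ, hρ0, hρ1, hρ⟩ := D.exists_norm_algHom_idealOneV_le p hk hv σ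
  obtain ⟨ρ', hρ'0, hρ'1, hρ'⟩ := D.exists_norm_div_omega_sub_one_le σ p hk hv
  have hQ := D.one_lt_sigmaCard σ
  set q := D.sigmaCard v σ - 1 with hq
  have hq0 : 0 < q := by omega
  refine ⟨max ρ ρ', lt_max_of_lt_left hρ0, max_lt hρ1 hρ'1, fun K => ?_⟩
  -- The exponents `a + q * l` with `a < K * n + q` and `l < K * n` all stay below `(K + q + q * K)
  -- * n`.
  filter_upwards [D.eventually_norm_sum_idealOneSigma_le σ hk hb hv hρ0.le hρ (K + q + q * K),
    eventually_gt_atTop 0] with n hn hn0 j hj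
  -- The representative of `j` modulo `q` in the first period from `K * n` on. Along `a + q * l` the
  -- roots of unity drop out, leaving power sums of the `1`-units `(β / ω) ^ q`; and `a ≥ K * n`
  -- keeps the initial ones at most `ρ ^ (K * n)`.
  set a := K * n + (j - K * n) % q with ha
  have hmod : (j - K * n) % q < q := Nat.mod_lt _ hq0
  have hja : j = a + q * ((j - K * n) / q) := by
    rw [ha, add_assoc, Nat.mod_add_div]
    omega
  have hpow (l : ℕ) : ∑ I ∈ D.idealsPrimeTo hk v n,
      algebraMap k v.Cp (b I) * D.idealOneSigma σ I ^ (a + q * l) =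
      ∑ I ∈ D.idealsPrimeTo hk v n, (algebraMap k v.Cp (b I) * D.idealOneSigma σ I ^ a) *
        ((D.idealOneSigma σ I / D.omega v σ (D.idealOneSigma σ I)) ^ q) ^ l := by
    refine Finset.sum_congr rfl fun I hI => ?_
    have h1 := (D.omega_spec σ (D.norm_algHom_idealOneV_eq_one p hk hv σ
      (D.mem_idealsPrimeTo.1 hI).2)).1
    rw [div_pow, h1, div_one, pow_add, pow_mul, mul_assoc]
  have h1 := norm_sum_mul_pow_le (s := D.idealsPrimeTo hk v n)
    (b := fun I => algebraMap k v.Cp (b I) * D.idealOneSigma σ I ^ a)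
    (u := fun I => (D.idealOneSigma σ I / D.omega v σ (D.idealOneSigma σ I)) ^ q)
    (ρ := ρ') (B := 1) (η := ρ ^ (K * n)) (M := K * n) hρ'0.le hρ'1.le (fun I hI => ?_) zero_le_one
    (fun I hI => ?_) (by positivity) (fun l hl => ?_) ((j - K * n) / q)
  · rw [← hpow, ← hja, one_mul] at h1
    exact h1.trans (max_le (pow_le_pow_left₀ hρ0.le (le_max_left _ _) _)
      (pow_le_pow_left₀ hρ'0.le (le_max_right _ _) _))
  · have h2 := hρ' I (D.mem_idealsPrimeTo.1 hI).2
    exact (norm_pow_sub_one_le (norm_eq_one_of_norm_sub_one_lt (h2.trans_lt hρ'1)).le q).trans h2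
  · rw [norm_mul, norm_pow, v.norm_algebraMap_cp,
      D.norm_algHom_idealOneV_eq_one p hk hv σ (D.mem_idealsPrimeTo.1 hI).2, one_pow, mul_one]
    exact D.norm_algebraMap_coeff_le hv _
  · rw [← hpow]
    refine (hn (a + q * l) ?_).trans (pow_le_pow_of_le_one hρ0.le hρ1.le (by omega))
    have h2 : q * l ≤ q * (K * n) := Nat.mul_le_mul_left _ hl.le
    have h3 : q ≤ q * n := Nat.le_mul_of_pos_right _ hn0
    calc a + q * l < K * n + q * n + q * (K * n) := by omega
      _ = (K + q + q * K) * n := by ring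

/-- The power series in `x⁻¹` given by the `v`-adic interpolation. -/
def formalSeriesV (b : D.Ideals → D.A) (y : D.SSigma v σ p) : v.Cp⟦X⟧ :=
  PowerSeries.mk fun n => ∑ᶠ I : {I : D.IdealsPrimeTo v // D.degI I.1 = n},
    algebraMap k v.Cp (b I.1.1) * D.unitPow v σ (D.idealOneSigma σ I.1.1) (-y)

/-- The exponent `-y` is approximated by an integer `j ≥ K * n` with the same second component,
`p`-adically so close that the error is below `δ ^ (K * n)`; the power sum at `j` is already
controlled. -/
theorem exists_norm_coeff_formalSeriesV_le (hk : IsGlobalFunctionField Fq k)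
    {b : D.Ideals → D.A} (hb : D.IsMotivic p b) (hv : v ≠ D.inf) :
    ∃ δ : ℝ, 0 < δ ∧ δ < 1 ∧ ∀ K : ℕ, ∀ᶠ n : ℕ in atTop, ∀ y : D.SSigma v σ p,
      ‖PowerSeries.coeff n (D.formalSeriesV σ b y)‖ ≤ δ ^ (K * n) := by
  have := v.charP_cp (Fq := Fq) p
  obtain ⟨δ, hδ0, hδ1, hδ⟩ := D.exists_norm_sum_idealOneSigma_le σ hk hb hv
  obtain ⟨ρ, hρ0, hρ1, hρ⟩ := D.exists_norm_div_omega_sub_one_le σ p hk hv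
  have hQ := D.one_lt_sigmaCard σ
  refine ⟨δ, hδ0, hδ1, fun K => ?_⟩
  filter_upwards [hδ K] with n hn y
  obtain ⟨s, hs⟩ := ((tendsto_pow_prime_pow (p := p) hρ0.le hρ1).eventually_lt_const
    (pow_pos hδ0 (K * n))).exists
  obtain ⟨j, hj, hj2, hj1⟩ := exists_natCast_approx (q := D.sigmaCard v σ - 1) (by omega)
    (D.coprime_sigmaCard_sub_one σ p) (-y) s (K * n)
  have h1 : PowerSeries.coeff n (D.formalSeriesV σ b y) =
      ∑ I ∈ D.idealsPrimeTo hk v n,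
        algebraMap k v.Cp (b I) * (D.unitPow v σ (D.idealOneSigma σ I) (-y) -
          D.idealOneSigma σ I ^ j) +
      ∑ I ∈ D.idealsPrimeTo hk v n, algebraMap k v.Cp (b I) * D.idealOneSigma σ I ^ j := by
    rw [formalSeriesV, PowerSeries.coeff_mk, D.finsum_idealsPrimeTo hk
      (fun I => algebraMap k v.Cp (b I) * D.unitPow v σ (D.idealOneSigma σ I) (-y)),
      ← Finset.sum_add_distrib]
    refine Finset.sum_congr rfl fun I _ => ?_
    ring
  rw [h1]
  refine (IsUltrametricDist.norm_add_le_max _ _).trans (max_le ?_ (hn j hj))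
  refine IsUltrametricDist.norm_sum_le_of_forall_le_of_nonneg (by positivity) fun I hI => ?_
  have hI' := (D.mem_idealsPrimeTo.1 hI).2
  rw [norm_mul]
  refine (mul_le_of_le_one_left (norm_nonneg _) (D.norm_algebraMap_coeff_le hv _)).trans ?_
  refine (D.norm_unitPow_sub_pow_le hQ (D.omega_spec σ (D.norm_algHom_idealOneV_eq_one p hk hv σ
      hI')).1 ((hρ I hI').trans_lt hρ1) hj2 hj1).trans (le_trans ?_ hs.le)
  exact pow_le_pow_left₀ (norm_nonneg _) (hρ I hI') _

/-- At `v` the coefficients are integral and the unit powers have norm `1`, so any bound `t > 1`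
would do. -/
theorem hasHalfPlane_termV (hk : IsGlobalFunctionField Fq k) (b : D.Ideals → D.A) (hv : v ≠ D.inf) :
    HasHalfPlane (fun I : D.IdealsPrimeTo v => D.degI I.1) (D.termV (p := p) v σ b) := by
  have := v.charP_cp (Fq := Fq) p
  have hQ := D.one_lt_sigmaCard σ
  obtain ⟨ρ, hρ0, hρ1, hρ⟩ := D.exists_norm_div_omega_sub_one_le σ p hk hv
  refine ⟨2, two_pos, fun s hs => ?_⟩
  unfold AbsConverges
  refine squeeze_zero_norm (a := fun I : D.IdealsPrimeTo v => (1 / 2 : ℝ) ^ D.degI I.1) (fun I => ?_)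
    ((tendsto_pow_atTop_nhds_zero_of_lt_one (by norm_num) (by norm_num)).comp tendsto_comap)
  unfold termV idealPowV
  rw [norm_mul, norm_mul, D.norm_unitPow hQ (D.omega_spec σ
    (D.norm_algHom_idealOneV_eq_one p hk hv σ I.2)).1 ((hρ I.1 I.2).trans_lt hρ1), mul_one, norm_pow,
    Units.val_inv_eq_inv_val, norm_inv]
  refine (mul_le_of_le_one_left (by positivity) (D.norm_algebraMap_coeff_le hv _)).trans ?_
  refine pow_le_pow_left₀ (by positivity) ?_ _
  rw [one_div]
  exact inv_anti₀ two_pos hs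

/-- The sums are `A`-integral in `𝕍` and at most exponentially large at `∞`, so a nonzero one is at
least exponentially small at `v`, contradicting super-exponential decay. -/
theorem eventually_sum_idealsPrimeTo_eq_zero (hk : IsGlobalFunctionField Fq k)
    {b : D.Ideals → D.A} (hb : D.IsMotivic p b) (hv : v ≠ D.inf) (j : ℕ) {δ : ℝ} (hδ0 : 0 < δ)
    (hδ1 : δ < 1) (hδ : ∀ K : ℕ, ∀ᶠ n : ℕ in atTop,
      ‖σ (∑ I ∈ D.idealsPrimeTo hk v n, algebraMap k D.valueField (b I) * D.idealOneV I ^ j)‖ ≤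
        δ ^ (K * n)) :
    ∀ᶠ n : ℕ in atTop,
      ∑ I ∈ D.idealsPrimeTo hk v n, algebraMap k D.valueField (b I) * D.idealOneV I ^ j = 0 := by
  obtain ⟨m, hm⟩ := D.exists_abs_coeff_le hk hb.1
  obtain ⟨θ, hθ0, hθ1, hθ⟩ := D.exists_pow_le_abs hk hv
  have hr : (1 : ℝ) ≤ Nat.card Fq := Nat.one_le_cast.2 Nat.card_pos
  -- This `K` makes the decay at `v` faster than the lower bound of `pow_le_norm_algHom` with `H = n
  -- * (2 * m + j)`.
  obtain ⟨K, hK⟩ := exists_pow_mul_lt (X := 1) hδ0.le hδ1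
    (pow_pos hθ0 ((2 * m + j) * Module.finrank k D.valueField))
  rw [one_mul] at hK
  filter_upwards [hδ K, eventually_gt_atTop 0] with n hn hn0
  by_contra hne
  have hint : IsIntegral D.A ((∑ I ∈ D.idealsPrimeTo hk v n,
      algebraMap k D.valueField (b I) * D.idealOneV I ^ j : D.valueField) : D.inf.Cp) := by
    have h1 : ((∑ I ∈ D.idealsPrimeTo hk v n,
        algebraMap k D.valueField (b I) * D.idealOneV I ^ j : D.valueField) : D.inf.Cp) =
        ∑ I ∈ D.idealsPrimeTo hk v n, algebraMap D.A D.inf.Cp (b I) * D.idealOne I ^ j := by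
      change algebraMap D.valueField D.inf.Cp _ = _
      rw [map_sum]
      refine Finset.sum_congr rfl fun I _ => ?_
      rw [map_mul, map_pow]
      rfl
    rw [h1]
    exact IsIntegral.sum _ fun I _ =>
      isIntegral_algebraMap.mul ((D.isIntegral_idealOne p hk I).pow j)
  -- At `∞` a term is at most `r ^ (m * (n + 1) + n * j)`, and `m ≤ m * n` for `n > 0`.
  have h1 := D.pow_le_norm_algHom hv hθ σ hint hne (H := n * (2 * m + j)) fun τ => ?_
  · have h2 := h1.trans hn
    rw [show n * (2 * m + j) * Module.finrank k D.valueField =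
      (2 * m + j) * Module.finrank k D.valueField * n by ring, pow_mul _ _ n, pow_mul δ] at h2
    exact absurd h2 (not_le.2 (pow_lt_pow_left₀ hK (by positivity) hn0.ne'))
  · rw [map_sum]
    refine IsUltrametricDist.norm_sum_le_of_forall_le_of_nonneg (by positivity) fun I hI => ?_
    have hI' := (D.mem_idealsPrimeTo.1 hI).1
    rw [map_mul, AlgHom.commutes, map_pow, norm_mul, norm_pow, D.inf.norm_algebraMap_k_algCl,
      D.norm_algHom_inf_idealOneV p hk]
    refine (mul_le_mul_of_nonneg_right (hm I) (by positivity)).trans ?_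
    rw [hI', ← pow_mul, ← pow_add]
    refine pow_le_pow_right₀ hr ?_
    have h3 : m ≤ m * n := Nat.le_mul_of_pos_right _ hn0
    calc m * (n + 1) + n * j = m * n + m + n * j := by ring
      _ ≤ m * n + m * n + n * j := by omega
      _ = n * (2 * m + j) := by ring

theorem exists_entire_finite (hk : IsGlobalFunctionField Fq k) {b : D.Ideals → D.A}
    (hb : D.IsMotivic p b) (hv : v ≠ D.inf) : ∃ g : D.SSigma v σ p → v.Cp⟦X⟧,
      IsEntireFamily g ∧
      Continues (fun I : D.IdealsPrimeTo v => D.degI I.1) (D.termV v σ b) g ∧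
      D.IsEssAlgebraicV v σ g := by
  have := v.charP_cp (Fq := Fq) p
  have hQ := D.one_lt_sigmaCard σ
  obtain ⟨ρ, hρ0, hρ1, hρ⟩ := D.exists_norm_div_omega_sub_one_le σ p hk hv
  obtain ⟨δ, hδ0, hδ1, hδ⟩ := D.exists_norm_coeff_formalSeriesV_le σ hk hb hv
  have hω (I : D.Ideals) (hI : ∃ c ∈ I.1, v.abs (c : k) = 1) :=
    (D.omega_spec σ (D.norm_algHom_idealOneV_eq_one p hk hv σ hI)).1
  have hu (I : D.Ideals) (hI : ∃ c ∈ I.1, v.abs (c : k) = 1) := (hρ I hI).trans_lt hρ1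
  have hcoeff (y : D.SSigma v σ p) (n : ℕ) : PowerSeries.coeff n (D.formalSeriesV σ b y) =
      ∑ᶠ I : {I : D.IdealsPrimeTo v // D.degI I.1 = n},
        algebraMap k v.Cp (b I.1.1) * D.unitPow v σ (D.idealOneSigma σ I.1.1) (-y) :=
    PowerSeries.coeff_mk _ _
  refine ⟨D.formalSeriesV σ b, ?_, ?_, fun j => ?_⟩
  · refine isEntireFamily_of_coeff (deg := fun I : D.IdealsPrimeTo v => D.degI I.1)
      (c := fun I y => algebraMap k v.Cp (b I.1) * D.unitPow v σ (D.idealOneSigma σ I.1) (-y))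
      (D.finite_degI_primeTo hk) hcoeff (fun I ε hε => ?_) ?_
    · obtain ⟨U, hU, h⟩ := D.exists_nhds_norm_unitPow_sub_lt (p := p) hQ (hω I.1 I.2) (hu I.1 I.2) hε
      -- The neighbourhood is reflected because the exponents occurring are `-y`.
      refine ⟨-U, by simpa using neg_mem_nhds_zero _ hU, fun y₀ y₁ hy => ?_⟩
      have h1 := h (-y₀) (-y₁) (by
        rw [Set.mem_neg] at hy
        convert hy using 1
        abel)
      rw [← mul_sub, norm_mul]
      exact (mul_le_of_le_one_left (norm_nonneg _) (D.norm_algebraMap_coeff_le hv _)).trans_lt h1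
    · intro R hR ε hε
      exact eventually_mul_pow_le_of_forall (A := 1) (X := 1) zero_le_one hδ0.le hδ1
        (by simpa using hδ) hR hε
  · refine continues_of_coeff (deg := fun I : D.IdealsPrimeTo v => D.degI I.1)
      (L := D.termV (p := p) v σ b)
      (c := fun (I : D.IdealsPrimeTo v) (y : D.SSigma v σ p) => algebraMap k v.Cp (b I.1) *
        D.unitPow v σ (D.idealOneSigma σ I.1) (-y)) (D.hasHalfPlane_termV σ hk b hv) (fun s I => ?_)
      (D.finite_degI_primeTo hk) hcoeff
    exact mul_left_comm _ _ _
  -- At `y = -j` each coefficient is the image of an element of `𝕍`; vanishing of all but finitely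
  -- many yields the polynomial.
  · set x : ℕ → D.valueField := fun n =>
      ∑ I ∈ D.idealsPrimeTo hk v n, algebraMap k D.valueField (b I) * D.idealOneV I ^ j with hx
    have h1 (n : ℕ) : PowerSeries.coeff n (D.formalSeriesV σ b (-(j : D.SSigma v σ p))) =
        algebraMap v.AlgCl v.Cp (σ (x n)) := by
      rw [hcoeff, D.finsum_idealsPrimeTo hk (fun I => algebraMap k v.Cp (b I) *
        D.unitPow v σ (D.idealOneSigma σ I) (- -(j : D.SSigma v σ p))), hx]
      simp only [map_sum, map_mul, map_pow, AlgHom.commutes, ← IsScalarTower.algebraMap_apply, neg_neg]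
      refine Finset.sum_congr rfl fun I hI => ?_
      have hI' := (D.mem_idealsPrimeTo.1 hI).2
      rw [D.unitPow_natCast hQ (hω I hI') (hu I hI')]
    have h2 : ∀ᶠ n in atTop, x n = 0 :=
      D.eventually_sum_idealsPrimeTo_eq_zero σ hk hb hv j hδ0 hδ1 fun K => by
        filter_upwards [hδ K] with n hn
        rw [← v.norm_algebraMap_cp, ← h1]
        exact hn _
    obtain ⟨n₀, hn₀⟩ := eventually_atTop.1 h2
    refine ⟨∑ n ∈ Finset.range n₀, Polynomial.monomial n (x n), ?_⟩
    ext n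
    rw [h1, Polynomial.coeff_coe, Polynomial.coeff_map, Polynomial.finsetSum_coeff]
    simp only [Polynomial.coeff_monomial, Finset.sum_ite_eq', Finset.mem_range]
    split_ifs with h
    · rfl
    · rw [hn₀ n (not_lt.1 h), map_zero, map_zero, map_zero]

end Sums

end Datum
end
-- The main theorem.
theorem theorem4p2 {p : ℕ} [Fact p.Prime] {Fq k : Type*} [Field Fq] [Finite Fq] [CharP Fq p]
    [Field k] [Algebra Fq k] (hk : IsGlobalFunctionField Fq k) (D : Datum Fq k)
    (b : D.Ideals → D.A) (hb : D.IsMotivic p b) :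
    (∃ g : ℤ_[p] → D.inf.Cp⟦X⟧,
      IsEntireFamily g ∧ Continues D.degI (D.term b) g ∧ D.IsEssAlgebraic g) ∧
    ∀ (v : Place k), v ≠ D.inf → ∀ σ : D.valueField →ₐ[k] v.AlgCl,
      ∃ g : D.SSigma v σ p → v.Cp⟦X⟧,
        IsEntireFamily g ∧
        Continues (fun I : D.IdealsPrimeTo v => D.degI I.1) (D.termV v σ b) g ∧
        D.IsEssAlgebraicV v σ g := by
  have := D.finiteDimensional_valueField p hk
  exact ⟨D.exists_entire_inf hk hb, fun v hv σ => D.exists_entire_finite σ hk hb hv⟩
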